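/- Conventions. Let $\mathbb K=\mathbb R$ or $\mathbb C$ and let $M$ be a smooth (Hausdorff, finite-dimensional) manifold without boundary. $\mathrm{UConf}(M)=\bigsqcup_{k\ge 0}\mathrm{UConf}_k(M)$ is the manifold of finite subsets ("configurations") of $M$, where $\mathrm{UConf}_k(M)=\mathrm{OConf}_k(M)/S_k$ is the quotient of the open submanifold $\mathrm{OConf}_k(M)\subset M^k$ of tuples of distinct points, with the smooth structure for which $\mathrm{OConf}_k(M)\to\mathrm{UConf}_k(M)$ is a local diffeomorphism. Vector bundles are smooth $\mathbb K$-vector bundles of finite rank or, more generally, locally smooth unions of increasing sequences of subbundles of finite rank (ind-finite bundles); bundle maps are smooth and fibrewise linear. For bundles $\mathbf V,\mathbf W$ over $\mathrm{UConf}(M)$ there are the Hadamard product $(\mathbf V\otimes\mathbf W)_{\underline x}=\mathbf V_{\underline x}\otimes\mathbf W_{\underline x}$, with unit the trivial line bundle $\mathbf I_\otimes$, and the Cauchy product $$(\mathbf V\boxtimes\mathbf W)_{\underline x}=\bigoplus_{\underline x=\underline x'\sqcup\underline x''}\mathbf V_{\underline x'}\otimes\mathbf W_{\underline x''},$$ the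 sum being over ordered splits into disjoint configurations, with unit $\mathbf I_\boxtimes$, which is $\mathbb K$ over $\emptyset$ and $0$ elsewhere. A bundle map $f$ on $\mathbf V\boxtimes\mathbf W$ is given by its components $f(a_{\underline x},b_{\underline y})$ on $\mathbf V_{\underline x}\otimes\mathbf W_{\underline y}$, for disjoint $\underline x,\underline y$, with values over $\underline x\sqcup\underline y$. A commutative $2$-algebra bundle is a vector bundle $\mathbf P$ over $\mathrm{UConf}(M)$ with bundle maps $\odot:\mathbf P\otimes\mathbf P\to\mathbf P$, $\mathbf I_\otimes\to\mathbf P$ (with value $1_{\underline x}$ at $1$ over $\underline x$), $\boxdot:\mathbf P\boxtimes\mathbf P\to\mathbf P$ and $\mathbf I_\boxtimes\to\mathbf P$ such that both products are associative, commutative and unital, $(a_{\underline x}\odot b_{\underline x})\boxdot(c_{\underline y}\odot d_{\underline y})=(a_{\underline x}\boxdot c_{\underline y})\odot(b_{\underline x}\boxdot d_{\underline y})$ and $1_{\underline x}\boxdot 1_{\underline y}=1_{\underline x\sqcup\underline y}$ for disjoint $\underline x,\underline y$, and the $\boxtimes$-unit is $1_\emptyset$ (which satisfies $1_\emptyset\odot1_\emptyset=1_\emptyset$).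 It is a Poisson $2$-algebra bundle if it carries a bundle map $\{\ ,\ \}:\mathbf P\boxtimes\mathbf P\to\mathbf P$ such that, for all pairwise disjoint configurations, $$\{a_{\underline x},b_{\underline y}\}=-\{b_{\underline y},a_{\underline x}\},\qquad \{\{a_{\underline x},b_{\underline y}\},c_{\underline z}\}+\{\{b_{\underline y},c_{\underline z}\},a_{\underline x}\}+\{\{c_{\underline z},a_{\underline x}\},b_{\underline y}\}=0,$$ $$\{a_{\underline x},b_{\underline y}\boxdot c_{\underline z}\}=\{a_{\underline x},b_{\underline y}\}\boxdot c_{\underline z}+b_{\underline y}\boxdot\{a_{\underline x},c_{\underline z}\},$$ $$\{a_{\underline x},b_{\underline y}\odot c_{\underline y}\}=\{a_{\underline x},b_{\underline y}\}\odot(1_{\underline x}\boxdot c_{\underline y})+(1_{\underline x}\boxdot b_{\underline y})\odot\{a_{\underline x},c_{\underline y}\}.$$ For a vector bundle $V$ on $M$, let $S^\otimes(V)$ be its fibrewise symmetric algebra. The Cauchy-Hadamard bundle $\mathbf S^\boxtimes S^\otimes(V)$ over $\mathrm{UConf}(M)$ has as fibre over $\underline x=\{x_1,\dots,x_k\}$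 the tensor product of the algebras $S(V_{x_1}),\dots,S(V_{x_k})$ over the unordered set $\underline x$ (equivalently, the quotient by $S_k$ of $\bigoplus_{\sigma\in S_k}S(V_{x_{\sigma(1)}})\otimes\cdots\otimes S(V_{x_{\sigma(k)}})$). Its product $\odot$ is the product of this tensor product of algebras, $1_{\underline x}$ is the unit of the latter, $\boxdot$ is the juxtaposition of tensors over disjoint configurations, and the $\boxtimes$-unit is $1_\emptyset$. Write $V\boxtimes V$ for the bundle over $\mathrm{UConf}_2(M)$ with fibre $(V_x\otimes V_y)\oplus(V_y\otimes V_x)$ over $\{x,y\}$. Theorem. Let $V$ be a vector bundle on $M$ and let $k:V\boxtimes V\to\mathrm{UConf}_2(M)\times\mathbb K$ be an antisymmetric bundle map over $\mathrm{UConf}_2(M)$, i.e. $k(u_x,v_y)=-k(v_y,u_x)$ for $x\ne y$, $u_x\in V_x$, $v_y\in V_y$. Then $\mathbf S^\boxtimes S^\otimes(V)$, with the above operations, is a commutative $2$-algebra bundle over $\mathrm{UConf}(M)$, and there is exactly one bracket $\{\ ,\ \}:\mathbf S^\boxtimes S^\otimes(V)\boxtimes\mathbf S^\boxtimes S^\otimes(V)\to\mathbf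 S^\boxtimes S^\otimes(V)$ (fibrewise linear) such that, for all pairwise disjoint configurations $\underline x,\underline y,\underline z$ and all vectors over them, 1. $\{1_{\underline x},1_{\underline y}\}=\{a_{\underline x},1_{\underline y}\}=\{1_{\underline y},a_{\underline x}\}=0$; 2. $\{u_x,v_y\}=k(u_x,v_y)\,1_x\boxdot 1_y$ for points $x\ne y$ of $M$ and generators $u_x\in V_x$, $v_y\in V_y$; 3. the Leibniz rules hold in both arguments with respect to $\odot$, $$\{a_{\underline x}\odot b_{\underline x},c_{\underline y}\}=\{a_{\underline x},c_{\underline y}\}\odot(b_{\underline x}\boxdot1_{\underline y})+(a_{\underline x}\boxdot1_{\underline y})\odot\{b_{\underline x},c_{\underline y}\},$$ $$\{a_{\underline x},b_{\underline y}\odot c_{\underline y}\}=\{a_{\underline x},b_{\underline y}\}\odot(1_{\underline x}\boxdot c_{\underline y})+(1_{\underline x}\boxdot b_{\underline y})\odot\{a_{\underline x},c_{\underline y}\},$$ and with respect to $\boxdot$, $$\{a_{\underline x}\boxdot b_{\underline y},c_{\underline z}\}=\{a_{\underline x},c_{\underline z}\}\boxdot b_{\underline y}+a_{\underline x}\boxdot\{b_{\underline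 y},c_{\underline z}\},\qquad\{a_{\underline x},b_{\underline y}\boxdot c_{\underline z}\}=\{a_{\underline x},b_{\underline y}\}\boxdot c_{\underline z}+b_{\underline y}\boxdot\{a_{\underline x},c_{\underline z}\}.$$ This bracket is a smooth bundle map, and it makes $\mathbf S^\boxtimes S^\otimes(V)$ a Poisson $2$-algebra bundle over $\mathrm{UConf}(M)$. -/

import Mathlib

open scoped TensorProduct Manifold ContDiff Topology

noncomputable section

universe u v w

/-! ## The unordered configuration space

A configuration of `M` is a finite subset of `M`, so `UConf(M)` is the type `Finset M`, and
`UConf_k(M)` consists of the finite sets with `k` elements. -/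

/-- The configuration underlying a tuple of points (the map `q_k` on tuples of distinct points). -/
def conf {M : Type u} {n : ℕ} (p : Fin n → M) : Finset M := (Set.finite_range p).toFinset

/-- The topology of `UConf(M) = ⨆ OConf_k(M) / S_k` : the disjoint union of the quotient
topologies, i.e. the final topology for the maps `q_k : OConf_k(M) → UConf(M)`, where
`OConf_k(M) ⊆ M ^ k` is the subspace of the tuples of distinct points. -/
instance uconfTopology (M : Type u) [TopologicalSpace M] : TopologicalSpace (Finset M) :=
  ⨆ k : ℕ, TopologicalSpace.coinduced
    (fun p : {p : Fin k → M // Function.Injective p} => conf p.1) inferInstance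

section Smooth

variable (𝕜 : Type) [RCLike 𝕜]
  {E : Type v} [NormedAddCommGroup E] [NormedSpace ℝ E] {H : Type w} [TopologicalSpace H]
  (I : ModelWithCorners ℝ E H) {M : Type u} [TopologicalSpace M] [ChartedSpace H M]

/-- Smoothness at a point of scalar functions on the manifold `M`. -/
def SmoothM (f : M → 𝕜) (x : M) : Prop := ContMDiffAt I 𝓘(ℝ, 𝕜) ∞ f x

/-- Smoothness at a configuration of scalar functions on `UConf(M)`. The smooth structure of
`UConf_k(M) = OConf_k(M) / S_k` is the one for which `q_k` is a local diffeomorphism, so `f` is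
smooth at `x` iff `f ∘ q_k` is smooth at the tuples `p ∈ OConf_k(M)` over `x`, where `OConf_k(M)`
is an open submanifold of the product manifold `M ^ k`. -/
def SmoothU (f : Finset M → 𝕜) (x : Finset M) : Prop :=
  ∀ p : Fin x.card → M, Function.Injective p → conf p = x →
    ContMDiffAt (ModelWithCorners.pi fun _ : Fin x.card => I) 𝓘(ℝ, 𝕜) ∞
      (fun q : Fin x.card → M => f (conf q)) p

end Smooth

/-! ## Bundles -/

/-- A family of `𝕜`-vector spaces over `X` together with the datum of which of its
(set-theoretic) sections are smooth at which points. The laws are in `IsVectorBundle`. -/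
structure PreBundle (𝕜 : Type) [RCLike 𝕜] (X : Type u) : Type (max u (v + 1)) where
  fib : X → Type v
  [grp : ∀ x, AddCommGroup (fib x)]
  [mod : ∀ x, Module 𝕜 (fib x)]
  SmoothAt : (∀ x, fib x) → X → Prop

attribute [instance] PreBundle.grp PreBundle.mod

/-- The symmetric algebra of a `𝕜`-vector space, i.e. Mathlib's `SymmetricAlgebra`. (A separate
name, so that its additive and its multiplicative structure come from the same instances.) -/
def FibSym (𝕜 : Type) [RCLike 𝕜] (V : Type v) [AddCommGroup V] [Module 𝕜 V] : Type v :=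
  SymmetricAlgebra 𝕜 V

instance FibSym.commRing (𝕜 : Type) [RCLike 𝕜] (V : Type v) [AddCommGroup V] [Module 𝕜 V] :
    CommRing (FibSym 𝕜 V) :=
  inferInstanceAs (CommRing (SymmetricAlgebra 𝕜 V))

instance FibSym.algebra (𝕜 : Type) [RCLike 𝕜] (V : Type v) [AddCommGroup V] [Module 𝕜 V] :
    Algebra 𝕜 (FibSym 𝕜 V) :=
  inferInstanceAs (Algebra 𝕜 (SymmetricAlgebra 𝕜 V))

/-- The inclusion `V → S(V)`. -/
def FibSym.ι (𝕜 : Type) [RCLike 𝕜] (V : Type v) [AddCommGroup V] [Module 𝕜 V] :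
    V →ₗ[𝕜] FibSym 𝕜 V :=
  SymmetricAlgebra.ι 𝕜 V

section Bundles

variable {𝕜 : Type} [RCLike 𝕜] {X : Type u} [TopologicalSpace X]

/-- `V` is a smooth `𝕜`-vector bundle over `X` which is the union of an increasing sequence
`F 0 ⊆ F 1 ⊆ ...` of subbundles of finite (locally constant) rank: every `F n` has, near every
point, a finite frame in which smoothness of sections of `F n` is smoothness of the coordinates,
and every smooth section of `V` is locally a section of some `F n`.
(The vector bundles of finite rank are those for which `F` can be taken constant.)
Here `sm` is the notion of smoothness of scalar functions on `X`. -/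
def IsVectorBundle (sm : (X → 𝕜) → X → Prop) (V : PreBundle.{u, v} 𝕜 X) : Prop :=
  (∀ (s t : ∀ x, V.fib x) (x : X), (∀ᶠ y in 𝓝 x, s y = t y) → V.SmoothAt s x → V.SmoothAt t x) ∧
  ∃ F : ℕ → ∀ x, Submodule 𝕜 (V.fib x),
    (∀ x, Monotone fun n => F n x) ∧
    (∀ x (v : V.fib x), ∃ n, v ∈ F n x) ∧
    (∀ (s : ∀ x, V.fib x) (x : X), V.SmoothAt s x → ∃ n, ∀ᶠ y in 𝓝 x, s y ∈ F n y) ∧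
    ∀ (n : ℕ) (x : X), ∃ (r : ℕ) (e : Fin r → ∀ y, V.fib y), ∀ᶠ y in 𝓝 x,
      LinearIndependent 𝕜 (fun i => e i y) ∧
      Submodule.span 𝕜 (Set.range fun i => e i y) = F n y ∧
      ∀ f : Fin r → X → 𝕜,
        V.SmoothAt (fun z => ∑ i, f i z • e i z) y ↔ ∀ i, sm (f i) y

/-- A family of fibrewise linear maps is a (smooth) bundle map if it maps smooth local sections
to smooth local sections. -/
def IsBundleMap {V : PreBundle.{u, v} 𝕜 X} {W : PreBundle.{u, w} 𝕜 X}
    (f : ∀ x, V.fib x →ₗ[𝕜] W.fib x) : Prop :=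
  ∀ (s : ∀ x, V.fib x) (x : X), V.SmoothAt s x → W.SmoothAt (fun y => f y (s y)) x

/-- The smooth structure generated by a set of distinguished local sections: `s` is smooth at `x`
if near `x` it is a finite combination, with smooth coefficients, of sections in `G`. -/
def GenSmoothAt (sm : (X → 𝕜) → X → Prop) {fib : X → Type v} [∀ x, AddCommGroup (fib x)]
    [∀ x, Module 𝕜 (fib x)] (G : (∀ x, fib x) → X → Prop) (s : ∀ x, fib x) (x : X) : Prop :=
  ∃ (n : ℕ) (f : Fin n → X → 𝕜) (g : Fin n → ∀ y, fib y),
    (∀ j, sm (f j) x) ∧ (∀ j, G (g j) x) ∧ ∀ᶠ y in 𝓝 x, s y = ∑ j, f j y • g j y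

/-- The Hadamard (i.e. fibrewise) tensor product, with smooth sections generated by the `v ⊗ w`
with `v` and `w` smooth. -/
@[reducible] def hadamard (sm : (X → 𝕜) → X → Prop) (V : PreBundle.{u, v} 𝕜 X)
    (W : PreBundle.{u, w} 𝕜 X) : PreBundle.{u, max v w} 𝕜 X where
  fib x := V.fib x ⊗[𝕜] W.fib x
  SmoothAt := GenSmoothAt sm fun s x => ∃ (v : ∀ y, V.fib y) (w : ∀ y, W.fib y),
    V.SmoothAt v x ∧ W.SmoothAt w x ∧ s = fun y => v y ⊗ₜ[𝕜] w y

/-- The Hadamard unit: the trivial line bundle. -/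
@[reducible] def trivialLine (sm : (X → 𝕜) → X → Prop) : PreBundle.{u, 0} 𝕜 X where
  fib _ := 𝕜
  SmoothAt := sm

/-- The (Hadamard) symmetric bundle `S^⊗(V)`: the fibre over `x` is the symmetric algebra of `V_x`,
and the smooth sections are generated by the finite products (including the empty one) of
smooth sections of `V`. -/
@[reducible] def symBundle (sm : (X → 𝕜) → X → Prop) (V : PreBundle.{u, v} 𝕜 X) :
    PreBundle.{u, v} 𝕜 X where
  fib x := FibSym 𝕜 (V.fib x)
  SmoothAt := GenSmoothAt sm fun s x => ∃ l : List (∀ y, V.fib y),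
    (∀ v ∈ l, V.SmoothAt v x) ∧ s = fun y => (l.map fun v => FibSym.ι 𝕜 _ (v y)).prod

end Bundles

/-! ## Bundles over the configuration space -/

section Conf

variable {M : Type u}

/-- `w = x ⊔ y` with `x` and `y` disjoint. -/
def IsSplit (w x y : Finset M) : Prop := Disjoint x y ∧ ∀ a, a ∈ w ↔ a ∈ x ∨ a ∈ y

lemma IsSplit.symm {w x y : Finset M} (h : IsSplit w x y) : IsSplit w y x :=
  ⟨h.1.symm, fun a => (h.2 a).trans or_comm⟩

/-- The ordered splits `w = w' ⊔ w''`. -/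
abbrev Splits (w : Finset M) : Type u := {p : Finset M × Finset M // IsSplit w p.1 p.2}

instance Splits.finite (w : Finset M) : Finite (Splits w) := by
  classical
  refine Finite.of_injective
    (fun p : Splits w => ((⟨p.1.1, ?_⟩, ⟨p.1.2, ?_⟩) : w.powerset × w.powerset)) ?_
  · exact Finset.mem_powerset.2 fun a ha => (p.2.2 a).2 (Or.inl ha)
  · exact Finset.mem_powerset.2 fun a ha => (p.2.2 a).2 (Or.inr ha)
  · intro p q h
    simp only [Prod.mk.injEq, Subtype.mk.injEq] at h
    exact Subtype.ext (Prod.ext h.1 h.2)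

instance Splits.fintype (w : Finset M) : Fintype (Splits w) := Fintype.ofFinite _

variable {𝕜 : Type} [RCLike 𝕜]

/-- The extension `i_* V` of a bundle on `M = UConf_1(M)` by zero: the index type of the product
has exactly one element if `x` is a one-point configuration and is empty otherwise. -/
@[reducible] def pushforward (V : PreBundle.{u, v} 𝕜 M) : PreBundle.{u, max u v} 𝕜 (Finset M) where
  fib x := ∀ a : {a : M // x = {a}}, V.fib a.1
  SmoothAt s x := ∀ a : M, x = {a} → V.SmoothAt (fun b => s {b} ⟨b, rfl⟩) a

open Classical in
/-- A vector of `V_a`, as a vector of `i_* V` over the configuration `{a}`. -/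
def pushforwardMk (V : PreBundle.{u, v} 𝕜 M) (a : M) (u : V.fib a) : (pushforward V).fib {a} :=
  Pi.single (M := fun c : {c : M // ({a} : Finset M) = {c}} => V.fib c.1) ⟨a, rfl⟩ u

/-- The fibre of the Cauchy tensor product `V ⊠ W` over `w`: the direct sum, over the (finitely
many) ordered splits `w = w' ⊔ w''`, of `V_{w'} ⊗ W_{w''}`. -/
abbrev CauchyFib (V : PreBundle.{u, v} 𝕜 (Finset M)) (W : PreBundle.{u, w} 𝕜 (Finset M))
    (x : Finset M) : Type (max u v w) :=
  ∀ p : Splits x, V.fib p.1.1 ⊗[𝕜] W.fib p.1.2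

open Classical in
/-- The vector `a ⊗ b ∈ V_x ⊗ W_y` as an element of the summand of `(V ⊠ W)_z` belonging to
the split `z = x ⊔ y`. -/
def cauchyMk {V : PreBundle.{u, v} 𝕜 (Finset M)} {W : PreBundle.{u, w} 𝕜 (Finset M)}
    {z x y : Finset M} (h : IsSplit z x y) (a : V.fib x) (b : W.fib y) : CauchyFib V W z :=
  Pi.single (M := fun p : Splits z => V.fib p.1.1 ⊗[𝕜] W.fib p.1.2) ⟨(x, y), h⟩ (a ⊗ₜ[𝕜] b)

/-- The Cauchy unit `I_⊠`: `𝕜` over the empty configuration and `0` elsewhere. -/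
@[reducible] def cauchyUnit (𝕜 : Type) [RCLike 𝕜] (M : Type u) :
    PreBundle.{u, 0} 𝕜 (Finset M) where
  fib x := PLift (x = ∅) → 𝕜
  SmoothAt _ _ := True

section

variable [TopologicalSpace M] (sm : (Finset M → 𝕜) → Finset M → Prop)

/-- The Cauchy tensor product `V ⊠ W`. Its smooth sections are generated by the
sections `y ↦ ∑_{y = y' ⊔ y''} φ(y') ⊗ ψ(y'')` with `φ` and `ψ` smooth at all parts of the given
configuration; over `OConf(M)` these are the sums of external tensor products of smooth sections
(`φ` and `ψ` may be supported near a single part). -/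
@[reducible] def cauchy (V : PreBundle.{u, v} 𝕜 (Finset M)) (W : PreBundle.{u, w} 𝕜 (Finset M)) :
    PreBundle.{u, max u v w} 𝕜 (Finset M) where
  fib x := CauchyFib V W x
  SmoothAt := GenSmoothAt sm fun s x => ∃ (φ : ∀ y, V.fib y) (ψ : ∀ y, W.fib y),
    (∀ x' ⊆ x, V.SmoothAt φ x' ∧ W.SmoothAt ψ x') ∧
      s = fun (y : Finset M) (p : Splits y) => φ p.1.1 ⊗ₜ[𝕜] ψ p.1.2

/-- The Cauchy symmetric bundle `S^⊠(W)` of a bundle `W` on `M`. Its fibre over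
`x = {x_1, ..., x_k}` is `W_{x_1} ⊡ ... ⊡ W_{x_k}`, the tensor product of the fibres of `W` over
the unordered set of points of `x`; see `cauchySymEquiv` for its description as the quotient of
the Cauchy tensor power by the symmetric group. The smooth sections are generated by
`y ↦ ⊡_{a ∈ y} w(a)`, with `w` smooth at all points of the given configuration. -/
@[reducible] def cauchySym (W : PreBundle.{u, v} 𝕜 M) : PreBundle.{u, max u v} 𝕜 (Finset M) where
  fib x := ⨂[𝕜] a : {a : M // a ∈ x}, W.fib a.1
  SmoothAt := GenSmoothAt sm fun s x => ∃ w : ∀ a, W.fib a,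
    (∀ a ∈ x, W.SmoothAt w a) ∧
      s = fun (y : Finset M) => PiTensorProduct.tprod 𝕜 fun a : {a : M // a ∈ y} => w a.1

end

/-! ### The fibres of `S^⊠(W)` as coinvariants of the Cauchy tensor powers -/

section Coinvariants

variable (W : PreBundle.{u, v} 𝕜 M) (x : Finset M)

/-- The fibre `W_{x_1} ⊠ ... ⊠ W_{x_k}` of the Cauchy tensor power over `x = {x_1, ..., x_k}`: the
direct sum of the tensor products `W_{e(1)} ⊗ ... ⊗ W_{e(k)}` over the orderings `e` of `x`. -/
abbrev CauchyPowerFib : Type (max u v) :=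
  ∀ e : Fin x.card ≃ {a : M // a ∈ x}, ⨂[𝕜] i : Fin x.card, W.fib (e i).1

open Classical in
/-- The pure tensor `v_1 ⊗ ... ⊗ v_k` in the summand of the ordering `e`. -/
def cauchyPowerMk {x : Finset M} (e : Fin x.card ≃ {a : M // a ∈ x}) (v : ∀ i, W.fib (e i).1) :
    CauchyPowerFib W x :=
  Pi.single (M := fun e : Fin x.card ≃ {a : M // a ∈ x} => ⨂[𝕜] i : Fin x.card, W.fib (e i).1) e
    (PiTensorProduct.tprod 𝕜 v)

/-- The subspace spanned by the `v - σ(v)`, where `σ ∈ S_k` maps `v_1 ⊗ ... ⊗ v_k` to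
`v_{σ(1)} ⊗ ... ⊗ v_{σ(k)}`. -/
def cauchySymRel : Submodule 𝕜 (CauchyPowerFib W x) :=
  Submodule.span 𝕜 {t | ∃ (e : Fin x.card ≃ {a : M // a ∈ x}) (v : ∀ i, W.fib (e i).1)
    (σ : Equiv.Perm (Fin x.card)),
    t = cauchyPowerMk W e v - cauchyPowerMk W (σ.trans e) fun i => v (σ i)}

lemma exists_eq_comp {x : Finset M} (e : Fin x.card ≃ {a : M // a ∈ x}) (v : ∀ i, W.fib (e i).1) :
    ∃ s : ∀ a : {a : M // a ∈ x}, W.fib a.1, v = fun i => s (e i) :=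
  ⟨Equiv.piCongrLeft (fun a : {a : M // a ∈ x} => W.fib a.1) e v, by
    funext i; exact (Equiv.piCongrLeft_apply_apply (fun a : {a : M // a ∈ x} => W.fib a.1) e v i).symm⟩

lemma cauchyPowerMk_sub_mem {x : Finset M} (e e' : Fin x.card ≃ {a : M // a ∈ x})
    (s : ∀ a : {a : M // a ∈ x}, W.fib a.1) :
    cauchyPowerMk W e (fun i => s (e i)) - cauchyPowerMk W e' (fun i => s (e' i))
      ∈ cauchySymRel W x := by
  obtain ⟨σ, rfl⟩ : ∃ σ : Equiv.Perm (Fin x.card), e' = σ.trans e :=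
    ⟨e'.trans e.symm, by ext i; simp⟩
  exact Submodule.subset_span ⟨e, _, σ, rfl⟩

open Classical in
/-- Forget the ordering. -/
def cauchyPowerToSym : CauchyPowerFib W x →ₗ[𝕜] ⨂[𝕜] a : {a : M // a ∈ x}, W.fib a.1 :=
  ∑ e : Fin x.card ≃ {a : M // a ∈ x},
    (PiTensorProduct.reindex 𝕜 (fun a : {a : M // a ∈ x} => W.fib a.1) e.symm).symm.toLinearMap
      ∘ₗ LinearMap.proj e

lemma cauchyPowerToSym_mk {x : Finset M} (e : Fin x.card ≃ {a : M // a ∈ x})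
    (s : ∀ a : {a : M // a ∈ x}, W.fib a.1) :
    cauchyPowerToSym W x (cauchyPowerMk W e fun i => s (e i)) = PiTensorProduct.tprod 𝕜 s := by
  classical
  unfold cauchyPowerToSym cauchyPowerMk
  rw [LinearMap.sum_apply, Finset.sum_eq_single e]
  · refine (LinearEquiv.symm_apply_eq _).2 ?_
    rw [PiTensorProduct.reindex_tprod, LinearMap.proj_apply, Pi.single_eq_same]
    rfl
  · intro e' _ he
    rw [LinearMap.comp_apply, LinearMap.proj_apply, Pi.single_eq_of_ne he]
    exact map_zero _
  · exact fun h => absurd (Finset.mem_univ e) h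

lemma cauchySymRel_le_ker : cauchySymRel W x ≤ LinearMap.ker (cauchyPowerToSym W x) := by
  refine Submodule.span_le.2 ?_
  rintro _ ⟨e, v, σ, rfl⟩
  obtain ⟨s, rfl⟩ := exists_eq_comp W e v
  refine LinearMap.mem_ker.2 ?_
  rw [map_sub, cauchyPowerToSym_mk]
  exact sub_eq_zero.2 (cauchyPowerToSym_mk W (σ.trans e) s).symm

open Classical in
/-- The inclusion of the summand of one chosen ordering. -/
def symToCauchyPower : (⨂[𝕜] a : {a : M // a ∈ x}, W.fib a.1) →ₗ[𝕜] CauchyPowerFib W x :=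
  LinearMap.single 𝕜 (fun e : Fin x.card ≃ {a : M // a ∈ x} => ⨂[𝕜] i : Fin x.card, W.fib (e i).1)
      x.equivFin.symm
    ∘ₗ (PiTensorProduct.reindex 𝕜 (fun a : {a : M // a ∈ x} => W.fib a.1)
      x.equivFin.symm.symm).toLinearMap

lemma symToCauchyPower_tprod (s : ∀ a : {a : M // a ∈ x}, W.fib a.1) :
    symToCauchyPower W x (PiTensorProduct.tprod 𝕜 s)
      = cauchyPowerMk W x.equivFin.symm fun i => s (x.equivFin.symm i) := by
  unfold symToCauchyPower cauchyPowerMk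
  rw [LinearMap.comp_apply, LinearEquiv.coe_coe, PiTensorProduct.reindex_tprod]
  rfl

/-- `S^⊠(W)_x` is the quotient of the Cauchy tensor power by the action of the symmetric group. -/
def cauchySymEquiv : (CauchyPowerFib W x ⧸ cauchySymRel W x) ≃ₗ[𝕜]
    ⨂[𝕜] a : {a : M // a ∈ x}, W.fib a.1 :=
  LinearEquiv.ofLinearMap
    ((cauchySymRel W x).liftQ (cauchyPowerToSym W x) (cauchySymRel_le_ker W x))
    ((cauchySymRel W x).mkQ ∘ₗ symToCauchyPower W x)
    (by
      refine PiTensorProduct.ext (MultilinearMap.ext fun s => ?_)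
      change (cauchySymRel W x).liftQ (cauchyPowerToSym W x) (cauchySymRel_le_ker W x) (Submodule.Quotient.mk
        (symToCauchyPower W x (PiTensorProduct.tprod 𝕜 s))) = _
      rw [symToCauchyPower_tprod, Submodule.liftQ_apply, cauchyPowerToSym_mk]
      rfl)
    (by
      classical
      refine Submodule.linearMap_qext _ (LinearMap.pi_ext' fun e => ?_)
      refine PiTensorProduct.ext (MultilinearMap.ext fun v => ?_)
      obtain ⟨s, rfl⟩ := exists_eq_comp W e v
      change Submodule.Quotient.mk (symToCauchyPower W x (cauchyPowerToSym W x
        (cauchyPowerMk W e fun i => s (e i)))) =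
          Submodule.Quotient.mk (cauchyPowerMk W e fun i => s (e i))
      rw [cauchyPowerToSym_mk, symToCauchyPower_tprod]
      exact (Submodule.Quotient.eq _).2 (cauchyPowerMk_sub_mem W _ _ s))

end Coinvariants

/-! ## 2-algebra bundles and Poisson 2-algebra bundles -/

section Structures

/-- `P`, with `⊗`-multiplication `mH`, `⊗`-unit `uH`, `⊠`-multiplication `mC` and `⊠`-unit `uC`,
is a commutative 2-algebra bundle. Identities between maps on Cauchy tensor products are written
out on the summands. -/
structure IsCommTwoAlgebraBundle [TopologicalSpace M] (sm : (Finset M → 𝕜) → Finset M → Prop)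
    (P : PreBundle.{u, v} 𝕜 (Finset M))
    (mH : ∀ x, (hadamard sm P P).fib x →ₗ[𝕜] P.fib x)
    (uH : ∀ x, (trivialLine sm).fib x →ₗ[𝕜] P.fib x)
    (mC : ∀ x, (cauchy sm P P).fib x →ₗ[𝕜] P.fib x)
    (uC : ∀ x, (cauchyUnit 𝕜 M).fib x →ₗ[𝕜] P.fib x) : Prop where
  isVectorBundle : IsVectorBundle sm P
  smooth_mH : IsBundleMap (V := hadamard sm P P) (W := P) mH
  smooth_uH : IsBundleMap (V := trivialLine sm) (W := P) uH
  smooth_mC : IsBundleMap (V := cauchy sm P P) (W := P) mC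
  smooth_uC : IsBundleMap (V := cauchyUnit 𝕜 M) (W := P) uC
  assoc_mH : ∀ (x) (a b c : P.fib x), mH x (mH x (a ⊗ₜ b) ⊗ₜ c) = mH x (a ⊗ₜ mH x (b ⊗ₜ c))
  comm_mH : ∀ (x) (a b : P.fib x), mH x (a ⊗ₜ b) = mH x (b ⊗ₜ a)
  unit_mH : ∀ (x) (a : P.fib x), mH x (uH x 1 ⊗ₜ a) = a ∧ mH x (a ⊗ₜ uH x 1) = a
  assoc_mC : ∀ {x y z xy yz w : Finset M} (hxy : IsSplit xy x y) (hyz : IsSplit yz y z)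
    (h : IsSplit w xy z) (h' : IsSplit w x yz) (a : P.fib x) (b : P.fib y) (c : P.fib z),
    mC w (cauchyMk h (mC xy (cauchyMk hxy a b)) c) = mC w (cauchyMk h' a (mC yz (cauchyMk hyz b c)))
  comm_mC : ∀ {x y w : Finset M} (h : IsSplit w x y) (a : P.fib x) (b : P.fib y),
    mC w (cauchyMk h a b) = mC w (cauchyMk h.symm b a)
  unit_mC : ∀ {x : Finset M} (h : IsSplit x ∅ x) (a : P.fib x),
    mC x (cauchyMk h (uC ∅ fun _ => 1) a) = a ∧ mC x (cauchyMk h.symm a (uC ∅ fun _ => 1)) = a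
  /-- compatibility of the multiplications (pentagon with the shuffle map) -/
  interchange : ∀ {x y w : Finset M} (h : IsSplit w x y) (a b : P.fib x) (c d : P.fib y),
    mC w (cauchyMk h (mH x (a ⊗ₜ b)) (mH y (c ⊗ₜ d)))
      = mH w (mC w (cauchyMk h a c) ⊗ₜ mC w (cauchyMk h b d))
  /-- compatibility of `mC` with `uH`, via `μ : I_⊗ ⊠ I_⊗ → I_⊗` -/
  mC_uH : ∀ {x y w : Finset M} (h : IsSplit w x y),
    mC w (cauchyMk h (uH x 1) (uH y 1)) = uH w 1
  /-- compatibility of `mH` with `uC`, via `Δ : I_⊠ → I_⊠ ⊗ I_⊠` -/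
  mH_uC : mH ∅ ((uC ∅ fun _ => 1) ⊗ₜ (uC ∅ fun _ => 1)) = uC ∅ fun _ => 1
  /-- compatibility of the units, via `ν : I_⊠ → I_⊗` -/
  uC_eq_uH : (uC ∅ fun _ => 1) = uH ∅ 1

/-- `P` with the given operations and the bracket `br : P ⊠ P → P` is a Poisson 2-algebra bundle. -/
structure IsPoissonTwoAlgebraBundle [TopologicalSpace M] (sm : (Finset M → 𝕜) → Finset M → Prop)
    (P : PreBundle.{u, v} 𝕜 (Finset M))
    (mH : ∀ x, (hadamard sm P P).fib x →ₗ[𝕜] P.fib x)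
    (uH : ∀ x, (trivialLine sm).fib x →ₗ[𝕜] P.fib x)
    (mC : ∀ x, (cauchy sm P P).fib x →ₗ[𝕜] P.fib x)
    (uC : ∀ x, (cauchyUnit 𝕜 M).fib x →ₗ[𝕜] P.fib x)
    (br : ∀ x, (cauchy sm P P).fib x →ₗ[𝕜] P.fib x) : Prop
    extends IsCommTwoAlgebraBundle sm P mH uH mC uC where
  smooth_br : IsBundleMap (V := cauchy sm P P) (W := P) br
  antisymm : ∀ {x y w : Finset M} (h : IsSplit w x y) (a : P.fib x) (b : P.fib y),
    br w (cauchyMk h a b) = -br w (cauchyMk h.symm b a)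
  jacobi : ∀ {x y z xy yz zx w : Finset M} (hxy : IsSplit xy x y) (hyz : IsSplit yz y z)
    (hzx : IsSplit zx z x) (h₁ : IsSplit w xy z) (h₂ : IsSplit w yz x) (h₃ : IsSplit w zx y)
    (a : P.fib x) (b : P.fib y) (c : P.fib z),
    br w (cauchyMk h₁ (br xy (cauchyMk hxy a b)) c)
      + br w (cauchyMk h₂ (br yz (cauchyMk hyz b c)) a)
      + br w (cauchyMk h₃ (br zx (cauchyMk hzx c a)) b) = 0
  leibniz_mC : ∀ {x y z xy xz yz w : Finset M} (hxy : IsSplit xy x y) (hxz : IsSplit xz x z)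
    (hyz : IsSplit yz y z) (h₁ : IsSplit w x yz) (h₂ : IsSplit w xy z) (h₃ : IsSplit w y xz)
    (a : P.fib x) (b : P.fib y) (c : P.fib z),
    br w (cauchyMk h₁ a (mC yz (cauchyMk hyz b c)))
      = mC w (cauchyMk h₂ (br xy (cauchyMk hxy a b)) c)
        + mC w (cauchyMk h₃ b (br xz (cauchyMk hxz a c)))
  leibniz_mH : ∀ {x y w : Finset M} (h : IsSplit w x y) (a : P.fib x) (b c : P.fib y),
    br w (cauchyMk h a (mH y (b ⊗ₜ c)))
      = mH w (br w (cauchyMk h a b) ⊗ₜ mC w (cauchyMk h (uH x 1) c))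
        + mH w (mC w (cauchyMk h (uH x 1) b) ⊗ₜ br w (cauchyMk h a c))

end Structures

/-! ## The Cauchy-Hadamard bundle -/

section CauchyHadamard

open Classical in
/-- For a split `z = x ⊔ y`, the points of `z` are the points of `x` and those of `y`. -/
def IsSplit.equiv {z x y : Finset M} (h : IsSplit z x y) :
    {a : M // a ∈ x} ⊕ {a : M // a ∈ y} ≃ {a : M // a ∈ z} where
  toFun := Sum.rec (fun a => ⟨a.1, (h.2 _).2 (Or.inl a.2)⟩) (fun a => ⟨a.1, (h.2 _).2 (Or.inr a.2)⟩)
  invFun a := if ha : a.1 ∈ x then Sum.inl ⟨a.1, ha⟩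
    else Sum.inr ⟨a.1, ((h.2 _).1 a.2).resolve_left ha⟩
  left_inv a := by
    rcases a with a | a
    · simp [a.2]
    · simp [Finset.disjoint_right.1 h.1 a.2]
  right_inv a := by
    by_cases ha : a.1 ∈ x <;> simp [ha]

/-- The product `⊡ : S^⊠(W)_x ⊗ S^⊠(W)_y → S^⊠(W)_z` for a split `z = x ⊔ y`, i.e.
`(⊡_{a ∈ x} w_a) ⊡ (⊡_{a ∈ y} w_a) = ⊡_{a ∈ z} w_a`; see `boxdot_tprod`. -/
def boxdot (W : PreBundle.{u, v} 𝕜 M) {z x y : Finset M} (h : IsSplit z x y) :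
    (⨂[𝕜] a : {a : M // a ∈ x}, W.fib a.1) ⊗[𝕜] (⨂[𝕜] a : {a : M // a ∈ y}, W.fib a.1) →ₗ[𝕜]
      ⨂[𝕜] a : {a : M // a ∈ z}, W.fib a.1 :=
  (PiTensorProduct.reindex 𝕜 (fun a : {a : M // a ∈ z} => W.fib a.1) h.equiv.symm).symm.toLinearMap
    ∘ₗ (PiTensorProduct.tmulEquivDep 𝕜
      (fun j : {a : M // a ∈ x} ⊕ {a : M // a ∈ y} => W.fib (h.equiv j).1)).toLinearMap

lemma boxdot_tprod (W : PreBundle.{u, v} 𝕜 M) {z x y : Finset M} (h : IsSplit z x y)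
    (s : ∀ a : {a : M // a ∈ z}, W.fib a.1) :
    boxdot W h
      ((PiTensorProduct.tprod 𝕜 fun a : {a : M // a ∈ x} => s ⟨a.1, (h.2 _).2 (Or.inl a.2)⟩) ⊗ₜ
        (PiTensorProduct.tprod 𝕜 fun a : {a : M // a ∈ y} => s ⟨a.1, (h.2 _).2 (Or.inr a.2)⟩))
      = PiTensorProduct.tprod 𝕜 s := by
  refine (LinearEquiv.symm_apply_eq _).2 ?_
  rw [PiTensorProduct.reindex_tprod]
  refine (PiTensorProduct.tmulEquivDep_apply (R := 𝕜)
    (N := fun j : {a : M // a ∈ x} ⊕ {a : M // a ∈ y} => W.fib (h.equiv j).1) _ _).trans ?_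
  congr 1
  funext j
  rcases j with j | j <;> rfl

variable [TopologicalSpace M] (smM : (M → 𝕜) → M → Prop)
  (smU : (Finset M → 𝕜) → Finset M → Prop) (V : PreBundle.{u, v} 𝕜 M)

/-- The Cauchy-Hadamard bundle `S^⊠ S^⊗ (V)`. -/
@[reducible] def cauchyHadamard : PreBundle.{u, max u v} 𝕜 (Finset M) :=
  cauchySym smU (symBundle smM V)

/-- The `⊗`-multiplication `⊙`: the product of the tensor product of the algebras `S(V_a)`, `a ∈ x`,
i.e. `(⊡ s_a) ⊙ (⊡ t_a) = ⊡ (s_a t_a)`. -/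
def chMulH (x : Finset M) :
    (hadamard smU (cauchyHadamard smM smU V) (cauchyHadamard smM smU V)).fib x →ₗ[𝕜]
      (cauchyHadamard smM smU V).fib x :=
  TensorProduct.lift
    (PiTensorProduct.mul (R := 𝕜) (A := fun a : {a : M // a ∈ x} => FibSym 𝕜 (V.fib a.1)))

/-- The `⊗`-unit `1_x = ⊡_{a ∈ x} 1_a`. -/
def chUnitH (x : Finset M) :
    (trivialLine smU).fib x →ₗ[𝕜] (cauchyHadamard smM smU V).fib x :=
  LinearMap.toSpanSingleton 𝕜 _ (PiTensorProduct.tprod 𝕜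
    fun a : {a : M // a ∈ x} => (1 : FibSym 𝕜 (V.fib a.1)))

/-- The `⊠`-multiplication `⊡`. -/
def chMulC (z : Finset M) :
    (cauchy smU (cauchyHadamard smM smU V) (cauchyHadamard smM smU V)).fib z →ₗ[𝕜]
      (cauchyHadamard smM smU V).fib z :=
  ∑ p : Splits z, boxdot (symBundle smM V) p.2 ∘ₗ LinearMap.proj p

open Classical in
/-- The `⊠`-unit, which maps `1 ∈ 𝕜` over the empty configuration to the empty product `1_∅`. -/
def chUnitC (x : Finset M) :
    (cauchyUnit 𝕜 M).fib x →ₗ[𝕜] (cauchyHadamard smM smU V).fib x :=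
  if h : x = ∅ then
    (LinearMap.proj (R := 𝕜) (φ := fun _ : PLift (x = ∅) => 𝕜) (PLift.up h)).smulRight
      (chUnitH smM smU V x 1)
  else 0

open Classical in
/-- A vector `u ∈ V_a` as a generator of `S^⊠ S^⊗ (V)` over the one-point configuration `{a}`
(the family `Pi.mulSingle _ (ι u)` has the single member `ι u ∈ S(V_a)`). -/
def chGen (a : M) (u : V.fib a) : (cauchyHadamard smM smU V).fib {a} :=
  PiTensorProduct.tprod 𝕜 (Pi.mulSingle
    (M := fun b : {b : M // b ∈ ({a} : Finset M)} => FibSym 𝕜 (V.fib b.1))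
    ⟨a, Finset.mem_singleton_self a⟩ (FibSym.ι 𝕜 (V.fib a) u))

/-- Antisymmetry of a kernel `k : V ⊠ V → 𝕜` (with `V ⊠ V` short for `i_* V ⊠ i_* V`, which
vanishes outside `UConf_2(M)`): `k ∘ τ = - k` for the braiding `τ`. -/
def IsAntisymmetricKernel
    (k : ∀ w, (cauchy smU (pushforward V) (pushforward V)).fib w →ₗ[𝕜] (trivialLine smU).fib w) :
    Prop :=
  ∀ {x y w : Finset M} (h : IsSplit w x y) (u : (pushforward V).fib x) (v : (pushforward V).fib y),
    k w (cauchyMk h u v) = -k w (cauchyMk h.symm v u)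

/-- The conditions which prescribe the bracket `br` on `S^⊠ S^⊗ (V)` with kernel `k`. -/
structure IsKernelBracket
    (k : ∀ w, (cauchy smU (pushforward V) (pushforward V)).fib w →ₗ[𝕜] (trivialLine smU).fib w)
    (br : ∀ w, (cauchy smU (cauchyHadamard smM smU V) (cauchyHadamard smM smU V)).fib w →ₗ[𝕜]
      (cauchyHadamard smM smU V).fib w) : Prop where
  /-- `{1_x, 1_y} = 0` -/
  unit_unit : ∀ {x y w : Finset M} (h : IsSplit w x y),
    br w (cauchyMk h (chUnitH smM smU V x 1) (chUnitH smM smU V y 1)) = 0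
  /-- `{a_x, 1_y} = 0` -/
  unit_right : ∀ {x y w : Finset M} (h : IsSplit w x y) (a : (cauchyHadamard smM smU V).fib x),
    br w (cauchyMk h a (chUnitH smM smU V y 1)) = 0
  /-- `{1_y, a_x} = 0` -/
  unit_left : ∀ {x y w : Finset M} (h : IsSplit w y x) (a : (cauchyHadamard smM smU V).fib x),
    br w (cauchyMk h (chUnitH smM smU V y 1) a) = 0
  /-- `{u_x, v_y} = k(u_x, v_y) 1_x ⊡ 1_y` for points `x ≠ y` -/
  generators : ∀ {x y : M} {w : Finset M} (h : IsSplit w {x} {y}) (u : V.fib x) (v : V.fib y),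
    br w (cauchyMk h (chGen smM smU V x u) (chGen smM smU V y v))
      = k w (cauchyMk h (pushforwardMk V x u) (pushforwardMk V y v)) •
        chMulC smM smU V w (cauchyMk h (chUnitH smM smU V {x} 1) (chUnitH smM smU V {y} 1))
  /-- `{a_x ⊙ b_x, c_y} = {a_x, c_y} ⊙ (b_x ⊡ 1_y) + (a_x ⊡ 1_y) ⊙ {b_x, c_y}` -/
  leibnizH_left : ∀ {x y w : Finset M} (h : IsSplit w x y)
    (a b : (cauchyHadamard smM smU V).fib x) (c : (cauchyHadamard smM smU V).fib y),
    br w (cauchyMk h (chMulH smM smU V x (a ⊗ₜ b)) c)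
      = chMulH smM smU V w (br w (cauchyMk h a c) ⊗ₜ
          chMulC smM smU V w (cauchyMk h b (chUnitH smM smU V y 1)))
        + chMulH smM smU V w (chMulC smM smU V w (cauchyMk h a (chUnitH smM smU V y 1)) ⊗ₜ
          br w (cauchyMk h b c))
  /-- `{a_x, b_y ⊙ c_y} = {a_x, b_y} ⊙ (1_x ⊡ c_y) + (1_x ⊡ b_y) ⊙ {a_x, c_y}` -/
  leibnizH_right : ∀ {x y w : Finset M} (h : IsSplit w x y)
    (a : (cauchyHadamard smM smU V).fib x) (b c : (cauchyHadamard smM smU V).fib y),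
    br w (cauchyMk h a (chMulH smM smU V y (b ⊗ₜ c)))
      = chMulH smM smU V w (br w (cauchyMk h a b) ⊗ₜ
          chMulC smM smU V w (cauchyMk h (chUnitH smM smU V x 1) c))
        + chMulH smM smU V w (chMulC smM smU V w (cauchyMk h (chUnitH smM smU V x 1) b) ⊗ₜ
          br w (cauchyMk h a c))
  /-- `{a_x ⊡ b_y, c_z} = {a_x, c_z} ⊡ b_y + a_x ⊡ {b_y, c_z}` -/
  leibnizC_left : ∀ {x y z xy xz yz w : Finset M} (hxy : IsSplit xy x y) (hxz : IsSplit xz x z)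
    (hyz : IsSplit yz y z) (h₁ : IsSplit w xy z) (h₂ : IsSplit w xz y) (h₃ : IsSplit w x yz)
    (a : (cauchyHadamard smM smU V).fib x) (b : (cauchyHadamard smM smU V).fib y)
    (c : (cauchyHadamard smM smU V).fib z),
    br w (cauchyMk h₁ (chMulC smM smU V xy (cauchyMk hxy a b)) c)
      = chMulC smM smU V w (cauchyMk h₂ (br xz (cauchyMk hxz a c)) b)
        + chMulC smM smU V w (cauchyMk h₃ a (br yz (cauchyMk hyz b c)))
  /-- `{a_x, b_y ⊡ c_z} = {a_x, b_y} ⊡ c_z + b_y ⊡ {a_x, c_z}` -/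
  leibnizC_right : ∀ {x y z xy xz yz w : Finset M} (hxy : IsSplit xy x y) (hxz : IsSplit xz x z)
    (hyz : IsSplit yz y z) (h₁ : IsSplit w x yz) (h₂ : IsSplit w xy z) (h₃ : IsSplit w y xz)
    (a : (cauchyHadamard smM smU V).fib x) (b : (cauchyHadamard smM smU V).fib y)
    (c : (cauchyHadamard smM smU V).fib z),
    br w (cauchyMk h₁ a (chMulC smM smU V yz (cauchyMk hyz b c)))
      = chMulC smM smU V w (cauchyMk h₂ (br xy (cauchyMk hxy a b)) c)
        + chMulC smM smU V w (cauchyMk h₃ b (br xz (cauchyMk hxz a c)))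

end CauchyHadamard

end Conf

end

/-! All fibres of the Cauchy-Hadamard bundle sit inside one polynomial algebra `TotalSym V`, the
symmetric algebra of the direct sum of all fibres $V_a$ written in bases. The inclusion `toTotal` is
an algebra homomorphism split by `ofTotal`. It turns both products into ordinary multiplication
(`toTotal_chMulH`, `toTotal_chMulC`) and every $1_{\underline x}$ into $1$. The kernel, extended by
zero to pairs over the same point, is a matrix of constants on the variables and defines a
biderivation `totalBracket`. Brackets of generators are scalars, so the Leibniz rule keeps the
bracket of elements over $\underline x$ and $\underline y$ inside the image of the fibre over
$\underline x\sqcup\underline y$ (`totalBracket_mem_range`). The bracket therefore descends to the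
fibres, and each algebraic law becomes an identity for a constant Poisson bracket on polynomials.
Uniqueness holds because each fibre is generated as an algebra by the $V_a$, and the Leibniz rules
for both products reduce any bracket to pairs of generators over two one-point configurations
(`IsKernelBracket.unique`).

Smoothness is local on the configuration space. The map from tuples of distinct points is open and
continuous, so configurations near $\underline x$ are images of nearby tuples (`nhds_conf`). A map
$\rho$ collapsing disjoint neighbourhoods of the points of $\underline x$ to their centres matches
each nearby $\underline y$ with $\underline x$, hence the splits of $\underline y$ with the subsets
of $\underline x$. This breaks a map on a Cauchy product into finitely many components
(`isBundleMap_of_components`). Smooth sections near $\underline x$ are generated, over the smooth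
functions, by sections of $V$ near single points (`SmoothCh.generation`). By the Leibniz rule the
smoothness of the bracket is then that of the kernel on two such sections.

For the bundle structure, the $n$-th subbundle consists of tensors of degree at most $n$ at each
point in the $n$-th subbundle of $V$; its frames are products of monomials in local frames of $V$
(`chMonomial_isFrame`). The delicate point is to recover smooth coordinates. A smooth section may be
presented through sections of a larger subbundle of $V$, so the coordinate functionals of the frame
must be extended smoothly to that subbundle (`exists_smooth_dual`). Tensor products of coefficient
functionals then read off the coordinates. -/

noncomputable section

/-! ## Constant Poisson brackets on polynomial algebras -/

section PolyBracket

variable {R : Type*} [CommRing R] {σ : Type*}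

/-- The biderivation of a polynomial algebra with constant values `c i j` on the variables. -/
def polyBracket (c : σ → σ → R) :
    Derivation R (MvPolynomial σ R) (Derivation R (MvPolynomial σ R) (MvPolynomial σ R)) :=
  MvPolynomial.mkDerivation R fun i => MvPolynomial.mkDerivation R fun j => MvPolynomial.C (c i j)

variable (c : σ → σ → R) (f g h : MvPolynomial σ R)

lemma polyBracket_X (i j : σ) :
    polyBracket c (.X i) (.X j) = MvPolynomial.C (c i j) := by
  simp [polyBracket]

lemma polyBracket_mul_left :
    polyBracket c (f * g) h = f * polyBracket c g h + g * polyBracket c f h := by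
  simp

lemma polyBracket_mul_right :
    polyBracket c f (g * h) = g * polyBracket c f h + h * polyBracket c f g := by
  simp

lemma polyBracket_antisymm (hc : ∀ i j, c i j = -c j i) :
    polyBracket c f g = -polyBracket c g f := by
  -- The case of a variable in one slot, by induction on the other argument; it serves as the
  -- generator case of the induction on `f`.
  have hX : ∀ i, polyBracket c (.X i) g = -polyBracket c g (.X i) := fun i => by
    induction g using MvPolynomial.induction_on with
    | C r => simp
    | add p q hp hq => rw [map_add, hp, hq, map_add, Derivation.add_apply, neg_add]
    | mul_X p j hp =>
      rw [polyBracket_mul_left, polyBracket_mul_right, hp, polyBracket_X, polyBracket_X, hc i j,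
        map_neg]
      ring
  induction f using MvPolynomial.induction_on with
  | C r => simp
  | add p q hp hq => rw [map_add, Derivation.add_apply, hp, hq, map_add, neg_add]
  | mul_X p i hp =>
    rw [polyBracket_mul_left, polyBracket_mul_right, hp, hX]
    ring

/-- Given antisymmetry, the Jacobiator is a derivation in its last argument, so it vanishes there
once it vanishes on variables. Cyclic rotation brings each argument into that place in turn. On
three variables the inner brackets are constants, which every derivation kills. -/
lemma polyBracket_jacobi (hc : ∀ i j, c i j = -c j i) :
    polyBracket c (polyBracket c f g) h + polyBracket c (polyBracket c g h) f
      + polyBracket c (polyBracket c h f) g = 0 := by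
  have key : ∀ f g : MvPolynomial σ R,
      (∀ i, polyBracket c (polyBracket c f g) (.X i) + polyBracket c (polyBracket c g (.X i)) f
        + polyBracket c (polyBracket c (.X i) f) g = 0) →
      ∀ h, polyBracket c (polyBracket c f g) h + polyBracket c (polyBracket c g h) f
        + polyBracket c (polyBracket c h f) g = 0 := by
    intro f g hX h
    induction h using MvPolynomial.induction_on with
    | C r => simp
    | add p q hp hq =>
      simp only [map_add, Derivation.add_apply]
      linear_combination hp + hq
    | mul_X p i hp =>
      have e1 := hX i
      have e2 := polyBracket_antisymm c (.X i) g hc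
      have e3 := polyBracket_antisymm c p g hc
      simp only [polyBracket_mul_left, polyBracket_mul_right, map_add, Derivation.add_apply]
      rw [polyBracket_antisymm c p f hc] at hp ⊢
      rw [polyBracket_antisymm c (.X i) f hc] at e1 ⊢
      simp only [map_neg, Derivation.neg_apply] at hp e1 ⊢
      linear_combination .X i * hp + p * e1 - polyBracket c f p * e2 - polyBracket c f (.X i) * e3
  have h3 : ∀ i j k, polyBracket c (polyBracket c (.X i) (.X j)) (.X k)
      + polyBracket c (polyBracket c (.X j) (.X k)) (.X i)
      + polyBracket c (polyBracket c (.X k) (.X i)) (.X j) = 0 := fun i j k => by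
    simp [polyBracket_X]
  have h2 : ∀ i j h, polyBracket c (polyBracket c (.X i) (.X j)) h
      + polyBracket c (polyBracket c (.X j) h) (.X i)
      + polyBracket c (polyBracket c h (.X i)) (.X j) = 0 := fun i j => key _ _ (h3 i j)
  have h1 : ∀ i g h, polyBracket c (polyBracket c g (.X i)) h
      + polyBracket c (polyBracket c (.X i) h) g
      + polyBracket c (polyBracket c h g) (.X i) = 0 := fun i g => key _ _ fun j => by
    linear_combination h2 i j g
  exact key f g (fun i => by linear_combination h1 i g f) h

end PolyBracket

/-! ## The symmetric algebras `FibSym` -/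

section FibSym

variable {𝕜 : Type} [RCLike 𝕜] {V : Type v} [AddCommGroup V] [Module 𝕜 V]

namespace FibSym

theorem induction {motive : FibSym 𝕜 V → Prop}
    (scalar : ∀ r, motive (algebraMap 𝕜 (FibSym 𝕜 V) r)) (ι : ∀ x, motive (ι 𝕜 V x))
    (mul : ∀ a b, motive a → motive b → motive (a * b))
    (add : ∀ a b, motive a → motive b → motive (a + b)) (a : FibSym 𝕜 V) : motive a :=
  SymmetricAlgebra.induction (R := 𝕜) (M := V) (motive := motive)
    scalar ι mul add a

/-- The universal property of the symmetric algebra. -/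
def lift {A : Type*} [CommRing A] [Algebra 𝕜 A] (f : V →ₗ[𝕜] A) : FibSym 𝕜 V →ₐ[𝕜] A :=
  SymmetricAlgebra.lift (R := 𝕜) (M := V) f

@[simp] lemma lift_ι {A : Type*} [CommRing A] [Algebra 𝕜 A] (f : V →ₗ[𝕜] A) (u : V) :
    lift f (ι 𝕜 V u) = f u :=
  SymmetricAlgebra.lift_ι_apply f u

end FibSym

end FibSym

/-! ## The fibres of the Cauchy-Hadamard bundle as algebras -/

section Fibres

variable {M : Type u} {𝕜 : Type} [RCLike 𝕜] (V : PreBundle.{u, v} 𝕜 M)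

/-- The fibre of `S^⊠ S^⊗ (V)`, a commutative algebra. -/
abbrev ChFib (x : Finset M) : Type (max u v) :=
  ⨂[𝕜] a : {a : M // a ∈ x}, FibSym 𝕜 (V.fib a.1)

/-- Indices of a basis of the direct sum of the fibres of `V`. -/
abbrev BasisIndex : Type (max u v) := Σ a : M, Module.Basis.ofVectorSpaceIndex 𝕜 (V.fib a)

/-- The symmetric algebra of the direct sum of all fibres of `V`, in coordinates. -/
abbrev TotalSym : Type (max u v) := MvPolynomial (BasisIndex V) 𝕜

/-- The inclusion of `V_a` into `TotalSym V`. -/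
def totalGen (a : M) : V.fib a →ₗ[𝕜] TotalSym V :=
  (Module.Basis.ofVectorSpace 𝕜 (V.fib a)).constr 𝕜 fun i => MvPolynomial.X ⟨a, i⟩

lemma totalGen_basis (a : M) (i) :
    totalGen V a (Module.Basis.ofVectorSpace 𝕜 (V.fib a) i) = MvPolynomial.X ⟨a, i⟩ :=
  Module.Basis.constr_basis _ _ _ _

/-- The inclusion of the fibre over `x` into `TotalSym V`. -/
def toTotal (x : Finset M) : ChFib V x →ₐ[𝕜] TotalSym V :=
  PiTensorProduct.liftAlgHom
    ((MultilinearMap.mkPiAlgebra 𝕜 {a : M // a ∈ x} (TotalSym V)).compLinearMap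
      fun a => (FibSym.lift (totalGen V a.1)).toLinearMap)
    (by simp) (by intro s t; simp [Finset.prod_mul_distrib])

lemma toTotal_tprod (x : Finset M) (s : ∀ a : {a : M // a ∈ x}, FibSym 𝕜 (V.fib a.1)) :
    toTotal V x (PiTensorProduct.tprod 𝕜 s) = ∏ a, FibSym.lift (totalGen V a.1) (s a) := by
  exact (PiTensorProduct.lift.tprod (R := 𝕜) s).trans (by simp)

open Classical in
/-- The inclusion of `S(V_a)` into the fibre over `x`, where `a ∈ x`. -/
def chSingle (x : Finset M) (a : {a : M // a ∈ x}) : FibSym 𝕜 (V.fib a.1) →ₐ[𝕜] ChFib V x :=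
  PiTensorProduct.singleAlgHom (R := 𝕜) (A := fun a : {a : M // a ∈ x} => FibSym 𝕜 (V.fib a.1)) a

lemma tprod_eq_prod_chSingle (x : Finset M) (s : ∀ a : {a : M // a ∈ x}, FibSym 𝕜 (V.fib a.1)) :
    (PiTensorProduct.tprod 𝕜 s : ChFib V x) = ∏ a, chSingle V x a (s a) := by
  classical
  unfold chSingle
  simp only [PiTensorProduct.singleAlgHom_apply]
  rw [← PiTensorProduct.tprod_prod]
  congr 1
  exact (Finset.univ_prod_mulSingle s).symm

lemma toTotal_chSingle (x : Finset M) (a : {a : M // a ∈ x}) (f : FibSym 𝕜 (V.fib a.1)) :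
    toTotal V x (chSingle V x a f) = FibSym.lift (totalGen V a.1) f := by
  classical
  unfold chSingle
  rw [PiTensorProduct.singleAlgHom_apply, toTotal_tprod, Finset.prod_eq_single a]
  · simp
  · intro b _ hb
    simp [Pi.mulSingle_eq_of_ne hb]
  · simp

/-- A pure tensor is a product of elements coming from single factors $S(V_a)$, and each factor is
generated by $V_a$. Algebra homomorphisms and biderivations on a fibre are thus controlled by the
vectors of the $V_a$. -/
theorem ChFib.induction (x : Finset M) {motive : ChFib V x → Prop}
    (scalar : ∀ r, motive (algebraMap 𝕜 _ r))
    (gen : ∀ (a : {a : M // a ∈ x}) (u : V.fib a.1), motive (chSingle V x a (FibSym.ι 𝕜 _ u)))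
    (mul : ∀ a b, motive a → motive b → motive (a * b))
    (add : ∀ a b, motive a → motive b → motive (a + b)) (a : ChFib V x) : motive a := by
  have h1 : ∀ (a : {a : M // a ∈ x}) f, motive (chSingle V x a f) := fun a f => by
    induction f using FibSym.induction with
    | scalar r => rw [AlgHom.commutes]; exact scalar r
    | ι u => exact gen a u
    | mul p q hp hq => rw [map_mul]; exact mul _ _ hp hq
    | add p q hp hq => rw [map_add]; exact add _ _ hp hq
  induction a using PiTensorProduct.induction_on with
  | smul_tprod r s =>
    rw [Algebra.smul_def, tprod_eq_prod_chSingle]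
    refine mul _ _ (scalar r) (Finset.prod_induction _ motive mul ?_ fun a _ => h1 a _)
    rw [← map_one (algebraMap 𝕜 (ChFib V x))]
    exact scalar 1
  | add p q hp hq => exact add _ _ hp hq

open Classical in
/-- The projection of `TotalSym V` to the fibre over `x`, which kills the generators outside `x`. -/
def ofTotal (x : Finset M) : TotalSym V →ₐ[𝕜] ChFib V x :=
  MvPolynomial.aeval fun i => if h : i.1 ∈ x then
    chSingle V x ⟨i.1, h⟩ (FibSym.ι 𝕜 _ (Module.Basis.ofVectorSpace 𝕜 (V.fib i.1) i.2)) else 0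

lemma ofTotal_totalGen (x : Finset M) (a : {a : M // a ∈ x}) (u : V.fib a.1) :
    ofTotal V x (totalGen V a.1 u) = chSingle V x a (FibSym.ι 𝕜 _ u) := by
  classical
  have : (ofTotal V x).toLinearMap ∘ₗ totalGen V a.1
      = (chSingle V x a).toLinearMap ∘ₗ FibSym.ι 𝕜 (V.fib a.1) := by
    refine (Module.Basis.ofVectorSpace 𝕜 (V.fib a.1)).ext fun i => ?_
    rw [LinearMap.comp_apply, totalGen_basis]
    simp [ofTotal]
  exact LinearMap.congr_fun this u

-- Both maps are algebra homomorphisms, so generators suffice, and those over points of `x` are not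
-- killed. The resulting injectivity lets every identity in a fibre be checked among polynomials.
@[simp] lemma ofTotal_toTotal (x : Finset M) (f : ChFib V x) : ofTotal V x (toTotal V x f) = f := by
  induction f using ChFib.induction with
  | scalar r => simp
  | gen a u => rw [toTotal_chSingle, FibSym.lift_ι, ofTotal_totalGen]
  | mul p q hp hq => rw [map_mul, map_mul, hp, hq]
  | add p q hp hq => rw [map_add, map_add, hp, hq]

lemma toTotal_injective (x : Finset M) : Function.Injective (toTotal V x) :=
  Function.LeftInverse.injective (ofTotal_toTotal V x)

end Fibres

/-! ### Splits and linear maps on Cauchy products -/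

section CauchyProduct

variable {M : Type u} {𝕜 : Type} [RCLike 𝕜]

lemma IsSplit.unique {w w' x y : Finset M} (h : IsSplit w x y) (h' : IsSplit w' x y) : w = w' :=
  Finset.ext fun a => (h.2 a).trans (h'.2 a).symm

lemma IsSplit.left_subset {w x y : Finset M} (h : IsSplit w x y) : x ⊆ w :=
  fun a ha => (h.2 a).2 (Or.inl ha)

lemma IsSplit.right_subset {w x y : Finset M} (h : IsSplit w x y) : y ⊆ w :=
  fun a ha => (h.2 a).2 (Or.inr ha)

lemma isSplit_disjUnion {x y : Finset M} (h : Disjoint x y) : IsSplit (x.disjUnion y h) x y :=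
  ⟨h, fun _ => Finset.mem_disjUnion⟩

variable {P : PreBundle.{u, v} 𝕜 (Finset M)} {Q : PreBundle.{u, w} 𝕜 (Finset M)}

open Classical in
/-- The inclusion of a summand of the Cauchy product. -/
def cauchyIncl {z x y : Finset M} (h : IsSplit z x y) :
    P.fib x ⊗[𝕜] Q.fib y →ₗ[𝕜] CauchyFib P Q z :=
  LinearMap.single 𝕜 (fun p : Splits z => P.fib p.1.1 ⊗[𝕜] Q.fib p.1.2) ⟨(x, y), h⟩

lemma cauchyIncl_tmul {z x y : Finset M} (h : IsSplit z x y) (a : P.fib x) (b : Q.fib y) :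
    cauchyIncl h (a ⊗ₜ[𝕜] b) = cauchyMk h a b := rfl

lemma sum_proj_cauchyMk {N : Type*} [AddCommGroup N] [Module 𝕜 N] {z x y : Finset M}
    (L : ∀ p : Splits z, P.fib p.1.1 ⊗[𝕜] Q.fib p.1.2 →ₗ[𝕜] N)
    (h : IsSplit z x y) (a : P.fib x) (b : Q.fib y) :
    (∑ p : Splits z, L p ∘ₗ LinearMap.proj p) (cauchyMk h a b) = L ⟨(x, y), h⟩ (a ⊗ₜ b) := by
  classical
  rw [LinearMap.sum_apply, Finset.sum_eq_single ⟨(x, y), h⟩]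
  · rw [LinearMap.comp_apply, LinearMap.proj_apply]
    unfold cauchyMk
    rw [Pi.single_eq_same]
  · intro p _ hp
    rw [LinearMap.comp_apply, LinearMap.proj_apply]
    unfold cauchyMk
    rw [Pi.single_eq_of_ne hp, map_zero]
  · exact fun h => absurd (Finset.mem_univ _) h

lemma cauchyFib_eq_sum {z : Finset M} (φ : ∀ x, P.fib x) (ψ : ∀ x, Q.fib x) :
    (fun p : Splits z => φ p.1.1 ⊗ₜ[𝕜] ψ p.1.2 : CauchyFib P Q z)
      = ∑ p : Splits z, cauchyMk p.2 (φ p.1.1) (ψ p.1.2) := by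
  classical
  exact (Finset.univ_sum_single (M := fun p : Splits z => P.fib p.1.1 ⊗[𝕜] Q.fib p.1.2) _).symm

lemma cauchyFib_hom_ext {N : Type*} [AddCommGroup N] [Module 𝕜 N] {z : Finset M}
    {f g : CauchyFib P Q z →ₗ[𝕜] N}
    (H : ∀ {x y : Finset M} (h : IsSplit z x y) (a : P.fib x) (b : Q.fib y),
      f (cauchyMk h a b) = g (cauchyMk h a b)) : f = g := by
  classical
  refine LinearMap.pi_ext' fun p => TensorProduct.ext' fun a b => ?_
  exact H p.2 a b

end CauchyProduct

/-! ### The bracket on the total polynomial algebra and its restriction to fibres -/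

section Bracket

variable {M : Type u} {𝕜 : Type} [RCLike 𝕜] (V : PreBundle.{u, v} 𝕜 M) [TopologicalSpace M]
  (smM : (M → 𝕜) → M → Prop) (smU : (Finset M → 𝕜) → Finset M → Prop)

/-- The linear map underlying `pushforwardMk`. -/
def pushforwardMkLin (a : M) : V.fib a →ₗ[𝕜] (pushforward V).fib {a} := by
  classical
  exact LinearMap.single 𝕜 (fun c : {c : M // ({a} : Finset M) = {c}} => V.fib c.1) ⟨a, rfl⟩

variable (k : ∀ w, (cauchy smU (pushforward V) (pushforward V)).fib w →ₗ[𝕜] (trivialLine smU).fib w)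

omit [TopologicalSpace M] in
lemma isSplit_pair {a b : M} (h : a ≠ b) :
    IsSplit (({a} : Finset M).disjUnion {b} (Finset.disjoint_singleton.2 h)) {a} {b} :=
  isSplit_disjUnion _

open Classical in
/-- The kernel `k` as a family of bilinear forms, extended by zero to the diagonal. -/
def kernelForm (a b : M) : V.fib a →ₗ[𝕜] V.fib b →ₗ[𝕜] 𝕜 :=
  if h : a ≠ b then
    ((TensorProduct.mk 𝕜 _ _).compl₁₂ (pushforwardMkLin V a) (pushforwardMkLin V b)).compr₂
      (k _ ∘ₗ cauchyIncl (P := pushforward V) (Q := pushforward V) (isSplit_pair h))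
  else 0

lemma kernelForm_eq {a b : M} {w : Finset M} (h : IsSplit w {a} {b}) (u : V.fib a) (v : V.fib b) :
    kernelForm V smU k a b u v = k w (cauchyMk h (pushforwardMk V a u) (pushforwardMk V b v)) := by
  have hab : a ≠ b := Finset.disjoint_singleton.1 h.1
  obtain rfl := (isSplit_pair hab).unique h
  simp only [kernelForm, dif_pos hab]
  rfl

/-- Off the diagonal this is the hypothesis for the two orders of the split; on the diagonal both
sides are the default value zero. The whole matrix of the kernel is therefore antisymmetric, as the
polynomial Jacobi identity demands. -/
lemma kernelForm_antisymm (hk : IsAntisymmetricKernel smU V k) (a b : M) (u : V.fib a)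
    (v : V.fib b) : kernelForm V smU k a b u v = -kernelForm V smU k b a v u := by
  by_cases hab : a = b
  · subst hab
    simp [kernelForm]
  · rw [kernelForm_eq V smU k (isSplit_pair hab), kernelForm_eq V smU k (isSplit_pair hab).symm]
    exact hk _ _ _

/-- The matrix of the kernel with respect to the chosen bases. -/
def kernelMatrix (i j : BasisIndex V) : 𝕜 :=
  kernelForm V smU k i.1 j.1 (Module.Basis.ofVectorSpace 𝕜 (V.fib i.1) i.2)
    (Module.Basis.ofVectorSpace 𝕜 (V.fib j.1) j.2)

/-- The Poisson bracket on `TotalSym V`. -/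
abbrev totalBracket :
    Derivation 𝕜 (TotalSym V) (Derivation 𝕜 (TotalSym V) (TotalSym V)) :=
  polyBracket (kernelMatrix V smU k)

lemma totalBracket_totalGen (a b : M) (u : V.fib a) (v : V.fib b) :
    totalBracket V smU k (totalGen V a u) (totalGen V b v)
      = algebraMap 𝕜 _ (kernelForm V smU k a b u v) := by
  have : LinearMap.mk₂ 𝕜 (fun u v => totalBracket V smU k (totalGen V a u) (totalGen V b v))
      (by simp) (by simp) (by simp) (by simp)
      = (kernelForm V smU k a b).compr₂ (Algebra.linearMap 𝕜 (TotalSym V)) := by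
    refine (Module.Basis.ofVectorSpace 𝕜 (V.fib a)).ext fun i =>
      (Module.Basis.ofVectorSpace 𝕜 (V.fib b)).ext fun j => ?_
    rw [LinearMap.mk₂_apply, totalGen_basis, totalGen_basis, polyBracket_X]
    rfl
  exact LinearMap.congr_fun₂ this u v

/-- The bracket on `S^⊠ S^⊗ (V)` with kernel `k`. -/
def kernelBracket (w : Finset M) :
    (cauchy smU (cauchyHadamard smM smU V) (cauchyHadamard smM smU V)).fib w →ₗ[𝕜]
      (cauchyHadamard smM smU V).fib w :=
  ∑ p : Splits w, TensorProduct.lift (LinearMap.mk₂ 𝕜 (fun (a : ChFib V p.1.1) (b : ChFib V p.1.2) =>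
    ofTotal V w (totalBracket V smU k (toTotal V _ a) (toTotal V _ b)))
      (by simp) (by simp) (by simp) (by simp)) ∘ₗ LinearMap.proj p

lemma kernelBracket_mk {w x y : Finset M} (h : IsSplit w x y) (a : ChFib V x) (b : ChFib V y) :
    kernelBracket V smM smU k w
      (cauchyMk (V := cauchyHadamard smM smU V) (W := cauchyHadamard smM smU V) h a b)
      = ofTotal V w (totalBracket V smU k (toTotal V _ a) (toTotal V _ b)) :=
  sum_proj_cauchyMk (P := cauchyHadamard smM smU V) (Q := cauchyHadamard smM smU V) _ h a b

omit [TopologicalSpace M] in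
lemma toTotal_mem_range {x w : Finset M} (h : x ⊆ w) (a : ChFib V x) :
    toTotal V x a ∈ (toTotal V w).range := by
  induction a using ChFib.induction with
  | scalar r => rw [AlgHom.commutes]; exact Subalgebra.algebraMap_mem _ r
  | gen a u =>
    exact ⟨chSingle V w ⟨a.1, h a.2⟩ (FibSym.ι 𝕜 _ u), by
      erw [toTotal_chSingle, toTotal_chSingle]⟩
  | mul p q hp hq => rw [map_mul]; exact mul_mem hp hq
  | add p q hp hq => rw [map_add]; exact add_mem hp hq

/-- The bracket of two generators is a scalar, and the Leibniz rule multiplies it only by elements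
over `x` or over `y`; all of these lie in the subalgebra of `w`. -/
lemma totalBracket_mem_range {x y w : Finset M} (hx : x ⊆ w) (hy : y ⊆ w) (a : ChFib V x)
    (b : ChFib V y) :
    totalBracket V smU k (toTotal V x a) (toTotal V y b) ∈ (toTotal V w).range := by
  induction a using ChFib.induction with
  | scalar r => simp
  | gen i u =>
    rw [toTotal_chSingle]
    induction b using ChFib.induction with
    | scalar r => simp
    | gen j v =>
      rw [toTotal_chSingle, FibSym.lift_ι, FibSym.lift_ι, totalBracket_totalGen]
      exact Subalgebra.algebraMap_mem _ _
    | mul p q hp hq =>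
      rw [map_mul, polyBracket_mul_right]
      exact add_mem (mul_mem (toTotal_mem_range V hy p) hq) (mul_mem (toTotal_mem_range V hy q) hp)
    | add p q hp hq => rw [map_add, map_add]; exact add_mem hp hq
  | mul p q hp hq =>
    rw [map_mul, polyBracket_mul_left]
    exact add_mem (mul_mem (toTotal_mem_range V hx p) hq) (mul_mem (toTotal_mem_range V hx q) hp)
  | add p q hp hq => rw [map_add, map_add, Derivation.add_apply]; exact add_mem hp hq

/-- The projection `ofTotal` in the definition of the bracket loses nothing, because the polynomial
bracket already lies in the image of the fibre over `w`. After this, fibrewise identities for the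
bracket are polynomial ones. -/
lemma toTotal_kernelBracket {w x y : Finset M} (h : IsSplit w x y) (a : ChFib V x)
    (b : ChFib V y) :
    toTotal V w (kernelBracket V smM smU k w
      (cauchyMk (V := cauchyHadamard smM smU V) (W := cauchyHadamard smM smU V) h a b))
      = totalBracket V smU k (toTotal V _ a) (toTotal V _ b) := by
  rw [kernelBracket_mk]
  obtain ⟨c, hc⟩ := totalBracket_mem_range V smU k h.left_subset h.right_subset a b
  rw [← hc]
  exact congrArg _ (ofTotal_toTotal V w c)

lemma chMulH_tmul (x : Finset M) (a b : ChFib V x) :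
    chMulH smM smU V x (a ⊗ₜ b) = a * b := rfl

lemma chUnitH_one (x : Finset M) : chUnitH smM smU V x 1 = (1 : ChFib V x) :=
  one_smul 𝕜 (1 : ChFib V x)

lemma chMulC_mk {w x y : Finset M} (h : IsSplit w x y) (a : ChFib V x) (b : ChFib V y) :
    chMulC smM smU V w
      (cauchyMk (V := cauchyHadamard smM smU V) (W := cauchyHadamard smM smU V) h a b)
      = boxdot (symBundle smM V) h (a ⊗ₜ b) :=
  sum_proj_cauchyMk (P := cauchyHadamard smM smU V) (Q := cauchyHadamard smM smU V) _ h a b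

lemma boxdot_tprod_tprod {w x y : Finset M} (h : IsSplit w x y)
    (s : ∀ a : {a : M // a ∈ x}, FibSym 𝕜 (V.fib a.1))
    (t : ∀ a : {a : M // a ∈ y}, FibSym 𝕜 (V.fib a.1)) :
    ∃ r : ∀ a : {a : M // a ∈ w}, FibSym 𝕜 (V.fib a.1),
      boxdot (symBundle smM V) h (PiTensorProduct.tprod 𝕜 s ⊗ₜ PiTensorProduct.tprod 𝕜 t)
        = PiTensorProduct.tprod 𝕜 r ∧
      (∀ a : {a : M // a ∈ x}, r ⟨a.1, h.left_subset a.2⟩ = s a) ∧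
      ∀ a : {a : M // a ∈ y}, r ⟨a.1, h.right_subset a.2⟩ = t a := by
  classical
  let r : ∀ a : {a : M // a ∈ w}, FibSym 𝕜 (V.fib a.1) := fun a =>
    if ha : a.1 ∈ x then s ⟨a.1, ha⟩ else t ⟨a.1, ((h.2 _).1 a.2).resolve_left ha⟩
  have hs : ∀ a : {a : M // a ∈ x}, r ⟨a.1, h.left_subset a.2⟩ = s a := fun a => dif_pos a.2
  have ht : ∀ a : {a : M // a ∈ y}, r ⟨a.1, h.right_subset a.2⟩ = t a := fun a =>
    dif_neg (Finset.disjoint_right.1 h.1 a.2)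
  refine ⟨r, ?_, hs, ht⟩
  rw [← boxdot_tprod (symBundle smM V) h r]
  congr 2
  · exact congrArg _ (funext fun a => (hs a).symm)
  · exact congrArg _ (funext fun a => (ht a).symm)

/-- On pure tensors both sides are products of the images of the factors, over the points of `w` on
one side and over those of `x` and `y` on the other. -/
lemma toTotal_boxdot {w x y : Finset M} (h : IsSplit w x y) (a : ChFib V x) (b : ChFib V y) :
    toTotal V w (boxdot (symBundle smM V) h (a ⊗ₜ b)) = toTotal V x a * toTotal V y b := by
  classical
  have key : (toTotal V w).toLinearMap ∘ₗ boxdot (symBundle smM V) h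
      = LinearMap.mul' 𝕜 _ ∘ₗ TensorProduct.map (toTotal V x).toLinearMap
        (toTotal V y).toLinearMap := by
    refine TensorProduct.ext (PiTensorProduct.ext (MultilinearMap.ext fun s =>
      PiTensorProduct.ext (MultilinearMap.ext fun t => ?_)))
    obtain ⟨r, hr, hs, ht⟩ := boxdot_tprod_tprod V smM h s t
    change toTotal V w (boxdot (symBundle smM V) h
      (PiTensorProduct.tprod 𝕜 s ⊗ₜ PiTensorProduct.tprod 𝕜 t))
        = toTotal V x (PiTensorProduct.tprod 𝕜 s) * toTotal V y (PiTensorProduct.tprod 𝕜 t)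
    rw [hr]
    rw [toTotal_tprod, toTotal_tprod, toTotal_tprod, ← h.equiv.prod_comp, Fintype.prod_sum_type]
    congr 1
    · exact Finset.prod_congr rfl fun a _ => congrArg _ (hs a)
    · exact Finset.prod_congr rfl fun a _ => congrArg _ (ht a)
  exact LinearMap.congr_fun key (a ⊗ₜ b)

end Bracket

/-! ### Algebraic laws, existence and uniqueness of the bracket -/

section KernelBracket

variable {M : Type u} {𝕜 : Type} [RCLike 𝕜] (V : PreBundle.{u, v} 𝕜 M) [TopologicalSpace M]
  (smM : (M → 𝕜) → M → Prop) (smU : (Finset M → 𝕜) → Finset M → Prop)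
  (k : ∀ w, (cauchy smU (pushforward V) (pushforward V)).fib w →ₗ[𝕜] (trivialLine smU).fib w)

lemma toTotal_chMulC {w x y : Finset M} (h : IsSplit w x y) (a : ChFib V x) (b : ChFib V y) :
    toTotal V w (chMulC smM smU V w
      (cauchyMk (V := cauchyHadamard smM smU V) (W := cauchyHadamard smM smU V) h a b))
      = toTotal V x a * toTotal V y b := by
  rw [chMulC_mk]
  exact toTotal_boxdot V smM h a b

lemma toTotal_chMulH (x : Finset M) (a b : ChFib V x) :
    toTotal V x (chMulH smM smU V x (a ⊗ₜ b)) = toTotal V x a * toTotal V x b :=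
  map_mul (toTotal V x) a b

lemma toTotal_chUnitH (x : Finset M) : toTotal V x (chUnitH smM smU V x 1) = 1 := by
  rw [chUnitH_one]
  exact map_one (toTotal V x)

lemma chGen_eq (a : M) (u : V.fib a) : chGen smM smU V a u
    = chSingle V {a} ⟨a, Finset.mem_singleton_self a⟩ (FibSym.ι 𝕜 _ u) := rfl

lemma toTotal_chGen (a : M) (u : V.fib a) :
    toTotal V {a} (chGen smM smU V a u) = totalGen V a u := by
  rw [chGen_eq, toTotal_chSingle, FibSym.lift_ι]

theorem isKernelBracket_kernelBracket :
    IsKernelBracket smM smU V k (kernelBracket V smM smU k) where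
  unit_unit h := by
    apply toTotal_injective
    rw [toTotal_kernelBracket, toTotal_chUnitH, toTotal_chUnitH, map_zero]
    simp
  unit_right h a := by
    apply toTotal_injective
    rw [toTotal_kernelBracket, toTotal_chUnitH, map_zero]
    simp
  unit_left h a := by
    apply toTotal_injective
    rw [toTotal_kernelBracket, toTotal_chUnitH, map_zero]
    simp
  generators h u v := by
    apply toTotal_injective
    rw [toTotal_kernelBracket, toTotal_chGen, toTotal_chGen, totalBracket_totalGen,
      kernelForm_eq V smU k h]
    refine Eq.trans ?_ (map_smul (toTotal V _) _ _).symm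
    rw [toTotal_chMulC, toTotal_chUnitH, toTotal_chUnitH, mul_one, Algebra.algebraMap_eq_smul_one]
  leibnizH_left h a b c := by
    apply toTotal_injective
    refine Eq.trans ?_ (map_add (toTotal V _) _ _).symm
    repeat rw [toTotal_kernelBracket]
    repeat rw [toTotal_chMulH]
    repeat rw [toTotal_kernelBracket]
    repeat rw [toTotal_chMulC]
    rw [toTotal_chUnitH, polyBracket_mul_left]
    ring
  leibnizH_right h a b c := by
    apply toTotal_injective
    refine Eq.trans ?_ (map_add (toTotal V _) _ _).symm
    repeat rw [toTotal_kernelBracket]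
    repeat rw [toTotal_chMulH]
    repeat rw [toTotal_kernelBracket]
    repeat rw [toTotal_chMulC]
    rw [toTotal_chUnitH, polyBracket_mul_right]
    ring
  leibnizC_left hxy hxz hyz h₁ h₂ h₃ a b c := by
    apply toTotal_injective
    refine Eq.trans ?_ (map_add (toTotal V _) _ _).symm
    repeat rw [toTotal_kernelBracket]
    repeat rw [toTotal_chMulC]
    repeat rw [toTotal_kernelBracket]
    rw [polyBracket_mul_left]
    ring
  leibnizC_right hxy hxz hyz h₁ h₂ h₃ a b c := by
    apply toTotal_injective
    refine Eq.trans ?_ (map_add (toTotal V _) _ _).symm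
    repeat rw [toTotal_kernelBracket]
    repeat rw [toTotal_chMulC]
    repeat rw [toTotal_kernelBracket]
    rw [polyBracket_mul_right]
    ring

lemma kernelBracket_antisymm (hk : IsAntisymmetricKernel smU V k) {x y w : Finset M}
    (h : IsSplit w x y) (a : ChFib V x) (b : ChFib V y) :
    kernelBracket V smM smU k w
      (cauchyMk (V := cauchyHadamard smM smU V) (W := cauchyHadamard smM smU V) h a b)
    = -kernelBracket V smM smU k w
      (cauchyMk (V := cauchyHadamard smM smU V) (W := cauchyHadamard smM smU V) h.symm b a) := by
  apply toTotal_injective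
  refine Eq.trans ?_ (map_neg (toTotal V _) _).symm
  rw [toTotal_kernelBracket, toTotal_kernelBracket]
  exact polyBracket_antisymm _ _ _ fun i j => kernelForm_antisymm V smU k hk _ _ _ _

lemma kernelBracket_jacobi (hk : IsAntisymmetricKernel smU V k)
    {x y z xy yz zx w : Finset M} (hxy : IsSplit xy x y) (hyz : IsSplit yz y z)
    (hzx : IsSplit zx z x) (h₁ : IsSplit w xy z) (h₂ : IsSplit w yz x) (h₃ : IsSplit w zx y)
    (a : (cauchyHadamard smM smU V).fib x) (b : (cauchyHadamard smM smU V).fib y)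
    (c : (cauchyHadamard smM smU V).fib z) :
    kernelBracket V smM smU k w (cauchyMk h₁ (kernelBracket V smM smU k xy (cauchyMk hxy a b)) c)
      + kernelBracket V smM smU k w (cauchyMk h₂ (kernelBracket V smM smU k yz (cauchyMk hyz b c)) a)
      + kernelBracket V smM smU k w (cauchyMk h₃ (kernelBracket V smM smU k zx (cauchyMk hzx c a)) b)
      = 0 := by
  apply toTotal_injective
  refine (map_add (toTotal V _) _ _).trans ?_
  refine (congrArg₂ (· + ·) (map_add (toTotal V _) _ _) rfl).trans ?_
  repeat rw [toTotal_kernelBracket]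
  rw [map_zero]
  exact polyBracket_jacobi _ _ _ _ fun i j => kernelForm_antisymm V smU k hk _ _ _ _

/-- Writing a generator over a large configuration as a generator over one point times a unit makes
it accessible to the Leibniz rule for $\boxdot$ and to the normalisation on generators. -/
lemma chSingle_eq_chMulC {x y : Finset M} (a : M) (h : IsSplit x {a} y) (ha : a ∈ x)
    (u : V.fib a) :
    chSingle V x ⟨a, ha⟩ (FibSym.ι 𝕜 _ u)
      = chMulC smM smU V x (cauchyMk h (chGen smM smU V a u) (chUnitH smM smU V y 1)) := by
  apply toTotal_injective
  rw [toTotal_chMulC, toTotal_chGen, toTotal_chUnitH, toTotal_chSingle, FibSym.lift_ι, mul_one]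

omit [TopologicalSpace M] in
lemma exists_isSplit_singleton {x : Finset M} {a : M} (ha : a ∈ x) : ∃ y, IsSplit x {a} y := by
  classical
  refine ⟨x.erase a, Finset.disjoint_singleton_left.2 (Finset.notMem_erase a x), fun b => ?_⟩
  by_cases hb : b = a <;> simp [hb, ha]

omit [TopologicalSpace M] in
lemma exists_isSplit {x y z xy w : Finset M} (hxy : IsSplit xy x y) (h : IsSplit w xy z) :
    ∃ xz yz, IsSplit xz x z ∧ IsSplit yz y z ∧ IsSplit w xz y ∧ IsSplit w x yz := by
  have hx : Disjoint x z := h.1.mono_left hxy.left_subset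
  have hy : Disjoint y z := h.1.mono_left hxy.right_subset
  refine ⟨x.disjUnion z hx, y.disjUnion z hy, isSplit_disjUnion _, isSplit_disjUnion _,
    ⟨?_, fun a => ?_⟩, ?_, fun a => ?_⟩
  · rw [Finset.disjoint_disjUnion_left]
    exact ⟨hxy.1, hy.symm⟩
  · rw [h.2, hxy.2, Finset.mem_disjUnion]
    tauto
  · rw [Finset.disjoint_disjUnion_right]
    exact ⟨hxy.1, hx⟩
  · rw [h.2, hxy.2, Finset.mem_disjUnion]
    tauto

/-- Induction on both arguments along algebra generators: scalars bracket to zero by the unit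
conditions, and products are handled by the Leibniz rules for $\odot$. For two generators the
Leibniz rules for $\boxdot$ strip off all other points, where only units stand. -/
theorem IsKernelBracket.unique
    {br br' : ∀ w, (cauchy smU (cauchyHadamard smM smU V) (cauchyHadamard smM smU V)).fib w →ₗ[𝕜]
      (cauchyHadamard smM smU V).fib w}
    (H : IsKernelBracket smM smU V k br) (H' : IsKernelBracket smM smU V k br') : br = br' := by
  have key : ∀ {x y w : Finset M} (h : IsSplit w x y) (a : ChFib V x) (b : ChFib V y),
      br w (cauchyMk (V := cauchyHadamard smM smU V) (W := cauchyHadamard smM smU V) h a b)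
        = br' w (cauchyMk (V := cauchyHadamard smM smU V) (W := cauchyHadamard smM smU V) h a b) := by
    have hadd1 : ∀ (br : ∀ w, (cauchy smU (cauchyHadamard smM smU V)
        (cauchyHadamard smM smU V)).fib w →ₗ[𝕜] (cauchyHadamard smM smU V).fib w)
        {x y w : Finset M} (h : IsSplit w x y) (p q : ChFib V x) (b : ChFib V y),
        br w (cauchyMk (V := cauchyHadamard smM smU V) (W := cauchyHadamard smM smU V) h (p + q) b)
        = br w (cauchyMk (V := cauchyHadamard smM smU V) (W := cauchyHadamard smM smU V) h p b)
        + br w (cauchyMk (V := cauchyHadamard smM smU V) (W := cauchyHadamard smM smU V) h q b) := by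
      intro br x y w h p q b
      simp only [← cauchyIncl_tmul, TensorProduct.add_tmul, map_add]
    have hadd2 : ∀ (br : ∀ w, (cauchy smU (cauchyHadamard smM smU V)
        (cauchyHadamard smM smU V)).fib w →ₗ[𝕜] (cauchyHadamard smM smU V).fib w)
        {x y w : Finset M} (h : IsSplit w x y) (b : ChFib V x) (p q : ChFib V y),
        br w (cauchyMk (V := cauchyHadamard smM smU V) (W := cauchyHadamard smM smU V) h b (p + q))
        = br w (cauchyMk (V := cauchyHadamard smM smU V) (W := cauchyHadamard smM smU V) h b p)
        + br w (cauchyMk (V := cauchyHadamard smM smU V) (W := cauchyHadamard smM smU V) h b q) := by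
      intro br x y w h b p q
      simp only [← cauchyIncl_tmul, TensorProduct.tmul_add, map_add]
    have hs1 : ∀ {br : ∀ w, (cauchy smU (cauchyHadamard smM smU V)
        (cauchyHadamard smM smU V)).fib w →ₗ[𝕜] (cauchyHadamard smM smU V).fib w}
        (_ : IsKernelBracket smM smU V k br)
        {x y w : Finset M} (h : IsSplit w x y) (r : 𝕜) (b : ChFib V y),
        br w (cauchyMk (V := cauchyHadamard smM smU V) (W := cauchyHadamard smM smU V) h
          (algebraMap 𝕜 (ChFib V x) r) b) = 0 := by
      intro br H x y w h r b
      rw [Algebra.algebraMap_eq_smul_one, ← cauchyIncl_tmul, ← TensorProduct.smul_tmul', map_smul,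
        map_smul, cauchyIncl_tmul, ← chUnitH_one V smM smU, H.unit_left, smul_zero]
    have hs2 : ∀ {br : ∀ w, (cauchy smU (cauchyHadamard smM smU V)
        (cauchyHadamard smM smU V)).fib w →ₗ[𝕜] (cauchyHadamard smM smU V).fib w}
        (_ : IsKernelBracket smM smU V k br)
        {x y w : Finset M} (h : IsSplit w x y) (r : 𝕜) (b : ChFib V x),
        br w (cauchyMk (V := cauchyHadamard smM smU V) (W := cauchyHadamard smM smU V) h
          b (algebraMap 𝕜 (ChFib V y) r)) = 0 := by
      intro br H x y w h r b
      rw [Algebra.algebraMap_eq_smul_one, ← cauchyIncl_tmul, TensorProduct.tmul_smul, map_smul,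
        map_smul, cauchyIncl_tmul, ← chUnitH_one V smM smU, H.unit_right, smul_zero]
    intro x y w h a b
    induction a using ChFib.induction with
    | scalar r => rw [hs1 H, hs1 H']
    | add p q hp hq => rw [hadd1, hadd1, hp, hq]
    | mul p q hp hq =>
      rw [← chMulH_tmul V smM smU, H.leibnizH_left, H'.leibnizH_left, hp, hq]
    | gen i u =>
      induction b using ChFib.induction with
      | scalar r => rw [hs2 H, hs2 H']
      | add p q hp hq => rw [hadd2, hadd2, hp, hq]
      | mul p q hp hq =>
        rw [← chMulH_tmul V smM smU, H.leibnizH_right, H'.leibnizH_right, hp, hq]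
      | gen j v =>
        obtain ⟨x', hx'⟩ := exists_isSplit_singleton i.2
        obtain ⟨y', hy'⟩ := exists_isSplit_singleton j.2
        -- Here `t` is the point of `i` together with `y`, and `r` consists of the two points of `i`
        -- and `j`. The remainders `x'` and `y'` carry units, so the Leibniz terms that
        -- differentiate them vanish.
        obtain ⟨t, t', ht, ht', htw, htw'⟩ := exists_isSplit hx' h
        obtain ⟨r, r', hr, hr', hrt, hrt'⟩ := exists_isSplit hy' ht.symm
        rw [chSingle_eq_chMulC V smM smU i.1 hx' i.2 u, H.leibnizC_left hx' ht ht' h htw htw',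
          H'.leibnizC_left hx' ht ht' h htw htw', H.unit_left, H'.unit_left,
          chSingle_eq_chMulC V smM smU j.1 hy' j.2 v,
          H.leibnizC_right hr.symm hr'.symm hy' ht hrt hrt',
          H'.leibnizC_right hr.symm hr'.symm hy' ht hrt hrt', H.unit_right, H'.unit_right,
          H.generators, H'.generators]
  exact funext fun w => cauchyFib_hom_ext (P := cauchyHadamard smM smU V)
    (Q := cauchyHadamard smM smU V) fun h a b => key h a b

lemma chMulC_assoc {x y z xy yz w : Finset M} (hxy : IsSplit xy x y) (hyz : IsSplit yz y z)
    (h : IsSplit w xy z) (h' : IsSplit w x yz) (a : (cauchyHadamard smM smU V).fib x)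
    (b : (cauchyHadamard smM smU V).fib y) (c : (cauchyHadamard smM smU V).fib z) :
    chMulC smM smU V w (cauchyMk h (chMulC smM smU V xy (cauchyMk hxy a b)) c)
      = chMulC smM smU V w (cauchyMk h' a (chMulC smM smU V yz (cauchyMk hyz b c))) := by
  apply toTotal_injective
  repeat rw [toTotal_chMulC]
  exact mul_assoc _ _ _

lemma chMulC_comm {x y w : Finset M} (h : IsSplit w x y) (a : (cauchyHadamard smM smU V).fib x)
    (b : (cauchyHadamard smM smU V).fib y) :
    chMulC smM smU V w (cauchyMk h a b) = chMulC smM smU V w (cauchyMk h.symm b a) := by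
  apply toTotal_injective
  repeat rw [toTotal_chMulC]
  exact mul_comm _ _

lemma chMulC_one_left {w x y : Finset M} (h : IsSplit w x y)
    (a : (cauchyHadamard smM smU V).fib y) :
    toTotal V w (chMulC smM smU V w (cauchyMk h (chUnitH smM smU V x 1) a)) = toTotal V y a := by
  rw [toTotal_chMulC, toTotal_chUnitH, one_mul]

lemma chUnitC_empty : chUnitC smM smU V ∅ (fun _ => 1) = chUnitH smM smU V ∅ 1 := by
  unfold chUnitC
  rw [dif_pos rfl]
  exact one_smul 𝕜 _

lemma chMulC_unit_left {x : Finset M} (h : IsSplit x ∅ x) (a : (cauchyHadamard smM smU V).fib x) :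
    chMulC smM smU V x (cauchyMk h (chUnitC smM smU V ∅ fun _ => 1) a) = a := by
  apply toTotal_injective
  rw [chUnitC_empty, chMulC_one_left]

lemma chMulC_interchange {x y w : Finset M} (h : IsSplit w x y)
    (a b : (cauchyHadamard smM smU V).fib x) (c d : (cauchyHadamard smM smU V).fib y) :
    chMulC smM smU V w (cauchyMk h (chMulH smM smU V x (a ⊗ₜ b)) (chMulH smM smU V y (c ⊗ₜ d)))
      = chMulH smM smU V w (chMulC smM smU V w (cauchyMk h a c) ⊗ₜ
          chMulC smM smU V w (cauchyMk h b d)) := by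
  apply toTotal_injective
  rw [toTotal_chMulH]
  repeat rw [toTotal_chMulC]
  repeat rw [toTotal_chMulH]
  exact mul_mul_mul_comm _ _ _ _

lemma chMulC_chUnitH {x y w : Finset M} (h : IsSplit w x y) :
    chMulC smM smU V w (cauchyMk h (chUnitH smM smU V x 1) (chUnitH smM smU V y 1))
      = chUnitH smM smU V w 1 := by
  apply toTotal_injective
  rw [chMulC_one_left, toTotal_chUnitH, toTotal_chUnitH]

end KernelBracket

/-! ## The topology of the configuration space -/

section Topology

variable {M : Type u} {n : ℕ}

lemma mem_conf {p : Fin n → M} {a : M} : a ∈ conf p ↔ ∃ i, p i = a := by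
  simp [conf]

lemma apply_mem_conf (p : Fin n → M) (i : Fin n) : p i ∈ conf p := mem_conf.2 ⟨i, rfl⟩

lemma conf_eq_map {p : Fin n → M} (hp : Function.Injective p) :
    conf p = Finset.univ.map ⟨p, hp⟩ := by
  ext a
  simp [mem_conf]

lemma card_conf {p : Fin n → M} (hp : Function.Injective p) : (conf p).card = n := by
  rw [conf_eq_map hp, Finset.card_map, Finset.card_univ, Fintype.card_fin]

lemma exists_conf_eq (x : Finset M) :
    ∃ (n : ℕ) (p : Fin n → M), Function.Injective p ∧ conf p = x := by
  refine ⟨x.card, fun i => (x.equivFin.symm i).1,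
    Subtype.val_injective.comp x.equivFin.symm.injective, Finset.ext fun a => ?_⟩
  rw [mem_conf]
  exact ⟨fun ⟨i, hi⟩ => hi ▸ (x.equivFin.symm i).2, fun ha => ⟨x.equivFin ⟨a, ha⟩, by simp⟩⟩

open Classical in
/-- The points of a configuration which satisfy `Q`. -/
def confFilter (Q : M → Prop) (y : Finset M) : Finset M := y.filter Q

@[simp] lemma mem_confFilter {Q : M → Prop} {y : Finset M} {a : M} :
    a ∈ confFilter Q y ↔ a ∈ y ∧ Q a := by
  classical
  exact Finset.mem_filter

lemma confFilter_subset (Q : M → Prop) (y : Finset M) : confFilter Q y ⊆ y :=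
  fun _ ha => (mem_confFilter.1 ha).1

variable [TopologicalSpace M]

lemma continuous_conf :
    Continuous fun p : {p : Fin n → M // Function.Injective p} => conf p.1 :=
  continuous_iff_coinduced_le.2 (le_iSup (fun k : ℕ => TopologicalSpace.coinduced
    (fun p : {p : Fin k → M // Function.Injective p} => conf p.1) inferInstance) n)

/-- Two injective tuples with the same underlying set differ by a permutation, so the saturation of
`U` is the union of its permuted copies. Tuples of any other length have configurations of another
cardinality. -/
lemma isOpenMap_conf :
    IsOpenMap fun p : {p : Fin n → M // Function.Injective p} => conf p.1 := by
  intro U hU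
  refine isOpen_iSup_iff.2 fun j => isOpen_coinduced.2 ?_
  by_cases hj : j = n
  · subst hj
    let act : Equiv.Perm (Fin j) → {p : Fin j → M // Function.Injective p} →
      {p : Fin j → M // Function.Injective p} := fun s p => ⟨p.1 ∘ s, p.2.comp s.injective⟩
    have hact : ∀ s, Continuous (act s) := fun s => by
      refine Continuous.subtype_mk (continuous_pi fun i => ?_) _
      exact (continuous_apply (s i)).comp continuous_subtype_val
    have : (fun p : {p : Fin j → M // Function.Injective p} => conf p.1) ⁻¹'
        ((fun p => conf p.1) '' U) = ⋃ s, act s ⁻¹' U := by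
      ext p
      simp only [Set.mem_preimage, Set.mem_image, Set.mem_iUnion]
      constructor
      · rintro ⟨q, hq, hqp⟩
        have h1 : ∀ i, ∃ l, p.1 l = q.1 i := fun i =>
          mem_conf.1 (hqp ▸ apply_mem_conf q.1 i)
        choose s hs using h1
        have hsi : Function.Injective s := fun i i' h =>
          q.2 ((hs i).symm.trans ((congrArg p.1 h).trans (hs i')))
        refine ⟨Equiv.ofBijective s (Finite.injective_iff_bijective.1 hsi), ?_⟩
        convert hq
        exact Subtype.ext (funext hs)
      · rintro ⟨s, hs⟩
        refine ⟨_, hs, Finset.ext fun a => ?_⟩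
        rw [mem_conf, mem_conf]
        exact ⟨fun ⟨i, hi⟩ => ⟨s i, hi⟩, fun ⟨i, hi⟩ => ⟨s.symm i, by simpa [act] using hi⟩⟩
    rw [this]
    exact isOpen_iUnion fun s => hU.preimage (hact s)
  · convert isOpen_empty
    refine Set.eq_empty_of_forall_notMem fun p ⟨q, _, hq⟩ => hj ?_
    rw [← card_conf p.2, ← card_conf q.2]
    exact congrArg _ hq.symm

variable [T2Space M]

lemma eventually_injective {p : Fin n → M} (hp : Function.Injective p) :
    ∀ᶠ q in 𝓝 p, Function.Injective q := by
  have : ∀ i j : Fin n, ∀ᶠ q in 𝓝 p, q i = q j → i = j := fun i j => by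
    by_cases hij : i = j
    · exact Filter.Eventually.of_forall fun _ _ => hij
    · have ho : IsOpen {q : Fin n → M | q i ≠ q j} :=
        isOpen_ne_fun (continuous_apply i) (continuous_apply j)
      filter_upwards [ho.mem_nhds (hp.ne hij)] with q hq hq'
      exact absurd hq' hq
  have h2 := Filter.eventually_all.2 fun i => Filter.eventually_all.2 (this i)
  filter_upwards [h2] with q hq i j h
  exact hq i j h

/-- The quotient map is open and continuous, and by the Hausdorff property the injective tuples form
a neighbourhood of `p` in the full power, so the restriction to them can be dropped. -/
lemma nhds_conf {p : Fin n → M} (hp : Function.Injective p) :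
    𝓝 (conf p) = Filter.map conf (𝓝 p) := by
  have h1 := isOpenMap_conf.map_nhds_eq (x := (⟨p, hp⟩ : {p : Fin n → M // Function.Injective p}))
    continuous_conf.continuousAt
  rw [← h1, ← map_nhds_subtype_coe_eq_nhds hp (eventually_injective hp), Filter.map_map]
  rfl

lemma eventually_nhds_conf {p : Fin n → M} (hp : Function.Injective p) {Q : Finset M → Prop} :
    (∀ᶠ y in 𝓝 (conf p), Q y) ↔ ∀ᶠ q in 𝓝 p, Q (conf q) := by
  rw [nhds_conf hp, Filter.eventually_map]

lemma eventually_forall_mem {x : Finset M} {Q : M → Prop} (h : ∀ a ∈ x, ∀ᶠ c in 𝓝 a, Q c) :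
    ∀ᶠ y in 𝓝 x, ∀ c ∈ y, Q c := by
  obtain ⟨n, p, hp, rfl⟩ := exists_conf_eq x
  rw [eventually_nhds_conf hp]
  have : ∀ i, ∀ᶠ q in 𝓝 p, Q (q i) := fun i =>
    ((continuous_apply i).continuousAt (x := p)).eventually (h _ (apply_mem_conf p i))
  filter_upwards [Filter.eventually_all.2 this] with q hq c hc
  obtain ⟨i, rfl⟩ := mem_conf.1 hc
  exact hq i

/-- `ρ` maps a neighbourhood of `a` to `a`, for all points `a` of the configuration `x`. -/
def IsLocalRetraction (ρ : M → M) (x : Finset M) : Prop := ∀ a ∈ x, ∀ᶠ b in 𝓝 a, ρ b = a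

/-- Finitely many points of a Hausdorff space have disjoint neighbourhoods; each is collapsed to its
centre. The values elsewhere are irrelevant. -/
lemma exists_isLocalRetraction (x : Finset M) : ∃ ρ : M → M, IsLocalRetraction ρ x := by
  classical
  obtain ⟨U, hU, hd⟩ := x.finite_toSet.t2_separation
  refine ⟨fun b => if h : ∃ a ∈ x, b ∈ U a then h.choose else b, fun a ha => ?_⟩
  filter_upwards [(hU a).2.mem_nhds (hU a).1] with b hb
  have h : ∃ a ∈ x, b ∈ U a := ⟨a, ha, hb⟩
  rw [dif_pos h]
  by_contra hne
  exact Set.disjoint_left.1 (hd h.choose_spec.1 ha hne) h.choose_spec.2 hb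

omit [T2Space M] in
lemma IsLocalRetraction.mono {ρ : M → M} {x y : Finset M} (h : IsLocalRetraction ρ x)
    (hy : y ⊆ x) : IsLocalRetraction ρ y := fun a ha => h a (hy ha)

omit [T2Space M] in
lemma IsLocalRetraction.apply {ρ : M → M} {x : Finset M} (h : IsLocalRetraction ρ x) {a : M}
    (ha : a ∈ x) : ρ a = a := (h a ha).self_of_nhds

/-- A configuration near `x` comes from a tuple near an enumeration of `x`, so it has exactly one
point near each point of `x`. -/
lemma IsLocalRetraction.eventually_bijOn {ρ : M → M} {x : Finset M} (h : IsLocalRetraction ρ x) :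
    ∀ᶠ y : Finset M in 𝓝 x, Set.BijOn ρ y x := by
  obtain ⟨n, p, hp, rfl⟩ := exists_conf_eq x
  rw [eventually_nhds_conf hp]
  have : ∀ i, ∀ᶠ q in 𝓝 p, ρ (q i) = p i := fun i =>
    ((continuous_apply i).continuousAt (x := p)).eventually (h _ (apply_mem_conf p i))
  filter_upwards [Filter.eventually_all.2 this] with q hq
  refine ⟨fun c hc => ?_, fun c hc c' hc' hcc' => ?_, fun a ha => ?_⟩
  · obtain ⟨i, rfl⟩ := mem_conf.1 hc
    exact (hq i).symm ▸ apply_mem_conf p i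
  · obtain ⟨i, rfl⟩ := mem_conf.1 hc
    obtain ⟨j, rfl⟩ := mem_conf.1 hc'
    rw [hq, hq] at hcc'
    rw [hp hcc']
  · obtain ⟨i, rfl⟩ := mem_conf.1 ha
    exact ⟨q i, apply_mem_conf q i, hq i⟩

/-- This passes from `x` to its neighbours `y`: there `ρ` does not fix the points of `y`, but it is
still locally constant at them. Frame conditions have to be verified at all such `y`. -/
lemma IsLocalRetraction.eventually {ρ : M → M} {x : Finset M} (h : IsLocalRetraction ρ x) :
    ∀ᶠ y : Finset M in 𝓝 x, ∀ c ∈ y, ∀ᶠ b in 𝓝 c, ρ b = ρ c :=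
  eventually_forall_mem fun a ha => by
    filter_upwards [(h a ha).eventually_nhds] with c hc
    filter_upwards [hc] with b hb
    rw [hb, hc.self_of_nhds]

omit [T2Space M] in
/-- A splitting of tuples near `p` by a predicate which is locally constant at the points of `p`. -/
lemma exists_filter_conf {p : Fin n → M} (hp : Function.Injective p) {Q : M → Prop}
    (hQ : ∀ a ∈ conf p, ∀ᶠ b in 𝓝 a, (Q b ↔ Q a)) :
    ∃ e : Fin (confFilter Q (conf p)).card → Fin n, Function.Injective e ∧
      ∀ᶠ q in 𝓝 p, confFilter Q (conf q) = conf (q ∘ e) := by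
  classical
  have hc : (Finset.univ.filter fun i => Q (p i)).card = (confFilter Q (conf p)).card := by
    unfold confFilter
    rw [conf_eq_map hp, Finset.filter_map, Finset.card_map]
    rfl
  refine ⟨(Finset.univ.filter fun i => Q (p i)).orderEmbOfFin hc,
    (Finset.orderEmbOfFin _ hc).injective, ?_⟩
  have : ∀ i, ∀ᶠ q in 𝓝 p, (Q (q i) ↔ Q (p i)) := fun i =>
    ((continuous_apply i).continuousAt (x := p)).eventually (hQ _ (apply_mem_conf p i))
  filter_upwards [Filter.eventually_all.2 this] with q hq
  ext a
  rw [mem_confFilter, mem_conf, mem_conf]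
  -- The range of the order embedding is exactly the set of indices selected by `Q` at `p`, and near
  -- `p` the selected indices do not change.
  have hr : ∀ i, Q (p i) ↔ ∃ j, (Finset.univ.filter fun i => Q (p i)).orderEmbOfFin hc j = i := by
    intro i
    have h2 := Finset.range_orderEmbOfFin (Finset.univ.filter fun i => Q (p i)) hc
    have h3 := Set.ext_iff.1 h2 i
    rw [Set.mem_range] at h3
    rw [h3]
    simp
  constructor
  · rintro ⟨⟨i, rfl⟩, h⟩
    obtain ⟨j, hj⟩ := (hr i).1 ((hq i).1 h)
    exact ⟨j, congrArg q hj⟩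
  · rintro ⟨j, rfl⟩
    exact ⟨⟨_, rfl⟩, (hq _).2 ((hr _).2 ⟨j, rfl⟩)⟩

/-- In tuples, filtering by a predicate locally constant at the points of `x` is selection of a
fixed set of coordinates, which is continuous. -/
lemma tendsto_filter_nhds {x : Finset M} {Q : M → Prop}
    (hQ : ∀ a ∈ x, ∀ᶠ b in 𝓝 a, (Q b ↔ Q a)) :
    Filter.Tendsto (fun y : Finset M => confFilter Q y) (𝓝 x) (𝓝 (confFilter Q x)) := by
  obtain ⟨n, p, hp, rfl⟩ := exists_conf_eq x
  obtain ⟨e, he, h⟩ := exists_filter_conf hp hQ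
  rw [h.self_of_nhds, nhds_conf hp, nhds_conf (hp.comp he)]
  refine Filter.tendsto_map'_iff.2 ?_
  refine Filter.Tendsto.congr' (Filter.EventuallyEq.symm h) ?_
  refine Filter.tendsto_map.comp ?_
  exact (continuous_pi fun i => continuous_apply (e i)).tendsto p

end Topology

/-! ## Smooth functions -/

/-- The laws of a pointwise notion of smoothness of scalar functions: smooth functions
form an algebra and smoothness is local. -/
structure IsSmoothAlgebra {𝕜 : Type} [RCLike 𝕜] {X : Type u} [TopologicalSpace X]
    (sm : (X → 𝕜) → X → Prop) : Prop where
  const : ∀ (r : 𝕜) (x : X), sm (fun _ => r) x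
  add : ∀ {f g : X → 𝕜} {x : X}, sm f x → sm g x → sm (fun y => f y + g y) x
  mul : ∀ {f g : X → 𝕜} {x : X}, sm f x → sm g x → sm (fun y => f y * g y) x
  congr : ∀ {f g : X → 𝕜} {x : X}, sm f x → (∀ᶠ y in 𝓝 x, f y = g y) → sm g x

namespace IsSmoothAlgebra

variable {𝕜 : Type} [RCLike 𝕜] {X : Type u} [TopologicalSpace X] {sm : (X → 𝕜) → X → Prop}

lemma sum (H : IsSmoothAlgebra sm) {ι : Type*} (s : Finset ι) {f : ι → X → 𝕜} {x : X}
    (h : ∀ i ∈ s, sm (f i) x) : sm (fun y => ∑ i ∈ s, f i y) x := by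
  classical
  induction s using Finset.induction_on with
  | empty => simpa using H.const 0 x
  | insert a s ha ih =>
    simp only [Finset.sum_insert ha]
    exact H.add (h a (Finset.mem_insert_self a s)) (ih fun i hi => h i (Finset.mem_insert_of_mem hi))

lemma prod (H : IsSmoothAlgebra sm) {ι : Type*} (s : Finset ι) {f : ι → X → 𝕜} {x : X}
    (h : ∀ i ∈ s, sm (f i) x) : sm (fun y => ∏ i ∈ s, f i y) x := by
  classical
  induction s using Finset.induction_on with
  | empty => simpa using H.const 1 x
  | insert a s ha ih =>
    simp only [Finset.prod_insert ha]
    exact H.mul (h a (Finset.mem_insert_self a s)) (ih fun i hi => h i (Finset.mem_insert_of_mem hi))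

end IsSmoothAlgebra

section SmoothFunctions

variable {𝕜 : Type} [RCLike 𝕜]
  {E : Type v} [NormedAddCommGroup E] [NormedSpace ℝ E] {H : Type w} [TopologicalSpace H]
  (I : ModelWithCorners ℝ E H) {M : Type u} [TopologicalSpace M] [ChartedSpace H M]

variable {E' : Type*} [NormedAddCommGroup E'] [NormedSpace ℝ E'] {H' : Type*} [TopologicalSpace H']
  {J : ModelWithCorners ℝ E' H'} {N : Type*} [TopologicalSpace N] [ChartedSpace H' N]

lemma ContMDiffAt.mul_rclike {f g : N → 𝕜} {x : N} (hf : ContMDiffAt J 𝓘(ℝ, 𝕜) ∞ f x)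
    (hg : ContMDiffAt J 𝓘(ℝ, 𝕜) ∞ g x) : ContMDiffAt J 𝓘(ℝ, 𝕜) ∞ (fun y => f y * g y) x :=
  (contDiff_mul (𝕜 := ℝ) (𝔸 := 𝕜)).contDiffAt.contMDiffAt.comp x (hf.prodMk_space hg)

lemma isSmoothAlgebra_contMDiffAt :
    IsSmoothAlgebra fun (f : N → 𝕜) (x : N) => ContMDiffAt J 𝓘(ℝ, 𝕜) ∞ f x where
  const _ _ := contMDiffAt_const
  add hf hg := ContMDiffAt.add hf hg
  mul hf hg := ContMDiffAt.mul_rclike hf hg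
  congr hf h := ContMDiffAt.congr_of_eventuallyEq hf (Filter.EventuallyEq.symm h)

lemma isSmoothAlgebra_smoothM : IsSmoothAlgebra (SmoothM 𝕜 I : (M → 𝕜) → M → Prop) :=
  isSmoothAlgebra_contMDiffAt

lemma SmoothM.inv {f : M → 𝕜} {x : M} (hf : SmoothM 𝕜 I f x) (h : f x ≠ 0) :
    SmoothM 𝕜 I (fun y => (f y)⁻¹) x :=
  ((contDiffAt_inv ℝ h).contMDiffAt (n := ∞)).comp x hf

lemma SmoothM.continuousAt {f : M → 𝕜} {x : M} (hf : SmoothM 𝕜 I f x) : ContinuousAt f x :=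
  ContMDiffAt.continuousAt hf

lemma isSmoothAlgebra_smoothU [T2Space M] :
    IsSmoothAlgebra (SmoothU 𝕜 I : (Finset M → 𝕜) → Finset M → Prop) where
  const _ _ _ _ _ := contMDiffAt_const
  add hf hg p hp hpx := ContMDiffAt.add (hf p hp hpx) (hg p hp hpx)
  mul hf hg p hp hpx := ContMDiffAt.mul_rclike (hf p hp hpx) (hg p hp hpx)
  congr {f g x} hf h p hp hpx := by
    refine ContMDiffAt.congr_of_eventuallyEq (hf p hp hpx) ?_
    rw [← hpx, eventually_nhds_conf hp] at h
    filter_upwards [h] with q hq using hq.symm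

lemma mem_extChartAt_target_of_pi {n : ℕ} {p : Fin n → M} {z : Fin n → E}
    (hz : z ∈ (extChartAt (ModelWithCorners.pi fun _ : Fin n => I) p).target) (j : Fin n) :
    z j ∈ (extChartAt I (p j)).target := by
  rw [extChartAt_target] at hz ⊢
  obtain ⟨h1, y, rfl⟩ := hz
  exact ⟨h1 j trivial, y j, rfl⟩

/-- The chart of the power at `p` is the product of the charts at the `p i`, so in charts the map is
a linear selection of coordinates near the base point. -/
lemma contMDiffAt_pi_comp {m n : ℕ} (e : Fin m → Fin n) (p : Fin n → M) :
    ContMDiffAt (ModelWithCorners.pi fun _ : Fin n => I) (ModelWithCorners.pi fun _ : Fin m => I) ∞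
      (fun (q : Fin n → M) (i : Fin m) => q (e i)) p := by
  rw [contMDiffAt_iff]
  refine ⟨(continuous_pi fun i => continuous_apply (e i)).continuousAt, ?_⟩
  have hl : ContDiff ℝ ∞ fun (z : Fin n → E) (i : Fin m) => z (e i) :=
    contDiff_pi.2 fun i => contDiff_apply ℝ E (e i)
  refine hl.contDiffWithinAt.congr_of_eventuallyEq ?_ ?_
  · filter_upwards [extChartAt_target_mem_nhdsWithin
      (I := ModelWithCorners.pi fun _ : Fin n => I) p] with z hz
    funext i
    have hz' := mem_extChartAt_target_of_pi I hz
    exact (extChartAt I (p (e i))).right_inv (hz' (e i))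
  · funext i
    exact (extChartAt I (p (e i))).right_inv (mem_extChartAt_target (I := I) (p (e i)))

lemma contMDiffAt_pi_apply {n : ℕ} (i : Fin n) (p : Fin n → M) :
    ContMDiffAt (ModelWithCorners.pi fun _ : Fin n => I) I ∞ (fun q : Fin n → M => q i) p := by
  rw [contMDiffAt_iff]
  refine ⟨(continuous_apply i).continuousAt, ?_⟩
  refine (contDiff_apply ℝ E i).contDiffWithinAt.congr_of_eventuallyEq ?_ ?_
  · filter_upwards [extChartAt_target_mem_nhdsWithin
      (I := ModelWithCorners.pi fun _ : Fin n => I) p] with z hz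
    have hz' := mem_extChartAt_target_of_pi I hz
    exact (extChartAt I (p i)).right_inv (hz' i)
  · exact (extChartAt I (p i)).right_inv (mem_extChartAt_target (I := I) (p i))

lemma SmoothU.contMDiffAt {n : ℕ} {p : Fin n → M} (hp : Function.Injective p) {x : Finset M}
    (hpx : conf p = x) {f : Finset M → 𝕜} (hf : SmoothU 𝕜 I f x) :
    ContMDiffAt (ModelWithCorners.pi fun _ : Fin n => I) 𝓘(ℝ, 𝕜) ∞ (fun q => f (conf q)) p := by
  have hn : x.card = n := hpx ▸ card_conf hp
  subst hn
  exact hf p hp hpx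

/-- On tuples, passing to the subconfiguration is locally the smooth map `q ↦ q ∘ e` for a fixed
injection `e`. -/
lemma SmoothU.comp_filter {f : Finset M → 𝕜} {x : Finset M} {Q : M → Prop}
    (hQ : ∀ a ∈ x, ∀ᶠ b in 𝓝 a, (Q b ↔ Q a)) (hf : SmoothU 𝕜 I f (confFilter Q x)) :
    SmoothU 𝕜 I (fun y => f (confFilter Q y)) x := by
  intro p hp hpx
  obtain ⟨e, he, h⟩ := exists_filter_conf hp (hpx ▸ hQ)
  have h1 := (hf.contMDiffAt I (hp.comp he) (h.self_of_nhds.symm.trans (congrArg (confFilter Q) hpx))).comp p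
    (contMDiffAt_pi_comp I e p)
  refine h1.congr_of_eventuallyEq ?_
  filter_upwards [h] with q hq
  rw [hq]
  rfl

lemma SmoothU.finset_prod [T2Space M] {h : M → 𝕜} {x : Finset M} (hh : ∀ a ∈ x, SmoothM 𝕜 I h a) :
    SmoothU 𝕜 I (fun y => ∏ b ∈ y, h b) x := by
  intro p hp hpx
  have h1 : ContMDiffAt (ModelWithCorners.pi fun _ : Fin x.card => I) 𝓘(ℝ, 𝕜) ∞
      (fun q : Fin x.card → M => ∏ i, h (q i)) p :=
    isSmoothAlgebra_contMDiffAt.prod _ fun i _ =>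
      ContMDiffAt.comp p (hh (p i) (hpx ▸ apply_mem_conf p i)) (contMDiffAt_pi_apply I i p)
  refine h1.congr_of_eventuallyEq ?_
  filter_upwards [eventually_injective hp] with q hq
  rw [conf_eq_map hq, Finset.prod_map]
  rfl

end SmoothFunctions

/-! ## Generated smooth structures -/

section GenSmooth

variable {𝕜 : Type} [RCLike 𝕜] {X : Type u} [TopologicalSpace X] {sm : (X → 𝕜) → X → Prop}
  {fib : X → Type v} [∀ x, AddCommGroup (fib x)] [∀ x, Module 𝕜 (fib x)]
  {G : (∀ x, fib x) → X → Prop} {x : X} {s t : ∀ x, fib x}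

namespace GenSmoothAt

lemma congr (hs : GenSmoothAt sm G s x) (h : ∀ᶠ y in 𝓝 x, s y = t y) : GenSmoothAt sm G t x := by
  obtain ⟨n, f, g, hf, hg, hs⟩ := hs
  refine ⟨n, f, g, hf, hg, ?_⟩
  filter_upwards [hs, h] with y h1 h2
  rw [← h2, h1]

lemma zero : GenSmoothAt sm G (fun _ => 0) x :=
  ⟨0, Fin.elim0, Fin.elim0, fun j => j.elim0, fun j => j.elim0, by simp⟩

lemma of_gen (H : IsSmoothAlgebra sm) (hs : G s x) : GenSmoothAt sm G s x :=
  ⟨1, fun _ _ => 1, fun _ => s, fun _ => H.const 1 x, fun _ => hs, by simp⟩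

lemma add (hs : GenSmoothAt sm G s x) (ht : GenSmoothAt sm G t x) :
    GenSmoothAt sm G (fun y => s y + t y) x := by
  obtain ⟨n, f, g, hf, hg, hs⟩ := hs
  obtain ⟨m, f', g', hf', hg', ht⟩ := ht
  refine ⟨n + m, Fin.append f f', Fin.append g g', fun j => ?_, fun j => ?_, ?_⟩
  · refine Fin.addCases (fun i => ?_) (fun i => ?_) j
    · rw [Fin.append_left]; exact hf i
    · rw [Fin.append_right]; exact hf' i
  · refine Fin.addCases (fun i => ?_) (fun i => ?_) j
    · rw [Fin.append_left]; exact hg i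
    · rw [Fin.append_right]; exact hg' i
  · filter_upwards [hs, ht] with y h1 h2
    rw [h1, h2, Fin.sum_univ_add]
    simp only [Fin.append_left, Fin.append_right]

lemma smul (H : IsSmoothAlgebra sm) {f : X → 𝕜} (hf : sm f x) (hs : GenSmoothAt sm G s x) :
    GenSmoothAt sm G (fun y => f y • s y) x := by
  obtain ⟨n, f', g, hf', hg, hs⟩ := hs
  refine ⟨n, fun j y => f y * f' j y, g, fun j => H.mul hf (hf' j), hg, ?_⟩
  filter_upwards [hs] with y h1
  simp only [h1, Finset.smul_sum, mul_smul]

/-- Induction on a smooth section at `x`. -/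
theorem induction {motive : (∀ x, fib x) → Prop}
    (congr : ∀ s t, (∀ᶠ y in 𝓝 x, s y = t y) → motive s → motive t)
    (zero : motive fun _ => 0)
    (add : ∀ s t, motive s → motive t → motive fun y => s y + t y)
    (smul : ∀ f s, sm f x → motive s → motive fun y => f y • s y)
    (gen : ∀ s, G s x → motive s) (hs : GenSmoothAt sm G s x) : motive s := by
  obtain ⟨n, f, g, hf, hg, hs⟩ := hs
  have : ∀ S : Finset (Fin n), motive fun y => ∑ j ∈ S, f j y • g j y := fun S => by
    classical
    induction S using Finset.induction_on with
    | empty => simpa using zero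
    | insert a S ha ih =>
      simp only [Finset.sum_insert ha]
      exact add _ _ (smul _ _ (hf a) (gen _ (hg a))) ih
  exact congr _ _ (hs.mono fun y hy => hy.symm) (this Finset.univ)

lemma sum {ι : Type*} (S : Finset ι) {f : ι → ∀ x, fib x} (hf : ∀ i ∈ S, GenSmoothAt sm G (f i) x) :
    GenSmoothAt sm G (fun y => ∑ i ∈ S, f i y) x := by
  classical
  induction S using Finset.induction_on with
  | empty => simpa using zero
  | insert a S ha ih =>
    simp only [Finset.sum_insert ha]
    exact add (hf a (Finset.mem_insert_self a S)) (ih fun i hi => hf i (Finset.mem_insert_of_mem hi))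

end GenSmoothAt

end GenSmooth

/-! ### Products of smooth sections of the symmetric bundle -/

section SymSections

variable {𝕜 : Type} [RCLike 𝕜] {X : Type u} [TopologicalSpace X] {sm : (X → 𝕜) → X → Prop}
  {V : PreBundle.{u, v} 𝕜 X} {x : X} {s t : ∀ x, FibSym 𝕜 (V.fib x)}

variable (sm V) in
/-- The smooth sections of the symmetric bundle. -/
abbrev SmoothSym (s : ∀ x, FibSym 𝕜 (V.fib x)) (x : X) : Prop :=
  GenSmoothAt sm (fun s x => ∃ l : List (∀ y, V.fib y),
    (∀ v ∈ l, V.SmoothAt v x) ∧ s = fun y => (l.map fun v => FibSym.ι 𝕜 _ (v y)).prod) s x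

lemma smoothSym_one (H : IsSmoothAlgebra sm) :
    SmoothSym sm V (fun _ => (1 : FibSym 𝕜 (V.fib _))) x :=
  GenSmoothAt.of_gen H ⟨[], by simp, by simp⟩

/-- By bilinearity only generating sections matter, and their product is the generator of the
concatenated list. -/
lemma smoothSym_mul (H : IsSmoothAlgebra sm) (hs : SmoothSym sm V s x)
    (ht : SmoothSym sm V t x) : SmoothSym sm V (fun y => s y * t y) x := by
  refine GenSmoothAt.induction (motive := fun s => SmoothSym sm V (fun y => s y * t y) x)
    (fun s s' h hs => GenSmoothAt.congr hs ?_) ?_ ?_ ?_ ?_ hs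
  · filter_upwards [h] with y hy using by rw [hy]
  · simpa using GenSmoothAt.zero
  · intro s s' hs hs'
    simp only [add_mul]
    exact GenSmoothAt.add hs hs'
  · intro f s hf hs
    simp only [smul_mul_assoc]
    exact GenSmoothAt.smul H hf hs
  rintro _ ⟨l, hl, rfl⟩
  refine GenSmoothAt.induction (motive := fun t => SmoothSym sm V
    (fun y => (l.map fun v => FibSym.ι 𝕜 _ (v y)).prod * t y) x)
    (fun s s' h hs => GenSmoothAt.congr hs ?_) ?_ ?_ ?_ ?_ ht
  · filter_upwards [h] with y hy using by rw [hy]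
  · simpa using GenSmoothAt.zero
  · intro s s' hs hs'
    simp only [mul_add]
    exact GenSmoothAt.add hs hs'
  · intro f s hf hs
    simp only [mul_smul_comm]
    exact GenSmoothAt.smul H hf hs
  rintro _ ⟨l', hl', rfl⟩
  refine GenSmoothAt.of_gen H ⟨l ++ l', fun v hv => ?_, by simp⟩
  exact (List.mem_append.1 hv).elim (hl v) (hl' v)

lemma smoothSym_ι (H : IsSmoothAlgebra sm) {v : ∀ x, V.fib x} (hv : V.SmoothAt v x) :
    SmoothSym sm V (fun y => FibSym.ι 𝕜 _ (v y)) x :=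
  GenSmoothAt.of_gen H ⟨[v], by simpa using hv, by simp⟩

end SymSections

/-! ## Smooth sections of the Cauchy-Hadamard bundle -/

section ChSections

variable {𝕜 : Type} [RCLike 𝕜]
  {E : Type*} [NormedAddCommGroup E] [NormedSpace ℝ E] {H : Type*} [TopologicalSpace H]
  (I : ModelWithCorners ℝ E H) {M : Type u} [TopologicalSpace M] [ChartedSpace H M]
  (V : PreBundle.{u, v} 𝕜 M)

/-- The Cauchy-Hadamard bundle over the configuration space of a manifold. -/
abbrev chBundle : PreBundle.{u, max u v} 𝕜 (Finset M) :=
  cauchyHadamard (SmoothM 𝕜 I) (SmoothU 𝕜 I) V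

/-- The smooth sections of the Cauchy-Hadamard bundle. -/
abbrev SmoothCh (s : ∀ y, ChFib V y) (x : Finset M) : Prop :=
  GenSmoothAt (SmoothU 𝕜 I) (fun s x => ∃ w : ∀ a, FibSym 𝕜 (V.fib a),
    (∀ a ∈ x, SmoothSym (SmoothM 𝕜 I) V w a) ∧
      s = fun (y : Finset M) => PiTensorProduct.tprod 𝕜 fun a : {a : M // a ∈ y} => w a.1) s x

variable {V} {x : Finset M} {s t : ∀ y, ChFib V y}

omit [TopologicalSpace M] in
lemma tprod_mul {x : Finset M} (w w' : ∀ a : {a : M // a ∈ x}, FibSym 𝕜 (V.fib a.1)) :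
    (PiTensorProduct.tprod 𝕜 w * PiTensorProduct.tprod 𝕜 w' : ChFib V x)
      = PiTensorProduct.tprod 𝕜 fun a => w a * w' a :=
  PiTensorProduct.tprod_mul_tprod w w'

variable [T2Space M]

lemma smoothCh_tprod {w : ∀ a, FibSym 𝕜 (V.fib a)}
    (hw : ∀ a ∈ x, SmoothSym (SmoothM 𝕜 I) V w a) :
    SmoothCh I V
      (fun y => (PiTensorProduct.tprod 𝕜 fun a : {a : M // a ∈ y} => w a.1 : ChFib V y)) x :=
  GenSmoothAt.of_gen (isSmoothAlgebra_smoothU I) ⟨w, hw, rfl⟩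

lemma smoothCh_one : SmoothCh I V (fun y => (1 : ChFib V y)) x :=
  smoothCh_tprod I fun _ _ => smoothSym_one (isSmoothAlgebra_smoothM I)

lemma smoothCh_mul (hs : SmoothCh I V s x) (ht : SmoothCh I V t x) :
    SmoothCh I V (fun y => s y * t y) x := by
  have H := isSmoothAlgebra_smoothU (𝕜 := 𝕜) (M := M) I
  refine GenSmoothAt.induction (motive := fun s => SmoothCh I V
    (fun y => (s y * t y : ChFib V y)) x) (fun s s' h hs => GenSmoothAt.congr hs ?_) ?_ ?_ ?_ ?_ hs
  · filter_upwards [h] with y hy using by rw [hy]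
  · simpa using GenSmoothAt.zero
  · intro s s' hs hs'
    simp only [add_mul]
    exact GenSmoothAt.add hs hs'
  · intro f s hf hs
    simp only [smul_mul_assoc]
    exact GenSmoothAt.smul H hf hs
  rintro _ ⟨w, hw, rfl⟩
  refine GenSmoothAt.induction (motive := fun t => SmoothCh I V
    (fun y => ((PiTensorProduct.tprod 𝕜 fun a : {a : M // a ∈ y} => w a.1) * t y : ChFib V y)) x)
    (fun s s' h hs => GenSmoothAt.congr hs ?_) ?_ ?_ ?_ ?_ ht
  · filter_upwards [h] with y hy using by rw [hy]
  · simpa using GenSmoothAt.zero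
  · intro s s' hs hs'
    simp only [mul_add]
    exact GenSmoothAt.add hs hs'
  · intro f s hf hs
    simp only [mul_smul_comm]
    exact GenSmoothAt.smul H hf hs
  rintro _ ⟨w', hw', rfl⟩
  simp only [tprod_mul]
  exact smoothCh_tprod I (w := fun a => w a * w' a) fun a ha =>
    smoothSym_mul (isSmoothAlgebra_smoothM I) (hw a ha) (hw' a ha)

theorem isBundleMap_chMulH :
    IsBundleMap (V := hadamard (SmoothU 𝕜 I) (chBundle I V) (chBundle I V)) (W := chBundle I V)
      (chMulH (SmoothM 𝕜 I) (SmoothU 𝕜 I) V) := by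
  intro s x hs
  have hs : GenSmoothAt (SmoothU 𝕜 I) (fun s x => ∃ (v w : ∀ y, ChFib V y),
    SmoothCh I V v x ∧ SmoothCh I V w x ∧ s = fun y => v y ⊗ₜ[𝕜] w y) s x := hs
  have H := isSmoothAlgebra_smoothU (𝕜 := 𝕜) (M := M) I
  refine GenSmoothAt.induction (motive := fun s => SmoothCh I V
    (fun y => chMulH (SmoothM 𝕜 I) (SmoothU 𝕜 I) V y (s y)) x)
    (fun s s' h hs => GenSmoothAt.congr hs ?_) ?_ ?_ ?_ ?_ hs
  · filter_upwards [h] with y hy using by rw [hy]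
  · simpa using GenSmoothAt.zero
  · intro s s' hs hs'
    simp only [map_add]
    exact GenSmoothAt.add hs hs'
  · intro f s hf hs
    simp only [map_smul]
    exact GenSmoothAt.smul H hf hs
  rintro _ ⟨v, w, hv, hw, rfl⟩
  exact smoothCh_mul I hv hw

theorem isBundleMap_chUnitH :
    IsBundleMap (V := trivialLine (SmoothU 𝕜 I)) (W := chBundle I V)
      (chUnitH (SmoothM 𝕜 I) (SmoothU 𝕜 I) V) := by
  intro f x hf
  exact (GenSmoothAt.smul (isSmoothAlgebra_smoothU I) hf (smoothCh_one I) :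
    SmoothCh I V (fun y => f y • (1 : ChFib V y)) x)

omit [T2Space M] in
-- The empty configuration forms a component by itself: there is only one tuple of length zero, and
-- tuples of positive length never have empty image.
lemma smoothU_of_empty {f : Finset M → 𝕜} (hf : ∀ y, y ≠ ∅ → f y = 0) (x : Finset M) :
    SmoothU 𝕜 I f x := by
  intro p hp hpx
  by_cases hx : x = ∅
  · subst hx
    convert contMDiffAt_const (c := f ∅) using 2 with q
    exact congrArg f (Finset.eq_empty_of_forall_notMem fun a ha => (mem_conf.1 ha).choose.elim0)
  · convert contMDiffAt_const (c := (0 : 𝕜)) using 2 with q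
    refine hf _ fun hq => hx ?_
    have : Nonempty (Fin x.card) := Fin.pos_iff_nonempty.1 (Finset.card_pos.2
      (Finset.nonempty_iff_ne_empty.2 hx))
    have h := apply_mem_conf q (Classical.arbitrary _)
    rw [hq] at h
    exact absurd h (Finset.notMem_empty _)

theorem isBundleMap_chUnitC :
    IsBundleMap (V := cauchyUnit 𝕜 M) (W := chBundle I V)
      (chUnitC (SmoothM 𝕜 I) (SmoothU 𝕜 I) V) := by
  classical
  intro s x _
  -- A section of the Cauchy unit is a scalar at the empty configuration; extended by zero it is a
  -- smooth function, and the map becomes multiplication of this function with the smooth section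
  -- `1`.
  let f : Finset M → 𝕜 := fun y => if h : y = ∅ then s y ⟨h⟩ else 0
  have hf : SmoothU 𝕜 I f x := smoothU_of_empty I (fun y hy => dif_neg hy) x
  have h1 : SmoothCh I V (fun y => chUnitH (SmoothM 𝕜 I) (SmoothU 𝕜 I) V y (f y)) x :=
    isBundleMap_chUnitH I f x hf
  refine GenSmoothAt.congr h1 (Filter.Eventually.of_forall fun y => ?_)
  unfold chUnitC
  by_cases hy : y = ∅
  · simp only [f, dif_pos hy]
    rw [LinearMap.smulRight_apply, LinearMap.proj_apply, ← map_smul, smul_eq_mul, mul_one]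
  · simp only [f, dif_neg hy, map_zero, LinearMap.zero_apply]

end ChSections

/-! ### Splits of nearby configurations -/

section Splitting

variable {M : Type u}

lemma isSplit_filter (y : Finset M) (Q : M → Prop) :
    IsSplit y (confFilter Q y) (confFilter (fun a => ¬Q a) y) := by
  refine ⟨Finset.disjoint_left.2 fun a ha ha' => (mem_confFilter.1 ha').2 (mem_confFilter.1 ha).2,
    fun a => ?_⟩
  rw [mem_confFilter, mem_confFilter]
  tauto

/-- If `ρ` maps `y` bijectively to `x`, the splits of `y` correspond to the subsets of `x`. -/
lemma sum_splits_eq {N : Type*} [AddCommMonoid N] {ρ : M → M} {x y : Finset M}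
    (h : Set.BijOn ρ y x) (f : Splits y → N) :
    ∑ p, f p = ∑ x' ∈ x.powerset, f ⟨(_, _), isSplit_filter y fun a => ρ a ∈ x'⟩ := by
  classical
  symm
  refine Finset.sum_bij (fun x' _ => ⟨(_, _), isSplit_filter y fun a => ρ a ∈ x'⟩)
    (fun _ _ => Finset.mem_univ _) (fun x' hx' x'' hx'' heq => ?_) (fun p _ => ?_)
    (fun _ _ => rfl)
  · have h1 : confFilter (fun a => ρ a ∈ x') y = confFilter (fun a => ρ a ∈ x'') y :=
      congrArg (fun p : Splits y => p.1.1) heq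
    have h2 : ∀ a ∈ x, a ∈ x' ↔ a ∈ x'' := fun a ha => by
      obtain ⟨b, hb, rfl⟩ := h.surjOn ha
      have := Finset.ext_iff.1 h1 b
      simpa [Finset.mem_coe.1 hb] using this
    ext a
    exact ⟨fun ha => (h2 a (Finset.mem_powerset.1 hx' ha)).1 ha,
      fun ha => (h2 a (Finset.mem_powerset.1 hx'' ha)).2 ha⟩
  · have h1 : ∀ a ∈ y, ρ a ∈ p.1.1.image ρ ↔ a ∈ p.1.1 := fun a ha => by
      rw [Finset.mem_image]
      refine ⟨fun ⟨b, hb, hba⟩ => ?_, fun ha => ⟨a, ha, rfl⟩⟩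
      rwa [← h.injOn (p.2.left_subset hb) ha hba]
    refine ⟨p.1.1.image ρ, ?_, Subtype.ext (Prod.ext (Finset.ext fun a => ?_)
      (Finset.ext fun a => ?_))⟩
    · rw [Finset.mem_powerset]
      intro a ha
      obtain ⟨b, hb, rfl⟩ := Finset.mem_image.1 ha
      exact h.mapsTo (p.2.left_subset hb)
    · exact mem_confFilter.trans ⟨fun ha => (h1 a ha.1).1 ha.2,
        fun ha => ⟨p.2.left_subset ha, (h1 a (p.2.left_subset ha)).2 ha⟩⟩
    · refine mem_confFilter.trans ⟨fun ha => ((p.2.2 a).1 ha.1).resolve_left fun h2 => ha.2 ((h1 a ha.1).2 h2),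
        fun ha => ⟨p.2.right_subset ha, fun h2 => ?_⟩⟩
      exact Finset.disjoint_right.1 p.2.1 ha ((h1 a (p.2.right_subset ha)).1 h2)

end Splitting

/-! ### Extension of fibres to larger configurations -/

section Extension

variable {M : Type u} {𝕜 : Type} [RCLike 𝕜] (V : PreBundle.{u, v} 𝕜 M)

/-- The map `a ↦ a ⊡ 1` from the fibre over `x` to the fibre over a larger configuration `y`. -/
def chExtend (x y : Finset M) : ChFib V x →ₐ[𝕜] ChFib V y := (ofTotal V y).comp (toTotal V x)

lemma toTotal_chExtend {x y : Finset M} (h : x ⊆ y) (a : ChFib V x) :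
    toTotal V y (chExtend V x y a) = toTotal V x a := by
  obtain ⟨b, hb⟩ := toTotal_mem_range V h a
  have hb : toTotal V y b = toTotal V x a := hb
  rw [chExtend, AlgHom.comp_apply, ← hb, ofTotal_toTotal]

lemma toTotal_tprod_restrict (x : Finset M) (w : ∀ a, FibSym 𝕜 (V.fib a)) :
    toTotal V x (PiTensorProduct.tprod 𝕜 fun a : {a : M // a ∈ x} => w a.1)
      = ∏ a ∈ x, FibSym.lift (totalGen V a) (w a) := by
  rw [toTotal_tprod]
  exact Finset.prod_coe_sort x fun a => FibSym.lift (totalGen V a) (w a)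

open Classical in
lemma chExtend_tprod (y : Finset M) (Q : M → Prop) (w : ∀ a, FibSym 𝕜 (V.fib a)) :
    chExtend V (confFilter Q y) y (PiTensorProduct.tprod 𝕜 fun a : {a : M // a ∈ confFilter Q y} => w a.1)
      = PiTensorProduct.tprod 𝕜 fun a : {a : M // a ∈ y} => if Q a.1 then w a.1 else 1 := by
  apply toTotal_injective
  rw [toTotal_chExtend V (confFilter_subset _ _), toTotal_tprod_restrict,
    toTotal_tprod_restrict V y fun a => if Q a then w a else 1, confFilter, Finset.prod_filter]
  refine Finset.prod_congr rfl fun a _ => ?_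
  split_ifs <;> simp

/-- This factors $\boxdot$ through extension by units and the product inside one fibre, the form in
which its smoothness is proved. -/
lemma boxdot_eq_mul [TopologicalSpace M] (smM : (M → 𝕜) → M → Prop) {w x y : Finset M}
    (h : IsSplit w x y) (a : ChFib V x) (b : ChFib V y) :
    boxdot (symBundle smM V) h (a ⊗ₜ b) = chExtend V x w a * chExtend V y w b := by
  apply toTotal_injective
  rw [toTotal_boxdot, map_mul, toTotal_chExtend V h.left_subset, toTotal_chExtend V h.right_subset]

end Extension

/-! ### Smoothness of maps on Cauchy products -/

section SmoothMaps

variable {𝕜 : Type} [RCLike 𝕜]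
  {E : Type*} [NormedAddCommGroup E] [NormedSpace ℝ E] {H : Type*} [TopologicalSpace H]
  (I : ModelWithCorners ℝ E H) {M : Type u} [TopologicalSpace M] [ChartedSpace H M]
  [T2Space M] {V : PreBundle.{u, v} 𝕜 M}

/-- On a pure tensor section the extension puts the factor `1` at the points failing `Q`. Since `Q`
is locally constant at the points of `x`, the glued family of factors is smooth there. -/
lemma smoothCh_chExtend {x : Finset M} {Q : M → Prop} (hQ : ∀ a ∈ x, ∀ᶠ b in 𝓝 a, (Q b ↔ Q a))
    {s : ∀ y, ChFib V y} (hs : SmoothCh I V s (confFilter Q x)) :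
    SmoothCh I V (fun y => chExtend V (confFilter Q y) y (s (confFilter Q y))) x := by
  refine GenSmoothAt.induction (motive := fun s =>
    SmoothCh I V (fun y => chExtend V (confFilter Q y) y (s (confFilter Q y))) x)
    (fun s s' h hs => GenSmoothAt.congr hs ?_) ?_ ?_ ?_ ?_ hs
  · filter_upwards [(tendsto_filter_nhds hQ).eventually h] with y hy using by rw [hy]
  · simpa using GenSmoothAt.zero
  · intro s s' hs hs'
    simp only [map_add]
    exact GenSmoothAt.add hs hs'
  · intro f s hf hs
    simp only [map_smul]
    exact GenSmoothAt.smul (isSmoothAlgebra_smoothU I) (hf.comp_filter I hQ) hs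
  classical
  rintro _ ⟨w, hw, rfl⟩
  simp only [chExtend_tprod]
  refine smoothCh_tprod I (w := fun a => if Q a then w a else 1) fun a ha => ?_
  by_cases hqa : Q a
  · refine GenSmoothAt.congr (hw a (mem_confFilter.2 ⟨ha, hqa⟩)) ?_
    filter_upwards [hQ a ha] with b hb
    rw [if_pos (hb.2 hqa)]
  · refine GenSmoothAt.congr (smoothSym_one (isSmoothAlgebra_smoothM I)) ?_
    filter_upwards [hQ a ha] with b hb
    rw [if_neg (fun h => hqa (hb.1 h))]

/-- A family of linear maps on the Cauchy square of the Cauchy-Hadamard bundle is smooth if its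
components are. -/
lemma isBundleMap_of_components
    (T : ∀ y, (cauchy (SmoothU 𝕜 I) (chBundle I V) (chBundle I V)).fib y →ₗ[𝕜]
      (chBundle I V).fib y)
    (hT : ∀ (x : Finset M) (Q : M → Prop) (_ : ∀ a ∈ x, ∀ᶠ b in 𝓝 a, (Q b ↔ Q a))
      (φ ψ : ∀ y, ChFib V y), SmoothCh I V φ (confFilter Q x) →
      SmoothCh I V ψ (confFilter (fun a => ¬Q a) x) →
      SmoothCh I V (fun y => T y (cauchyMk (V := chBundle I V) (W := chBundle I V)
        (isSplit_filter y Q) (φ _) (ψ _))) x) :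
    IsBundleMap (V := cauchy (SmoothU 𝕜 I) (chBundle I V) (chBundle I V)) (W := chBundle I V)
      T := by
  intro s x hs
  have hs : GenSmoothAt (SmoothU 𝕜 I) (fun s x => ∃ (φ ψ : ∀ y, ChFib V y),
    (∀ x' ⊆ x, SmoothCh I V φ x' ∧ SmoothCh I V ψ x') ∧
      s = fun (y : Finset M) (p : Splits y) => φ p.1.1 ⊗ₜ[𝕜] ψ p.1.2) s x := hs
  refine GenSmoothAt.induction (motive := fun s => SmoothCh I V (fun y => T y (s y)) x)
    (fun s s' h hs => GenSmoothAt.congr hs ?_) ?_ ?_ ?_ ?_ hs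
  · filter_upwards [h] with y hy using by rw [hy]
  · simpa using GenSmoothAt.zero
  · intro s s' hs hs'
    simp only [map_add]
    exact GenSmoothAt.add hs hs'
  · intro f s hf hs
    simp only [map_smul]
    exact GenSmoothAt.smul (isSmoothAlgebra_smoothU I) hf hs
  rintro _ ⟨φ, ψ, hφψ, rfl⟩
  -- The splits of `y` vary with `y`. The retraction indexes them by the fixed subsets `x'` of `x`,
  -- through the predicate that `ρ` lands in `x'`, and so turns the sum into one over a constant
  -- index set.
  obtain ⟨ρ, hρ⟩ := exists_isLocalRetraction x
  have hQ : ∀ x' : Finset M, ∀ a ∈ x, ∀ᶠ b in 𝓝 a, (ρ b ∈ x' ↔ ρ a ∈ x') := fun x' a ha => by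
    filter_upwards [hρ a ha] with b hb
    rw [hb, hρ.apply ha]
  refine GenSmoothAt.congr (GenSmoothAt.sum x.powerset fun x' _ => hT x (fun a => ρ a ∈ x') (hQ x')
    φ ψ (hφψ _ (confFilter_subset _ _)).1 (hφψ _ (confFilter_subset _ _)).2) ?_
  filter_upwards [hρ.eventually_bijOn] with y hy
  rw [cauchyFib_eq_sum (P := chBundle I V) (Q := chBundle I V), map_sum]
  exact (sum_splits_eq hy fun p => T y (cauchyMk (V := chBundle I V) (W := chBundle I V) p.2
    (φ p.1.1) (ψ p.1.2))).symm

theorem isBundleMap_chMulC :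
    IsBundleMap (V := cauchy (SmoothU 𝕜 I) (chBundle I V) (chBundle I V)) (W := chBundle I V)
      (chMulC (SmoothM 𝕜 I) (SmoothU 𝕜 I) V) := by
  classical
  refine isBundleMap_of_components I _ fun x Q hQ φ ψ hφ hψ => ?_
  have hQ' : ∀ a ∈ x, ∀ᶠ b in 𝓝 a, (¬Q b ↔ ¬Q a) := fun a ha => (hQ a ha).mono fun b hb => not_congr hb
  refine GenSmoothAt.congr (smoothCh_mul I (smoothCh_chExtend I hQ hφ) (smoothCh_chExtend I hQ' hψ))
    (Filter.Eventually.of_forall fun y => ?_)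
  rw [chMulC_mk, boxdot_eq_mul]

end SmoothMaps

/-! ### Local generators of the smooth sections -/

section Germs

variable {𝕜 : Type} [RCLike 𝕜]
  {E : Type*} [NormedAddCommGroup E] [NormedSpace ℝ E] {H : Type*} [TopologicalSpace H]
  (I : ModelWithCorners ℝ E H) {M : Type u} [TopologicalSpace M] [ChartedSpace H M]
  [T2Space M] {V : PreBundle.{u, v} 𝕜 M}

open Classical in
/-- The section of the Cauchy-Hadamard bundle which has the factor `w` at the points over `a`. -/
def chInsert (ρ : M → M) (a : M) (w : ∀ c, FibSym 𝕜 (V.fib c)) (y : Finset M) : ChFib V y :=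
  PiTensorProduct.tprod 𝕜 fun c : {c : M // c ∈ y} => if ρ c.1 = a then w c.1 else 1

omit [TopologicalSpace M] [ChartedSpace H M] [T2Space M] in
-- Injectivity of `ρ` on `y` leaves a single point over `a`. The inserted section thus becomes the
-- image of a single factor, and depends on `w` through an algebra homomorphism.
lemma exists_chInsert_eq {ρ : M → M} {x y : Finset M} (h : Set.BijOn ρ y x) {a : M} (ha : a ∈ x) :
    ∃ c : {c : M // c ∈ y}, ρ c.1 = a ∧
      ∀ w : ∀ c, FibSym 𝕜 (V.fib c), chInsert ρ a w y = chSingle V y c (w c.1) := by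
  classical
  obtain ⟨c, hc, rfl⟩ := h.surjOn ha
  refine ⟨⟨c, hc⟩, rfl, fun w => ?_⟩
  refine congrArg (PiTensorProduct.tprod 𝕜) (funext fun b => ?_)
  by_cases hb : b = ⟨c, hc⟩
  · subst hb
    rw [if_pos rfl]
    exact (Pi.mulSingle_eq_same (M := fun b : {b : M // b ∈ y} => FibSym 𝕜 (V.fib b.1)) _ _).symm
  · have hne : ¬ρ b.1 = ρ c := fun h' => hb (Subtype.ext (h.injOn b.2 hc h'))
    rw [if_neg hne]
    exact (Pi.mulSingle_eq_of_ne (M := fun b : {b : M // b ∈ y} => FibSym 𝕜 (V.fib b.1)) hb _).symm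

lemma chInsert_congr {ρ : M → M} {x : Finset M} (hρ : IsLocalRetraction ρ x) {a : M}
    {w w' : ∀ c, FibSym 𝕜 (V.fib c)} (h : ∀ᶠ c in 𝓝 a, w c = w' c) :
    ∀ᶠ y in 𝓝 x, chInsert ρ a w y = chInsert ρ a w' y := by
  classical
  have : ∀ᶠ y in 𝓝 x, ∀ c ∈ y, ρ c = a → w c = w' c := eventually_forall_mem fun b hb => by
    by_cases hba : b = a
    · subst hba
      filter_upwards [h] with c hc _ using hc
    · filter_upwards [hρ b hb] with c hc hca
      exact absurd (hc.symm.trans hca) hba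
  filter_upwards [this] with y hy
  refine congrArg (PiTensorProduct.tprod 𝕜) (funext fun c => ?_)
  by_cases hc : ρ c.1 = a
  · rw [if_pos hc, if_pos hc, hy c.1 c.2 hc]
  · rw [if_neg hc, if_neg hc]

lemma smoothCh_chInsert {x : Finset M} {ρ : M → M} (hρ : IsLocalRetraction ρ x) {a : M}
    {w : ∀ c, FibSym 𝕜 (V.fib c)} (hw : SmoothSym (SmoothM 𝕜 I) V w a) :
    SmoothCh I V (chInsert ρ a w) x := by
  classical
  refine smoothCh_tprod I (w := fun c => if ρ c = a then w c else 1) fun b hb => ?_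
  by_cases hba : b = a
  · subst hba
    refine hw.congr ?_
    filter_upwards [hρ b hb] with c hc
    rw [if_pos hc]
  · refine (smoothSym_one (isSmoothAlgebra_smoothM I)).congr ?_
    filter_upwards [hρ b hb] with c hc
    rw [if_neg (by rw [hc]; exact hba)]

/-- Near `x`, the smooth sections of the Cauchy-Hadamard bundle are generated, as an algebra over
the smooth functions, by the sections of `V` near the points of `x`. -/
theorem SmoothCh.generation {x : Finset M} {ρ : M → M} (hρ : IsLocalRetraction ρ x)
    {motive : (∀ y, ChFib V y) → Prop}
    (congr : ∀ s t, (∀ᶠ y in 𝓝 x, s y = t y) → motive s → motive t)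
    (one : motive fun _ => 1)
    (add : ∀ s t, motive s → motive t → motive fun y => s y + t y)
    (smul : ∀ f s, SmoothU 𝕜 I f x → motive s → motive fun y => f y • s y)
    (mul : ∀ s t, motive s → motive t → motive fun y => s y * t y)
    (gen : ∀ a ∈ x, ∀ v, V.SmoothAt v a → motive (chInsert ρ a fun c => FibSym.ι 𝕜 _ (v c)))
    {s : ∀ y, ChFib V y} (hs : SmoothCh I V s x) : motive s := by
  classical
  have zero : motive fun _ => 0 := by
    simpa using smul (fun _ => 0) _ ((isSmoothAlgebra_smoothU I).const 0 x) one
  have hins : ∀ a ∈ x, ∀ w, SmoothSym (SmoothM 𝕜 I) V w a → motive (chInsert ρ a w) := by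
    intro a ha w hw
    refine GenSmoothAt.induction (motive := fun w => motive (chInsert ρ a w))
      (fun s t h hs => congr _ _ (chInsert_congr hρ h) hs) ?_ ?_ ?_ ?_ hw
    · refine congr _ _ ?_ zero
      filter_upwards [hρ.eventually_bijOn] with y hy
      obtain ⟨c, _, hc⟩ := exists_chInsert_eq (V := V) hy ha
      rw [hc, map_zero]
    · intro w w' hw hw'
      refine congr _ _ ?_ (add _ _ hw hw')
      filter_upwards [hρ.eventually_bijOn] with y hy
      obtain ⟨c, _, hc⟩ := exists_chInsert_eq (V := V) hy ha
      rw [hc, hc, hc, map_add]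
    · intro f w hf hw
      -- A coefficient `f` near `a` has to become a function of the configuration: the product has
      -- the factor `f` at the point over `a` and `1` at all others, hence equals `f` at that point.
      have hf' : SmoothU 𝕜 I (fun y => ∏ b ∈ y, if ρ b = a then f b else 1) x := by
        refine SmoothU.finset_prod I (h := fun b => if ρ b = a then f b else 1) fun b hb => ?_
        by_cases hba : b = a
        · subst hba
          refine (isSmoothAlgebra_smoothM I).congr hf ?_
          filter_upwards [hρ b hb] with c hc
          rw [if_pos hc]
        · refine (isSmoothAlgebra_smoothM I).congr ((isSmoothAlgebra_smoothM I).const 1 b) ?_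
          filter_upwards [hρ b hb] with c hc
          rw [if_neg (by rw [hc]; exact hba)]
      refine congr _ _ ?_ (smul _ _ hf' hw)
      filter_upwards [hρ.eventually_bijOn] with y hy
      obtain ⟨c, hca, hc⟩ := exists_chInsert_eq (V := V) hy ha
      rw [hc, hc, map_smul, Finset.prod_eq_single c.1, if_pos hca]
      · intro b hb hbc
        exact if_neg fun hba => hbc (hy.injOn hb c.2 (hba.trans hca.symm))
      · exact fun h => absurd c.2 h
    · rintro _ ⟨l, hl, rfl⟩
      induction l with
      | nil =>
        refine congr _ _ (Filter.Eventually.of_forall fun y => ?_) one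
        simp only [chInsert, List.map_nil, List.prod_nil, ite_self]
        rfl
      | cons v l ih =>
        refine congr _ _ (Filter.Eventually.of_forall fun y => ?_)
          (mul _ _ (gen a ha v (hl v List.mem_cons_self))
            (ih fun v' hv' => hl v' (List.mem_cons_of_mem _ hv')))
        simp only [chInsert, List.map_cons, List.prod_cons]
        rw [tprod_mul]
        refine congrArg (PiTensorProduct.tprod 𝕜) (funext fun c => ?_)
        split_ifs <;> simp
  refine GenSmoothAt.induction congr zero add smul ?_ hs
  rintro _ ⟨w, hw, rfl⟩
  -- A pure tensor section is near `x` the product, over the points `a` of `x`, of the sections with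
  -- its factor inserted only over `a`.
  have hprod : ∀ S ⊆ x, motive fun y => ∏ a ∈ S, chInsert ρ a w y := fun S => by
    induction S using Finset.induction_on with
    | empty => exact fun _ => by simpa using one
    | insert a S ha ih =>
      intro hS
      simp only [Finset.prod_insert ha]
      exact mul _ _ (hins a (hS (Finset.mem_insert_self a S)) w (hw a (hS (Finset.mem_insert_self a S))))
        (ih fun b hb => hS (Finset.mem_insert_of_mem hb))
  refine congr _ _ ?_ (hprod x subset_rfl)
  filter_upwards [hρ.eventually_bijOn] with y hy
  unfold chInsert
  rw [← PiTensorProduct.tprod_prod]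
  refine congrArg (PiTensorProduct.tprod 𝕜) (funext fun c => ?_)
  rw [Finset.prod_apply, Finset.prod_ite_eq, if_pos (Finset.mem_coe.1 (hy.mapsTo c.2))]

/-- Induction on a smooth section of the Cauchy-Hadamard bundle at `x`. -/
theorem SmoothCh.induction {x : Finset M} {ρ : M → M} (hρ : IsLocalRetraction ρ x)
    {motive : (∀ y, ChFib V y) → Prop}
    (congr : ∀ s t, (∀ᶠ y in 𝓝 x, s y = t y) → motive s → motive t)
    (one : motive fun _ => 1)
    (add : ∀ s t, motive s → motive t → motive fun y => s y + t y)
    (smul : ∀ f s, SmoothU 𝕜 I f x → motive s → motive fun y => f y • s y)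
    (mul : ∀ s t, SmoothCh I V s x → SmoothCh I V t x → motive s → motive t →
      motive fun y => s y * t y)
    (gen : ∀ a ∈ x, ∀ v, V.SmoothAt v a → motive (chInsert ρ a fun c => FibSym.ι 𝕜 _ (v c)))
    {s : ∀ y, ChFib V y} (hs : SmoothCh I V s x) : motive s := by
  -- Carrying smoothness along in the motive supplies it for both factors in the product step, where
  -- the Leibniz rule will need it.
  refine (SmoothCh.generation I hρ (motive := fun s => SmoothCh I V s x ∧ motive s)
    ?_ ?_ ?_ ?_ ?_ ?_ hs).2
  · exact fun s t h hs => ⟨hs.1.congr h, congr s t h hs.2⟩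
  · exact ⟨smoothCh_one I, one⟩
  · exact fun s t hs ht => ⟨hs.1.add ht.1, add s t hs.2 ht.2⟩
  · exact fun f s hf hs => ⟨hs.1.smul (isSmoothAlgebra_smoothU I) hf, smul f s hf hs.2⟩
  · exact fun s t hs ht => ⟨smoothCh_mul I hs.1 ht.1, mul s t hs.1 ht.1 hs.2 ht.2⟩
  · exact fun a ha v hv => ⟨smoothCh_chInsert I hρ (smoothSym_ι (isSmoothAlgebra_smoothM I) hv),
      gen a ha v hv⟩

end Germs

lemma IsVectorBundle.smoothAt_zero {𝕜 : Type} [RCLike 𝕜] {X : Type u} [TopologicalSpace X]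
    {sm : (X → 𝕜) → X → Prop} {V : PreBundle.{u, v} 𝕜 X} (hV : IsVectorBundle sm V)
    (H : IsSmoothAlgebra sm) (x : X) : V.SmoothAt (fun _ => 0) x := by
  obtain ⟨_, F, _, _, _, hF⟩ := hV
  obtain ⟨r, e, he⟩ := hF 0 x
  have := (he.self_of_nhds.2.2 fun _ _ => 0).2 fun _ => H.const 0 x
  simpa using this

lemma IsVectorBundle.smoothAt_congr {𝕜 : Type} [RCLike 𝕜] {X : Type u} [TopologicalSpace X]
    {sm : (X → 𝕜) → X → Prop} {V : PreBundle.{u, v} 𝕜 X} (hV : IsVectorBundle sm V)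
    {s t : ∀ x, V.fib x} {x : X} (hs : V.SmoothAt s x) (h : ∀ᶠ y in 𝓝 x, s y = t y) :
    V.SmoothAt t x :=
  hV.1 s t x h hs

lemma confFilter_bijOn {M : Type u} {ρ : M → M} {x y : Finset M} (h : Set.BijOn ρ y x) {Q : M → Prop}
    (hQ : ∀ c ∈ y, (Q c ↔ Q (ρ c))) : Set.BijOn ρ (confFilter Q y) (confFilter Q x) := by
  refine ⟨fun c hc => ?_, h.injOn.mono fun c hc => (confFilter_subset Q y hc), fun c hc => ?_⟩
  · have hc := mem_confFilter.1 hc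
    exact mem_confFilter.2 ⟨h.mapsTo hc.1, (hQ c hc.1).1 hc.2⟩
  · have hc := mem_confFilter.1 hc
    obtain ⟨d, hd, rfl⟩ := h.surjOn hc.1
    exact ⟨d, mem_confFilter.2 ⟨hd, (hQ d hd).2 hc.2⟩, rfl⟩

/-! ### Smoothness of the bracket -/

section BracketSmooth

variable {𝕜 : Type} [RCLike 𝕜]
  {E : Type*} [NormedAddCommGroup E] [NormedSpace ℝ E] {H : Type*} [TopologicalSpace H]
  (I : ModelWithCorners ℝ E H) {M : Type u} [TopologicalSpace M] [ChartedSpace H M]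
  [T2Space M] {V : PreBundle.{u, v} 𝕜 M}

open Classical in
/-- A section of `V`, restricted to the points over `a` and pushed forward to the one-point
configurations. -/
def pushforwardRestrict (ρ : M → M) (a : M) (u : ∀ c, V.fib c) (y : Finset M) :
    (pushforward V).fib y := fun c => if ρ c.1 = a then u c.1 else 0

omit [TopologicalSpace M] [ChartedSpace H M] [T2Space M] in
lemma pushforwardRestrict_singleton_of_eq {ρ : M → M} {a c : M} (h : ρ c = a) (u : ∀ c, V.fib c) :
    pushforwardRestrict ρ a u {c} = pushforwardMk V c (u c) := by
  classical
  funext ⟨b, hb⟩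
  obtain rfl := Finset.singleton_injective hb
  unfold pushforwardRestrict pushforwardMk
  rw [if_pos h, Pi.single_eq_same]

omit [TopologicalSpace M] [ChartedSpace H M] [T2Space M] in
lemma pushforwardRestrict_eq_zero {ρ : M → M} {a : M} {y : Finset M}
    (h : ∀ c, y = {c} → ρ c ≠ a) (u : ∀ c, V.fib c) : pushforwardRestrict ρ a u y = 0 := by
  classical
  funext ⟨b, hb⟩
  exact if_neg (h b hb)

omit [T2Space M] in
lemma pushforwardRestrict_smoothAt (hV : IsVectorBundle (SmoothM 𝕜 I) V) {ρ : M → M} {x : Finset M}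
    (hρ : IsLocalRetraction ρ x) {a : M} {u : ∀ c, V.fib c} (hu : V.SmoothAt u a) {x' : Finset M}
    (hx' : x' ⊆ x) : (pushforward V).SmoothAt (pushforwardRestrict ρ a u) x' := by
  classical
  rintro b rfl
  have hb : b ∈ x := hx' (Finset.mem_singleton_self b)
  by_cases hba : b = a
  · subst hba
    refine hV.smoothAt_congr hu ?_
    filter_upwards [hρ b hb] with c hc
    exact (if_pos hc).symm
  · refine hV.smoothAt_congr (hV.smoothAt_zero (isSmoothAlgebra_smoothM I) b) ?_
    filter_upwards [hρ b hb] with c hc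
    exact (if_neg (by rw [hc]; exact hba)).symm

omit [TopologicalSpace M] [ChartedSpace H M] [T2Space M] in
-- Of all splits of `{a', b'}` only `({a'}, {b'})` contributes: the first factor lives on one-point
-- configurations over `a`, which excludes `{b'}` since `a ≠ b`.
lemma pushforwardRestrict_tmul {ρ : M → M} {a b a' b' : M} (hab : a ≠ b) (ha : ρ a' = a)
    (hb : ρ b' = b) {z : Finset M} (h : IsSplit z {a'} {b'}) (u v : ∀ c, V.fib c) :
    (fun p : Splits z => pushforwardRestrict ρ a u p.1.1 ⊗ₜ[𝕜] pushforwardRestrict ρ b v p.1.2 :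
      CauchyFib (pushforward V) (pushforward V) z)
      = cauchyMk h (pushforwardMk V a' (u a')) (pushforwardMk V b' (v b')) := by
  classical
  rw [cauchyFib_eq_sum, Finset.sum_eq_single ⟨({a'}, {b'}), h⟩]
  · rw [pushforwardRestrict_singleton_of_eq ha, pushforwardRestrict_singleton_of_eq hb]
  · rintro ⟨⟨y, y'⟩, hy⟩ _ hne
    rw [← cauchyIncl_tmul]
    by_cases hya : y = {a'}
    · subst hya
      refine (hne (Subtype.ext (Prod.ext rfl (Finset.ext fun c => ?_)))).elim
      have h1 := h.2 c
      rw [hy.2 c] at h1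
      have h2 : c ∈ y' → c ∉ ({a'} : Finset M) := fun h' => Finset.disjoint_right.1 hy.1 h'
      have h3 : c ∈ ({b'} : Finset M) → c ∉ ({a'} : Finset M) :=
        fun h' => Finset.disjoint_right.1 h.1 h'
      change c ∈ y' ↔ c ∈ ({b'} : Finset M)
      tauto
    · have h0 : pushforwardRestrict ρ a u y = 0 := pushforwardRestrict_eq_zero (fun c hc hca => by
        subst hc
        have h1 := (h.2 c).1 (hy.left_subset (Finset.mem_singleton_self c))
        rw [Finset.mem_singleton, Finset.mem_singleton] at h1
        rcases h1 with rfl | rfl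
        · exact hya rfl
        · exact hab (hca.symm.trans hb)) u
      change cauchyIncl hy (pushforwardRestrict ρ a u y ⊗ₜ _) = 0
      rw [h0, TensorProduct.zero_tmul, map_zero]
  · exact fun h => absurd (Finset.mem_univ _) h

variable (k : ∀ w : Finset M, (cauchy (SmoothU 𝕜 I) (pushforward V) (pushforward V)).fib w →ₗ[𝕜]
      (trivialLine (SmoothU 𝕜 I)).fib w)

/-- The sections `u` and `v`, cut off to the points over `a` and over `b`, give a smooth section of
the Cauchy square, and `k` sends it to a smooth function. Evaluating this on the part of `y` over
`{a, b}` gives a function of all of `y`, even when `x` has further points. -/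
lemma exists_smoothU_eq_kernelForm (hV : IsVectorBundle (SmoothM 𝕜 I) V)
    (hk : IsBundleMap (V := cauchy (SmoothU 𝕜 I) (pushforward V) (pushforward V))
      (W := trivialLine (SmoothU 𝕜 I)) k)
    {ρ : M → M} {x : Finset M} (hρ : IsLocalRetraction ρ x) {a b : M}
    (hab : a ≠ b) {u v : ∀ c, V.fib c} (hu : V.SmoothAt u a) (hv : V.SmoothAt v b) :
    ∃ K : Finset M → 𝕜, SmoothU 𝕜 I K x ∧ ∀ᶠ y in 𝓝 x, ∀ a' ∈ y, ∀ b' ∈ y, ρ a' = a → ρ b' = b →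
      kernelForm V (SmoothU 𝕜 I) k a' b' (u a') (v b') = K y := by
  let s : ∀ z, CauchyFib (pushforward V) (pushforward V) z := fun z p =>
    pushforwardRestrict ρ a u p.1.1 ⊗ₜ[𝕜] pushforwardRestrict ρ b v p.1.2
  have hs : ∀ x' ⊆ x,
      (cauchy (SmoothU 𝕜 I) (pushforward V) (pushforward V)).SmoothAt s x' := fun x' hx' => by
    refine GenSmoothAt.of_gen (G := fun s x => ∃ φ ψ : ∀ y, (pushforward V).fib y,
      (∀ x' ⊆ x, (pushforward V).SmoothAt φ x' ∧ (pushforward V).SmoothAt ψ x') ∧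
        s = fun (y : Finset M) (p : Splits y) => φ p.1.1 ⊗ₜ[𝕜] ψ p.1.2)
      (isSmoothAlgebra_smoothU (𝕜 := 𝕜) (M := M) I) ⟨pushforwardRestrict ρ a u,
        pushforwardRestrict ρ b v, fun x'' hx'' => ⟨?_, ?_⟩, rfl⟩
    · exact pushforwardRestrict_smoothAt I hV hρ hu (hx''.trans hx')
    · exact pushforwardRestrict_smoothAt I hV hρ hv (hx''.trans hx')
  have hK : ∀ x' ⊆ x, SmoothU 𝕜 I (fun z => k z (s z)) x' := fun x' hx' => hk s x' (hs x' hx')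
  have hQ : ∀ c ∈ x, ∀ᶠ d in 𝓝 c, ((ρ d = a ∨ ρ d = b) ↔ (ρ c = a ∨ ρ c = b)) := fun c hc => by
    filter_upwards [hρ c hc] with d hd
    rw [hd, hρ.apply hc]
  -- `K y` is the smooth function `z ↦ k z (s z)` at the subconfiguration of the points of `y` over
  -- `a` or `b`, which has two elements for `y` near `x`.
  refine ⟨_, SmoothU.comp_filter I hQ
    (hK _ (confFilter_subset (fun d => ρ d = a ∨ ρ d = b) x)), ?_⟩
  filter_upwards [hρ.eventually_bijOn] with y hy a' ha' b' hb' haa hbb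
  have hsplit : IsSplit (confFilter (fun d => ρ d = a ∨ ρ d = b) y) {a'} {b'} := by
    refine ⟨Finset.disjoint_singleton.2 fun h => hab ?_, fun c => ?_⟩
    · rw [← haa, ← hbb, h]
    · rw [mem_confFilter, Finset.mem_singleton, Finset.mem_singleton]
      constructor
      · rintro ⟨hc, h | h⟩
        · exact Or.inl (hy.injOn hc ha' (h.trans haa.symm))
        · exact Or.inr (hy.injOn hc hb' (h.trans hbb.symm))
      · rintro (rfl | rfl)
        · exact ⟨ha', Or.inl haa⟩
        · exact ⟨hb', Or.inr hbb⟩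
  rw [kernelForm_eq V (SmoothU 𝕜 I) k hsplit]
  exact congrArg _ (pushforwardRestrict_tmul hab haa hbb hsplit u v).symm

/-- After passage to components, the sections for which the bracket is smooth are closed under
products by the Leibniz rule, in each argument separately. Two successive inductions leave only
sections of `V` near two points, where the bracket is a value of the kernel times the unit. -/
theorem isBundleMap_kernelBracket (hV : IsVectorBundle (SmoothM 𝕜 I) V)
    (hk : IsBundleMap (V := cauchy (SmoothU 𝕜 I) (pushforward V) (pushforward V))
      (W := trivialLine (SmoothU 𝕜 I)) k) :
    IsBundleMap (V := cauchy (SmoothU 𝕜 I) (chBundle I V) (chBundle I V)) (W := chBundle I V)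
      (kernelBracket V (SmoothM 𝕜 I) (SmoothU 𝕜 I) k) := by
  refine isBundleMap_of_components I _ fun x Q hQ φ ψ hφ hψ => ?_
  have hQ' : ∀ a ∈ x, ∀ᶠ b in 𝓝 a, (¬Q b ↔ ¬Q a) := fun a ha =>
    (hQ a ha).mono fun b hb => not_congr hb
  obtain ⟨ρ, hρ⟩ := exists_isLocalRetraction x
  have Hs := isSmoothAlgebra_smoothU (𝕜 := 𝕜) (M := M) I
  let br : ∀ y, ChFib V (confFilter Q y) → ChFib V (confFilter (fun a => ¬Q a) y) → ChFib V y :=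
    fun y a b => ofTotal V y (totalBracket V (SmoothU 𝕜 I) k (toTotal V _ a) (toTotal V _ b))
  suffices SmoothCh I V (fun y => br y (φ _) (ψ _)) x from
    this.congr (Filter.Eventually.of_forall fun y => (kernelBracket_mk V _ _ k _ _ _).symm)
  refine SmoothCh.induction I (hρ.mono (confFilter_subset Q x))
    (motive := fun φ => SmoothCh I V (fun y => br y (φ _) (ψ _)) x)
    (fun s t h hs => hs.congr ?_) ?_ ?_ ?_ ?_ ?_ hφ
  · filter_upwards [(tendsto_filter_nhds hQ).eventually h] with y hy using by rw [hy]
  · simpa [br] using GenSmoothAt.zero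
  · intro s t hs ht
    simpa only [br, map_add, Derivation.add_apply] using hs.add ht
  · intro f s hf hs
    refine (hs.smul Hs (hf.comp_filter I hQ)).congr (Filter.Eventually.of_forall fun y => ?_)
    simp only [br]
    rw [map_smul (toTotal V _), Derivation.map_smul, Derivation.smul_apply, map_smul]
  · intro s t hs ht hs' ht'
    refine ((smoothCh_mul I (smoothCh_chExtend I hQ hs) ht').add
      (smoothCh_mul I (smoothCh_chExtend I hQ ht) hs')).congr (Filter.Eventually.of_forall fun y => ?_)
    simp only [br]
    rw [map_mul (toTotal V _), polyBracket_mul_left, map_add, map_mul, map_mul]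
    rfl
  intro a ha u hu
  refine SmoothCh.induction I (hρ.mono (confFilter_subset (fun a => ¬Q a) x))
    (motive := fun ψ => SmoothCh I V (fun y => br y (chInsert ρ a _ _) (ψ _)) x)
    (fun s t h hs => hs.congr ?_) ?_ ?_ ?_ ?_ ?_ hψ
  · filter_upwards [(tendsto_filter_nhds hQ').eventually h] with y hy using by rw [hy]
  · simpa [br] using GenSmoothAt.zero
  · intro s t hs ht
    simpa only [br, map_add] using hs.add ht
  · intro f s hf hs
    refine (hs.smul Hs (hf.comp_filter I hQ')).congr (Filter.Eventually.of_forall fun y => ?_)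
    simp only [br]
    rw [map_smul (toTotal V _), Derivation.map_smul, map_smul]
  · intro s t hs ht hs' ht'
    refine ((smoothCh_mul I (smoothCh_chExtend I hQ' hs) ht').add
      (smoothCh_mul I (smoothCh_chExtend I hQ' ht) hs')).congr
        (Filter.Eventually.of_forall fun y => ?_)
    simp only [br]
    rw [map_mul (toTotal V _), polyBracket_mul_right, map_add, map_mul, map_mul]
    rfl
  intro b hb v hv
  rw [mem_confFilter] at ha hb
  -- The two arguments live over complementary parts of `x`, so the diagonal, where the kernel is
  -- cut off to zero, is never reached.
  have hab : a ≠ b := fun h => hb.2 (h ▸ ha.2)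
  obtain ⟨K, hK, hKe⟩ := exists_smoothU_eq_kernelForm I k hV hk hρ hab hu hv
  refine (GenSmoothAt.smul Hs hK (smoothCh_one I)).congr ?_
  have hQρ : ∀ᶠ y in 𝓝 x, ∀ c ∈ y, (Q c ↔ Q (ρ c)) := eventually_forall_mem fun c hc => by
    filter_upwards [hρ c hc, hQ c hc] with d hd hd'
    rw [hd, hd']
  filter_upwards [hKe, hQρ, hρ.eventually_bijOn] with y h1 h2 h3
  obtain ⟨a', haa, ha'⟩ := exists_chInsert_eq (V := V) (confFilter_bijOn h3 h2) (mem_confFilter.2 ha)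
  obtain ⟨b', hbb, hb'⟩ := exists_chInsert_eq (V := V)
    (confFilter_bijOn h3 (Q := fun a => ¬Q a) fun c hc => not_congr (h2 c hc)) (mem_confFilter.2 hb)
  simp only [br]
  rw [ha', hb', toTotal_chSingle, toTotal_chSingle, FibSym.lift_ι, FibSym.lift_ι,
    totalBracket_totalGen, AlgHom.commutes, Algebra.algebraMap_eq_smul_one,
    h1 a'.1 (confFilter_subset _ _ a'.2) b'.1 (confFilter_subset _ _ b'.2) haa hbb]

end BracketSmooth

/-! ## Dual functionals of local frames -/

section Dual

variable {𝕜 : Type} [RCLike 𝕜]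

/-- Independence is a premise inside the existential, with the zero map as default, so that
functionals can be chosen at all points although a local frame is independent only near one. -/
lemma exists_dual_of_linearIndependent {V : Type*} [AddCommGroup V] [Module 𝕜 V] {r : ℕ}
    (e : Fin r → V) : ∃ κ : V →ₗ[𝕜] (Fin r → 𝕜), LinearIndependent 𝕜 e →
      ∀ i, κ (e i) = Pi.single i 1 := by
  by_cases h : LinearIndependent 𝕜 e
  · obtain ⟨g, hg⟩ := LinearMap.exists_leftInverse_of_injective (Fintype.linearCombination 𝕜 e)
      (LinearMap.ker_eq_bot.2 (linearIndependent_iff_injective_fintypeLinearCombination.1 h))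
    refine ⟨g, fun _ i => ?_⟩
    have := LinearMap.congr_fun hg (Pi.single i 1)
    simpa using this
  · exact ⟨0, fun h' => absurd h' h⟩

lemma sum_dual_smul_eq {V : Type*} [AddCommGroup V] [Module 𝕜 V] {r : ℕ} {e : Fin r → V}
    {κ : V →ₗ[𝕜] (Fin r → 𝕜)} (hκ : ∀ i, κ (e i) = Pi.single i 1) {v : V}
    (hv : v ∈ Submodule.span 𝕜 (Set.range e)) : ∑ i, κ v i • e i = v := by
  induction hv using Submodule.span_induction with
  | mem x hx =>
    obtain ⟨i, rfl⟩ := hx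
    simp [hκ, Pi.single_apply]
  | zero => simp
  | add x y _ _ hx hy => simp [add_smul, Finset.sum_add_distrib, hx, hy]
  | smul a x _ hx => simp only [map_smul, Pi.smul_apply, smul_assoc, ← Finset.smul_sum, hx]

variable {X : Type u} [TopologicalSpace X] {sm : (X → 𝕜) → X → Prop} (Hsm : IsSmoothAlgebra sm)
  {V : PreBundle.{u, v} 𝕜 X}

include Hsm

lemma IsSmoothAlgebra.det {r : ℕ} {x : X} {B : X → Matrix (Fin r) (Fin r) 𝕜}
    (hB : ∀ i j, sm (fun y => B y i j) x) : sm (fun y => (B y).det) x := by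
  simp only [Matrix.det_apply']
  exact Hsm.sum _ fun σ _ => Hsm.mul (Hsm.const _ x) (Hsm.prod _ fun i _ => hB _ _)

lemma IsSmoothAlgebra.matrix_inv (hinv : ∀ {f : X → 𝕜} {x : X}, sm f x → f x ≠ 0 →
      sm (fun y => (f y)⁻¹) x) {r : ℕ} {x : X} {B : X → Matrix (Fin r) (Fin r) 𝕜}
    (hB : ∀ i j, sm (fun y => B y i j) x) (hdet : (B x).det ≠ 0) (i j : Fin r) :
    sm (fun y => (B y)⁻¹ i j) x := by
  simp only [Matrix.inv_def, Matrix.smul_apply, Ring.inverse_eq_inv', smul_eq_mul,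
    Matrix.adjugate_apply]
  refine Hsm.mul (hinv (Hsm.det hB) hdet) (Hsm.det fun i' j' => ?_)
  -- An entry of the adjugate is the determinant of `B y` with row `j` replaced by a constant
  -- vector.
  by_cases h : i' = j
  · simpa [Matrix.updateRow_apply, h] using Hsm.const _ x
  · simpa [Matrix.updateRow_apply, h] using hB i' j'

/-- `e` is a local frame near `x` of the family of subspaces `F`, in which smoothness of sections
is smoothness of the coordinates. -/
def IsSmoothFrame (sm : (X → 𝕜) → X → Prop) (V : PreBundle.{u, v} 𝕜 X)
    (F : ∀ x, Submodule 𝕜 (V.fib x)) {r : ℕ} (e : Fin r → ∀ x, V.fib x) (y : X) : Prop :=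
  LinearIndependent 𝕜 (fun i => e i y) ∧
    Submodule.span 𝕜 (Set.range fun i => e i y) = F y ∧
    ∀ f : Fin r → X → 𝕜, V.SmoothAt (fun z => ∑ i, f i z • e i z) y ↔ ∀ i, sm (f i) y

omit [TopologicalSpace X] Hsm in
lemma IsSmoothFrame.smoothAt [TopologicalSpace X] (Hsm : IsSmoothAlgebra sm)
    {F : ∀ x, Submodule 𝕜 (V.fib x)} {r : ℕ}
    {e : Fin r → ∀ x, V.fib x} {y : X} (h : IsSmoothFrame sm V F e y) (i : Fin r) :
    V.SmoothAt (e i) y := by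
  have := (h.2.2 fun j _ => Pi.single (M := fun _ => 𝕜) i 1 j).2 fun j => Hsm.const _ y
  simpa [Pi.single_apply] using this

/-- Coordinates with respect to a frame of a subbundle extend to functionals which are smooth
on a larger subbundle. -/
lemma exists_smooth_dual (hinv : ∀ {f : X → 𝕜} {x : X}, sm f x → f x ≠ 0 → sm (fun y => (f y)⁻¹) x)
    (hcont : ∀ {f : X → 𝕜} {x : X}, sm f x → ContinuousAt f x)
    (hV : ∀ (s t : ∀ x, V.fib x) (x : X), (∀ᶠ y in 𝓝 x, s y = t y) → V.SmoothAt s x →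
      V.SmoothAt t x)
    {F F' : ∀ x, Submodule 𝕜 (V.fib x)} (hF : ∀ x, F x ≤ F' x) {x : X} {r r' : ℕ}
    {e : Fin r → ∀ x, V.fib x} {e' : Fin r' → ∀ x, V.fib x}
    (he : ∀ᶠ y in 𝓝 x, IsSmoothFrame sm V F e y) (he' : ∀ᶠ y in 𝓝 x, IsSmoothFrame sm V F' e' y) :
    ∃ l : ∀ y, V.fib y →ₗ[𝕜] (Fin r → 𝕜), (∀ᶠ y in 𝓝 x, ∀ i, l y (e i y) = Pi.single i 1) ∧
      ∀ s, V.SmoothAt s x → (∀ᶠ y in 𝓝 x, s y ∈ F' y) → ∀ i, sm (fun y => l y (s y) i) x := by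
  choose κ hκ using fun y => exists_dual_of_linearIndependent (𝕜 := 𝕜) fun i => e' i y
  obtain ⟨μ, hμ⟩ := exists_dual_of_linearIndependent (𝕜 := 𝕜) fun i => e i x
  have hcoord : ∀ s, V.SmoothAt s x → (∀ᶠ y in 𝓝 x, s y ∈ F' y) →
      ∀ j, sm (fun y => κ y (s y) j) x := fun s hs hsF => by
    refine (he'.self_of_nhds.2.2 _).1 (hV _ _ x ?_ hs)
    filter_upwards [hsF, he'] with y h1 h2
    exact (sum_dual_smul_eq (hκ y h2.1) (h2.2.1.symm ▸ h1)).symm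
  have heF : ∀ᶠ y in 𝓝 x, ∀ i, e i y ∈ F' y := by
    filter_upwards [he] with y h i
    exact hF y (h.2.1 ▸ Submodule.subset_span ⟨i, rfl⟩)
  -- Row `i` holds the coordinates of `e i` in the frame `e'` of the larger subbundle.
  let A : X → Matrix (Fin r) (Fin r') 𝕜 := fun y => Matrix.of fun i => κ y (e i y)
  have hA : ∀ i j, sm (fun y => A y i j) x := fun i =>
    hcoord (e i) (he.self_of_nhds.smoothAt Hsm i) (heF.mono fun y h => h i)
  -- A right inverse of `A x`, built from functionals dual to `e` at `x` and kept constant. Then `A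
  -- y * L` is invertible near `x`, which avoids any smooth choice of complement.
  let L : Matrix (Fin r') (Fin r) 𝕜 := Matrix.of fun j => μ (e' j x)
  let B : X → Matrix (Fin r) (Fin r) 𝕜 := fun y => A y * L
  have hB : ∀ i j, sm (fun y => B y i j) x := fun i j => by
    simp only [B, Matrix.mul_apply]
    exact Hsm.sum _ fun l _ => Hsm.mul (hA i l) (Hsm.const _ x)
  have hBx : B x = 1 := by
    ext i j
    have h1 := sum_dual_smul_eq (hκ x he'.self_of_nhds.1)
      (he'.self_of_nhds.2.1.symm ▸ heF.self_of_nhds i)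
    have h2 := congrFun (congrArg μ h1) j
    rw [map_sum, hμ he.self_of_nhds.1, Finset.sum_apply] at h2
    simp only [B, A, L, Matrix.mul_apply, Matrix.of_apply]
    simpa [Matrix.one_apply, Pi.single_apply, eq_comm] using h2
  have hdet : (B x).det ≠ 0 := by simp [hBx]
  have hBd : ∀ᶠ y in 𝓝 x, (B y).det ≠ 0 := (hcont (Hsm.det hB)).eventually_ne hdet
  -- The factor $(AL)^{-1}$ corrects the constant matrix: $A\,L\,(AL)^{-1}=1$ says that the
  -- functional is dual to `e` at every `y` near `x`.
  refine ⟨fun y => (Matrix.vecMulLinear (L * (B y)⁻¹)).comp (κ y), ?_, fun s hs hsF i => ?_⟩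
  · filter_upwards [hBd] with y hy i
    have h1 : (A y * (L * (B y)⁻¹)) = 1 := by
      rw [← Matrix.mul_assoc]
      exact Matrix.mul_nonsing_inv _ (Ne.isUnit hy)
    funext j
    have h2 := congrFun (congrFun h1 i) j
    rw [Matrix.one_apply] at h2
    rw [Pi.single_apply, LinearMap.comp_apply, Matrix.vecMulLinear_apply]
    simp only [eq_comm (a := j)]
    exact h2
  · simp only [LinearMap.comp_apply, Matrix.vecMulLinear_apply, Matrix.vecMul, dotProduct,
      Matrix.mul_apply]
    exact Hsm.sum _ fun j _ => Hsm.mul (hcoord s hs hsF j) (Hsm.sum _ fun l _ =>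
      Hsm.mul (Hsm.const _ x) (Hsm.matrix_inv hinv hB hdet l i))

end Dual

/-! ## Monomials in symmetric algebras -/

section Monomials

variable {𝕜 : Type} [RCLike 𝕜] {V : Type v} [AddCommGroup V] [Module 𝕜 V] {r : ℕ}

/-- The exponents of the monomials of degree at most `n` in `r` variables. -/
abbrev Exponents (r n : ℕ) : Type := {m : Fin r → ℕ // ∑ i, m i ≤ n}

instance Exponents.finite (r n : ℕ) : Finite (Exponents r n) := by
  refine Finite.of_injective (fun (m : Exponents r n) (i : Fin r) =>
    (⟨m.1 i, Nat.lt_succ_of_le ((Finset.single_le_sum (fun _ _ => Nat.zero_le _)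
      (Finset.mem_univ i)).trans m.2)⟩ : Fin (n + 1))) fun m m' h => Subtype.ext (funext fun i => ?_)
  exact congrArg Fin.val (congrFun h i)

instance Exponents.fintype (r n : ℕ) : Fintype (Exponents r n) := Fintype.ofFinite _

variable (𝕜) in
/-- A monomial in the vectors `e i`. -/
def symMonomial (e : Fin r → V) (m : Fin r → ℕ) : FibSym 𝕜 V := ∏ i, FibSym.ι 𝕜 V (e i) ^ m i

/-- The map to a polynomial ring given by linear functionals. -/
def symToPoly (l : V →ₗ[𝕜] (Fin r → 𝕜)) : FibSym 𝕜 V →ₐ[𝕜] MvPolynomial (Fin r) 𝕜 :=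
  FibSym.lift ((Fintype.linearCombination 𝕜 (MvPolynomial.X (R := 𝕜) (σ := Fin r))).comp l)

lemma symToPoly_ι (l : V →ₗ[𝕜] (Fin r → 𝕜)) (u : V) :
    symToPoly l (FibSym.ι 𝕜 V u) = ∑ i, l u i • MvPolynomial.X i := by
  rw [symToPoly, FibSym.lift_ι, LinearMap.comp_apply, Fintype.linearCombination_apply]

/-- A coefficient of `symToPoly`. -/
def symCoeff (l : V →ₗ[𝕜] (Fin r → 𝕜)) (m : Fin r → ℕ) : FibSym 𝕜 V →ₗ[𝕜] 𝕜 :=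
  MvPolynomial.lcoeff 𝕜 (Finsupp.equivFunOnFinite.symm m) ∘ₗ (symToPoly l).toLinearMap

lemma symCoeff_apply (l : V →ₗ[𝕜] (Fin r → 𝕜)) (m : Fin r → ℕ) (z : FibSym 𝕜 V) :
    symCoeff l m z = (symToPoly l z).coeff (Finsupp.equivFunOnFinite.symm m) := rfl

/-- Functionals dual to `e` send each `e i` to the variable of index `i`, hence monomials in `e` to
monomials in the polynomial ring. -/
lemma symCoeff_symMonomial {l : V →ₗ[𝕜] (Fin r → 𝕜)} {e : Fin r → V}
    (h : ∀ i, l (e i) = Pi.single i 1) (m m' : Fin r → ℕ) :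
    symCoeff l m (symMonomial 𝕜 e m') = if m = m' then 1 else 0 := by
  classical
  have h1 : symToPoly l (symMonomial 𝕜 e m')
      = MvPolynomial.monomial (Finsupp.equivFunOnFinite.symm m') 1 := by
    rw [MvPolynomial.monomial_eq, Finsupp.prod_fintype _ _ (by simp), symMonomial, map_prod]
    simp [symToPoly_ι, h, Pi.single_apply]
  rw [symCoeff_apply, h1, MvPolynomial.coeff_monomial]
  simp [eq_comm]

variable (𝕜) in
/-- The elements of the symmetric algebra of degree at most `n` in the vectors in `F`. -/
def symFiltration (F : Submodule 𝕜 V) (n : ℕ) : Submodule 𝕜 (FibSym 𝕜 V) :=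
  (1 ⊔ F.map (FibSym.ι 𝕜 V)) ^ n

lemma symFiltration_mono {F F' : Submodule 𝕜 V} (hF : F ≤ F') {n n' : ℕ} (hn : n ≤ n') :
    symFiltration 𝕜 F n ≤ symFiltration 𝕜 F' n' :=
  (pow_le_pow_left' (sup_le_sup_left (Submodule.map_mono hF) 1) n).trans
    (pow_le_pow_right' le_sup_left hn)

lemma mul_mem_symFiltration {F : Submodule 𝕜 V} {n n' : ℕ} {a b : FibSym 𝕜 V}
    (ha : a ∈ symFiltration 𝕜 F n) (hb : b ∈ symFiltration 𝕜 F n') :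
    a * b ∈ symFiltration 𝕜 F (n + n') := by
  unfold symFiltration
  rw [pow_add]
  exact Submodule.mul_mem_mul ha hb

lemma one_mem_symFiltration (F : Submodule 𝕜 V) (n : ℕ) :
    (1 : FibSym 𝕜 V) ∈ symFiltration 𝕜 F n := by
  refine symFiltration_mono le_rfl (Nat.zero_le n) ?_
  rw [symFiltration, pow_zero]
  exact Submodule.one_le.1 le_rfl

lemma ι_mem_symFiltration {F : Submodule 𝕜 V} {u : V} (hu : u ∈ F) :
    FibSym.ι 𝕜 V u ∈ symFiltration 𝕜 F 1 := by
  rw [symFiltration, pow_one]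
  exact Submodule.mem_sup_right ⟨u, hu, rfl⟩

lemma symMonomial_mem_symFiltration {F : Submodule 𝕜 V} {e : Fin r → V} (he : ∀ i, e i ∈ F)
    (m : Fin r → ℕ) : symMonomial 𝕜 e m ∈ symFiltration 𝕜 F (∑ i, m i) := by
  classical
  unfold symMonomial
  have : ∀ S : Finset (Fin r), ∏ i ∈ S, FibSym.ι 𝕜 V (e i) ^ m i
      ∈ symFiltration 𝕜 F (∑ i ∈ S, m i) := fun S => by
    induction S using Finset.induction_on with
    | empty => simpa using one_mem_symFiltration F 0
    | insert a S ha ih =>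
      rw [Finset.prod_insert ha, Finset.sum_insert ha]
      refine mul_mem_symFiltration ?_ ih
      generalize m a = n
      induction n with
      | zero => simpa using one_mem_symFiltration F 0
      | succ n ih =>
        rw [pow_succ]
        exact mul_mem_symFiltration ih (ι_mem_symFiltration (he a))
  exact this Finset.univ

/-- One more factor from $1\oplus F$ either leaves a monomial unchanged or raises one exponent by
one; conversely a monomial of degree at most `n` lies in a smaller power. -/
lemma symFiltration_eq_span (e : Fin r → V) (n : ℕ) :
    symFiltration 𝕜 (Submodule.span 𝕜 (Set.range e)) n
      = Submodule.span 𝕜 (Set.range fun m : Exponents r n => symMonomial 𝕜 e m.1) := by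
  classical
  refine le_antisymm ?_ (Submodule.span_le.2 ?_)
  · induction n with
    | zero =>
      rw [symFiltration, pow_zero, Submodule.one_eq_span]
      refine Submodule.span_mono ?_
      rintro _ rfl
      exact ⟨⟨0, by simp⟩, by simp [symMonomial]⟩
    | succ n ih =>
      have h1 : (1 : Submodule 𝕜 (FibSym 𝕜 V)) ⊔ (Submodule.span 𝕜 (Set.range e)).map (FibSym.ι 𝕜 V)
          = Submodule.span 𝕜 ({1} ∪ Set.range fun i => FibSym.ι 𝕜 V (e i)) := by
        rw [Submodule.span_union, Submodule.one_eq_span, Submodule.map_span, ← Set.range_comp]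
        rfl
      rw [symFiltration, pow_succ]
      refine (mul_le_mul' ih h1.le).trans ?_
      rw [Submodule.span_mul_span]
      refine Submodule.span_mono ?_
      rintro _ ⟨_, ⟨m, rfl⟩, _, rfl | ⟨i, rfl⟩, rfl⟩
      · exact ⟨⟨m.1, m.2.trans (Nat.le_succ n)⟩, (mul_one _).symm⟩
      · refine ⟨⟨m.1 + Pi.single i 1, ?_⟩, ?_⟩
        · simp only [Pi.add_apply, Finset.sum_add_distrib, Finset.sum_pi_single', Finset.mem_univ,
            if_true]
          exact Nat.succ_le_succ m.2
        · simp only [symMonomial, Pi.add_apply, pow_add, Finset.prod_mul_distrib]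
          congr 1
          rw [Finset.prod_eq_single i]
          · simp
          · intro j _ hj
            simp [Pi.single_eq_of_ne hj]
          · simp
  · rintro _ ⟨m, rfl⟩
    exact symFiltration_mono le_rfl m.2
      (symMonomial_mem_symFiltration (fun i => Submodule.subset_span (Set.mem_range_self i)) m.1)

lemma exists_mem_symFiltration {F : ℕ → Submodule 𝕜 V} (hF : Monotone F)
    (hF' : ∀ v, ∃ n, v ∈ F n) (z : FibSym 𝕜 V) : ∃ n, z ∈ symFiltration 𝕜 (F n) n := by
  induction z using FibSym.induction with
  | scalar c =>
    refine ⟨0, ?_⟩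
    rw [Algebra.algebraMap_eq_smul_one]
    exact Submodule.smul_mem _ _ (one_mem_symFiltration _ _)
  | ι u =>
    obtain ⟨n, hn⟩ := hF' u
    -- The index bounds the degree as well as the subspace, so it must be at least one even if `u`
    -- already lies in `F 0`.
    exact ⟨n + 1, symFiltration_mono (hF n.le_succ) (Nat.le_add_left 1 n) (ι_mem_symFiltration hn)⟩
  | mul a b ha hb =>
    obtain ⟨n, hn⟩ := ha
    obtain ⟨n', hn'⟩ := hb
    exact ⟨n + n', mul_mem_symFiltration (symFiltration_mono (hF (Nat.le_add_right n n')) le_rfl hn)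
      (symFiltration_mono (hF (Nat.le_add_left n' n)) le_rfl hn')⟩
  | add a b ha hb =>
    obtain ⟨n, hn⟩ := ha
    obtain ⟨n', hn'⟩ := hb
    exact ⟨max n n', add_mem (symFiltration_mono (hF (le_max_left n n')) (le_max_left n n') hn)
      (symFiltration_mono (hF (le_max_right n n')) (le_max_right n n') hn')⟩

end Monomials

/-! ## The filtration of the Cauchy-Hadamard bundle -/

section SymSections

variable {𝕜 : Type} [RCLike 𝕜] {X : Type u} [TopologicalSpace X] {sm : (X → 𝕜) → X → Prop}
  (Hsm : IsSmoothAlgebra sm) {V : PreBundle.{u, v} 𝕜 X} {F : ℕ → ∀ x, Submodule 𝕜 (V.fib x)}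
  (hmono : ∀ x, Monotone fun n => F n x)
  (hloc : ∀ (s : ∀ x, V.fib x) (x : X), V.SmoothAt s x → ∃ n, ∀ᶠ y in 𝓝 x, s y ∈ F n y)
  {x : X}

/-- The coordinates given by `l` are smooth on the smooth sections of `F`. -/
def IsSmoothOn (sm : (X → 𝕜) → X → Prop) (V : PreBundle.{u, v} 𝕜 X)
    (F : ∀ x, Submodule 𝕜 (V.fib x)) {r : ℕ} (l : ∀ y, V.fib y →ₗ[𝕜] (Fin r → 𝕜)) (x : X) : Prop :=
  ∀ s, V.SmoothAt s x → (∀ᶠ y in 𝓝 x, s y ∈ F y) → ∀ i, sm (fun y => l y (s y) i) x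

include hmono hloc in
lemma SmoothSym.exists_mem_symFiltration {w : ∀ x, FibSym 𝕜 (V.fib x)} (hw : SmoothSym sm V w x) :
    ∃ N, ∀ᶠ y in 𝓝 x, w y ∈ symFiltration 𝕜 (F N y) N := by
  refine GenSmoothAt.induction
    (motive := fun w => ∃ N, ∀ᶠ y in 𝓝 x, w y ∈ symFiltration 𝕜 (F N y) N)
    ?_ ?_ ?_ ?_ ?_ hw
  · rintro s t h ⟨N, hN⟩
    exact ⟨N, by filter_upwards [h, hN] with y h1 h2 using h1 ▸ h2⟩
  · exact ⟨0, Filter.Eventually.of_forall fun y => zero_mem _⟩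
  · rintro s t ⟨N, hN⟩ ⟨N', hN'⟩
    refine ⟨max N N', ?_⟩
    filter_upwards [hN, hN'] with y h1 h2
    exact add_mem (symFiltration_mono (hmono y (le_max_left N N')) (le_max_left N N') h1)
      (symFiltration_mono (hmono y (le_max_right N N')) (le_max_right N N') h2)
  · rintro f s _ ⟨N, hN⟩
    exact ⟨N, hN.mono fun y h => Submodule.smul_mem _ _ h⟩
  · rintro _ ⟨l, hl, rfl⟩
    induction l with
    | nil => exact ⟨0, Filter.Eventually.of_forall fun y => by simpa using one_mem_symFiltration _ _⟩
    | cons v l ih =>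
      obtain ⟨N, hN⟩ := ih fun v hv => hl v (List.mem_cons_of_mem _ hv)
      obtain ⟨N', hN'⟩ := hloc v x (hl v List.mem_cons_self)
      -- The degree grows by one for `v`; adding all of `N' + 1` also makes the index large enough
      -- for `F N'` and `F N`.
      refine ⟨(N' + 1) + N, ?_⟩
      filter_upwards [hN, hN'] with y h1 h2
      rw [List.map_cons, List.prod_cons]
      exact mul_mem_symFiltration
        (symFiltration_mono (hmono y (by omega)) (Nat.le_add_left 1 N') (ι_mem_symFiltration h2))
        (symFiltration_mono (hmono y (by omega)) le_rfl h1)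

include Hsm hmono hloc in
-- A presentation of `w` near `x` involves finitely many sections of `V`, all inside one `F N₀`. The
-- bound depends on `w` only and precedes `r` and `l`, so functionals may be constructed afterwards,
-- adapted to the bound.
lemma SmoothSym.exists_smooth_symCoeff {w : ∀ x, FibSym 𝕜 (V.fib x)} (hw : SmoothSym sm V w x) :
    ∃ N₀, ∀ N ≥ N₀, ∀ (r : ℕ) (l : ∀ y, V.fib y →ₗ[𝕜] (Fin r → 𝕜)), IsSmoothOn sm V (F N) l x →
      ∀ m, sm (fun y => symCoeff (l y) m (w y)) x := by
  refine GenSmoothAt.induction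
    (motive := fun w => ∃ N₀, ∀ N ≥ N₀, ∀ (r : ℕ) (l : ∀ y, V.fib y →ₗ[𝕜] (Fin r → 𝕜)),
      IsSmoothOn sm V (F N) l x → ∀ m, sm (fun y => symCoeff (l y) m (w y)) x)
    ?_ ?_ ?_ ?_ ?_ hw
  · rintro s t h ⟨N, hN⟩
    refine ⟨N, fun N' hN' r l hl m => Hsm.congr (hN N' hN' r l hl m) ?_⟩
    filter_upwards [h] with y hy using by rw [hy]
  · exact ⟨0, fun N _ r l _ m => by simpa using Hsm.const 0 x⟩
  · rintro s t ⟨N, hN⟩ ⟨N', hN'⟩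
    refine ⟨max N N', fun n hn r l hl m => ?_⟩
    simp only [map_add]
    exact Hsm.add (hN n ((le_max_left N N').trans hn) r l hl m)
      (hN' n ((le_max_right N N').trans hn) r l hl m)
  · rintro f s hf ⟨N, hN⟩
    refine ⟨N, fun n hn r l hl m => ?_⟩
    simp only [map_smul, smul_eq_mul]
    exact Hsm.mul hf (hN n hn r l hl m)
  · rintro _ ⟨L, hL, rfl⟩
    -- All coefficients are treated together, since a coefficient of a product is a sum over
    -- products of coefficients of the factors.
    suffices h : ∃ N₀, ∀ N ≥ N₀, ∀ (r : ℕ) (l : ∀ y, V.fib y →ₗ[𝕜] (Fin r → 𝕜)),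
        IsSmoothOn sm V (F N) l x → ∀ d : Fin r →₀ ℕ, sm (fun y =>
          (symToPoly (l y) (L.map fun v => FibSym.ι 𝕜 _ (v y)).prod).coeff d) x by
      obtain ⟨N, hN⟩ := h
      exact ⟨N, fun n hn r l hl m => hN n hn r l hl _⟩
    induction L with
    | nil =>
      refine ⟨0, fun N _ r l _ d => ?_⟩
      simpa using Hsm.const (MvPolynomial.coeff d 1) x
    | cons v L ih =>
      obtain ⟨N, hN⟩ := ih fun v hv => hL v (List.mem_cons_of_mem _ hv)
      obtain ⟨N', hN'⟩ := hloc v x (hL v List.mem_cons_self)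
      refine ⟨max N N', fun n hn r l hl d => ?_⟩
      simp only [List.map_cons, List.prod_cons, map_mul, MvPolynomial.coeff_mul, symToPoly_ι,
        MvPolynomial.coeff_sum, MvPolynomial.coeff_smul, smul_eq_mul]
      refine Hsm.sum _ fun p _ => Hsm.mul (Hsm.sum _ fun i _ => Hsm.mul ?_ (Hsm.const _ x))
        (hN n ((le_max_left N N').trans hn) r l hl p.2)
      exact hl v (hL v List.mem_cons_self)
        (hN'.mono fun y h => hmono y ((le_max_right N N').trans hn) h) i

include Hsm in
lemma smoothSym_symMonomial {r : ℕ} {e : Fin r → ∀ x, V.fib x} (he : ∀ i, V.SmoothAt (e i) x)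
    (m : Fin r → ℕ) : SmoothSym sm V (fun y => symMonomial 𝕜 (fun i => e i y) m) x := by
  classical
  have h : ∀ S : Finset (Fin r),
      SmoothSym sm V (fun y => ∏ i ∈ S, FibSym.ι 𝕜 (V.fib y) (e i y) ^ m i) x := fun S => by
    induction S using Finset.induction_on with
    | empty => simpa using smoothSym_one Hsm
    | insert a S ha ih =>
      simp only [Finset.prod_insert ha]
      refine smoothSym_mul Hsm ?_ ih
      generalize m a = n
      induction n with
      | zero => simpa using smoothSym_one Hsm
      | succ n ih =>
        simp only [pow_succ]
        exact smoothSym_mul Hsm ih (smoothSym_ι Hsm (he a))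
  exact h Finset.univ

lemma exists_isSmoothFrame_of_fintype {F : ∀ x, Submodule 𝕜 (V.fib x)} {J : Type*} [Fintype J]
    (e : J → ∀ y, V.fib y) (h : ∀ᶠ y in 𝓝 x, LinearIndependent 𝕜 (fun j => e j y) ∧
      Submodule.span 𝕜 (Set.range fun j => e j y) = F y ∧
      ∀ f : J → X → 𝕜, V.SmoothAt (fun z => ∑ j, f j z • e j z) y ↔ ∀ j, sm (f j) y) :
    ∃ (r : ℕ) (e : Fin r → ∀ y, V.fib y), ∀ᶠ y in 𝓝 x, IsSmoothFrame sm V F e y := by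
  let η := Fintype.equivFin J
  refine ⟨Fintype.card J, fun i => e (η.symm i), ?_⟩
  filter_upwards [h] with y hy
  refine ⟨hy.1.comp _ η.symm.injective, ?_, fun f => ?_⟩
  · rw [← hy.2.1]
    congr 1
    exact η.symm.surjective.range_comp fun j => e j y
  · have h1 := hy.2.2 fun j => f (η j)
    have h2 : (fun z => ∑ j, f (η j) z • e j z) = fun z => ∑ i, f i z • e (η.symm i) z := by
      funext z
      exact (η.sum_comp fun i => f i z • e (η.symm i) z).symm ▸ by simp
    rw [h2] at h1
    exact h1.trans ⟨fun h i => by simpa using h (η.symm i), fun h j => h (η j)⟩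

end SymSections

/-! ### Tensor products of functionals and of monomials -/

section Tensor

lemma MultilinearMap.apply_mem_span_range {R ι : Type*} [CommSemiring R] [Fintype ι]
    {N : ι → Type*} [∀ i, AddCommMonoid (N i)] [∀ i, Module R (N i)] {P : Type*}
    [AddCommMonoid P] [Module R P] (f : MultilinearMap R N P) {κ : ι → Type*} [∀ i, Fintype (κ i)]
    (g : ∀ i, κ i → N i) {w : ∀ i, N i} (hw : ∀ i, w i ∈ Submodule.span R (Set.range (g i))) :
    f w ∈ Submodule.span R (Set.range fun j : ∀ i, κ i => f fun i => g i (j i)) := by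
  classical
  choose c hc using fun i => (Submodule.mem_span_range_iff_exists_fun R).1 (hw i)
  have : w = fun i => ∑ j, c i j • g i j := funext fun i => (hc i).symm
  rw [this, MultilinearMap.map_sum]
  refine Submodule.sum_mem _ fun j _ => ?_
  rw [MultilinearMap.map_smul_univ f (fun i => c i (j i)) fun i => g i (j i)]
  exact Submodule.smul_mem _ _ (Submodule.subset_span (Set.mem_range_self j))

variable {𝕜 : Type} [RCLike 𝕜] {M : Type u} {V : PreBundle.{u, v} 𝕜 M}

/-- The tensor product of linear functionals. -/
def tensorFunctional {z : Finset M}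
    (δ : ∀ c : {a : M // a ∈ z}, FibSym 𝕜 (V.fib c.1) →ₗ[𝕜] 𝕜) : ChFib V z →ₗ[𝕜] 𝕜 :=
  PiTensorProduct.lift ((MultilinearMap.mkPiAlgebra 𝕜 {a : M // a ∈ z} 𝕜).compLinearMap δ)

lemma tensorFunctional_tprod {z : Finset M}
    (δ : ∀ c : {a : M // a ∈ z}, FibSym 𝕜 (V.fib c.1) →ₗ[𝕜] 𝕜)
    (w : ∀ c : {a : M // a ∈ z}, FibSym 𝕜 (V.fib c.1)) :
    tensorFunctional δ (PiTensorProduct.tprod 𝕜 w) = ∏ c, δ c (w c) := by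
  rw [tensorFunctional, PiTensorProduct.lift.tprod, MultilinearMap.compLinearMap_apply,
    MultilinearMap.mkPiAlgebra_apply]

/-- The subspaces of bounded degree in the subspaces `F`. -/
def chFiltration (F : ∀ a, Submodule 𝕜 (V.fib a)) (n : ℕ) (y : Finset M) :
    Submodule 𝕜 (ChFib V y) :=
  Submodule.span 𝕜 {t | ∃ w : ∀ b : {b : M // b ∈ y}, FibSym 𝕜 (V.fib b.1),
    (∀ b, w b ∈ symFiltration 𝕜 (F b.1) n) ∧ t = PiTensorProduct.tprod 𝕜 w}

lemma tprod_mem_chFiltration {F : ∀ a, Submodule 𝕜 (V.fib a)} {n : ℕ} {y : Finset M}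
    {w : ∀ b : {b : M // b ∈ y}, FibSym 𝕜 (V.fib b.1)}
    (hw : ∀ b, w b ∈ symFiltration 𝕜 (F b.1) n) :
    (PiTensorProduct.tprod 𝕜 w : ChFib V y) ∈ chFiltration F n y :=
  Submodule.subset_span ⟨w, hw, rfl⟩

lemma chFiltration_mono {F F' : ∀ a, Submodule 𝕜 (V.fib a)} (hF : ∀ a, F a ≤ F' a) {n n' : ℕ}
    (hn : n ≤ n') (y : Finset M) : chFiltration F n y ≤ chFiltration F' n' y :=
  Submodule.span_mono fun _ ⟨w, hw, h⟩ => ⟨w, fun b => symFiltration_mono (hF b.1) hn (hw b), h⟩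

lemma exists_mem_chFiltration {F : ℕ → ∀ a, Submodule 𝕜 (V.fib a)}
    (hmono : ∀ x, Monotone fun n => F n x) (hexh : ∀ x (v : V.fib x), ∃ n, v ∈ F n x)
    {y : Finset M} (t : ChFib V y) : ∃ n, t ∈ chFiltration (F n) n y := by
  induction t using PiTensorProduct.induction_on with
  | smul_tprod c w =>
    choose N hN using fun b : {b : M // b ∈ y} =>
      exists_mem_symFiltration (hmono b.1) (hexh b.1) (w b)
    refine ⟨Finset.univ.sup N, Submodule.smul_mem _ _ (tprod_mem_chFiltration fun b => ?_)⟩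
    have := Finset.le_sup (f := N) (Finset.mem_univ b)
    exact symFiltration_mono (hmono b.1 this) this (hN b)
  | add a b ha hb =>
    obtain ⟨n, hn⟩ := ha
    obtain ⟨n', hn'⟩ := hb
    exact ⟨max n n',
      add_mem (chFiltration_mono (fun a => hmono a (le_max_left n n')) (le_max_left n n') y hn)
        (chFiltration_mono (fun a => hmono a (le_max_right n n')) (le_max_right n n') y hn')⟩

/-- The tensor products of monomials in the vectors `e a i`, where `a = q b` at the point `b`. -/
def chMonomial {r : M → ℕ} (e : ∀ a, Fin (r a) → ∀ y, V.fib y) (q : M → M)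
    (m : ∀ a, Fin (r a) → ℕ) (y : Finset M) : ChFib V y :=
  PiTensorProduct.tprod 𝕜 fun b : {b : M // b ∈ y} =>
    symMonomial 𝕜 (fun i => e (q b.1) i b.1) (m (q b.1))

variable {r : M → ℕ} {e : ∀ a, Fin (r a) → ∀ y, V.fib y}

lemma chMonomial_congr {q q' : M → M} (m : ∀ a, Fin (r a) → ℕ) {y : Finset M}
    (h : ∀ b ∈ y, q b = q' b) : chMonomial e q m y = chMonomial e q' m y := by
  unfold chMonomial
  congr 1
  funext b
  rw [h b.1 b.2]

open Classical in
/-- Exponents at the points of `x`, extended by zero. -/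
def extendExponents {x : Finset M} {n : ℕ} (m : ∀ a : {a : M // a ∈ x}, Exponents (r a.1) n)
    (a : M) : Exponents (r a) n :=
  if h : a ∈ x then m ⟨a, h⟩ else ⟨0, by simp⟩

lemma extendExponents_apply {x : Finset M} {n : ℕ}
    (m : ∀ a : {a : M // a ∈ x}, Exponents (r a.1) n) (a : {a : M // a ∈ x}) :
    extendExponents m a.1 = m a := dif_pos a.2

open Classical in
-- The value is a product of Kronecker deltas over the points of `z`. Surjectivity onto `x`
-- guarantees that any point where `m` and `m'` differ contributes a zero factor.
lemma tensorFunctional_chMonomial {x z : Finset M} {n : ℕ} {q : M → M} (hq : Set.SurjOn q z x)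
    {l : ∀ c : {c : M // c ∈ z}, V.fib c.1 →ₗ[𝕜] (Fin (r (q c.1)) → 𝕜)}
    (hl : ∀ c i, l c (e (q c.1) i c.1) = Pi.single i 1)
    (m m' : ∀ a : {a : M // a ∈ x}, Exponents (r a.1) n) :
    tensorFunctional (fun c => symCoeff (l c) (extendExponents m (q c.1)).1)
      (chMonomial e q (fun a => (extendExponents m' a).1) z) = if m = m' then 1 else 0 := by
  rw [chMonomial, tensorFunctional_tprod]
  simp only [symCoeff_symMonomial (hl _)]
  by_cases hm : m = m'
  · simp [hm]
  rw [if_neg hm]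
  obtain ⟨a, ha⟩ := Function.ne_iff.1 hm
  obtain ⟨c, hc, hca⟩ := hq a.2
  refine Finset.prod_eq_zero (Finset.mem_univ ⟨c, hc⟩) (if_neg fun h1 => ha ?_)
  obtain ⟨a, _⟩ := a
  subst hca
  rw [← extendExponents_apply m, ← extendExponents_apply m']
  exact Subtype.ext h1

lemma span_chMonomial {F : ∀ a, Submodule 𝕜 (V.fib a)} {x y : Finset M} {ρ : M → M}
    (hρ : Set.BijOn ρ y x) (n : ℕ)
    (he : ∀ b ∈ y, Submodule.span 𝕜 (Set.range fun i => e (ρ b) i b) = F b) :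
    Submodule.span 𝕜 (Set.range fun m : ∀ a : {a : M // a ∈ x}, Exponents (r a.1) n =>
      chMonomial e ρ (fun a => (extendExponents m a).1) y) = chFiltration F n y := by
  refine le_antisymm (Submodule.span_le.2 ?_) (Submodule.span_le.2 ?_)
  · rintro _ ⟨m, rfl⟩
    refine tprod_mem_chFiltration fun b => ?_
    refine symFiltration_mono le_rfl (extendExponents m (ρ b.1)).2
      (symMonomial_mem_symFiltration (fun i => ?_) _)
    rw [← he b.1 b.2]
    exact Submodule.subset_span (Set.mem_range_self i)
  · rintro _ ⟨w, hw, rfl⟩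
    have hw' : ∀ b : {b : M // b ∈ y}, w b ∈ Submodule.span 𝕜 (Set.range
        fun m : Exponents (r (ρ b.1)) n => symMonomial 𝕜 (fun i => e (ρ b.1) i b.1) m.1) :=
      fun b => by
        rw [← symFiltration_eq_span, he b.1 b.2]
        exact hw b
    refine Submodule.span_mono ?_ (MultilinearMap.apply_mem_span_range (PiTensorProduct.tprod 𝕜)
      (fun (b : {b : M // b ∈ y}) (m : Exponents (r (ρ b.1)) n) =>
        symMonomial 𝕜 (fun i => e (ρ b.1) i b.1) m.1) hw')
    rintro _ ⟨μ, rfl⟩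
    let η : {b : M // b ∈ y} ≃ {a : M // a ∈ x} :=
      Equiv.ofBijective (fun b => ⟨ρ b.1, hρ.mapsTo b.2⟩)
        ⟨fun b b' h => Subtype.ext (hρ.injOn b.2 b'.2 (congrArg Subtype.val h)), fun a => by
          obtain ⟨b, hb, h⟩ := hρ.surjOn a.2
          exact ⟨⟨b, hb⟩, Subtype.ext h⟩⟩
    refine ⟨Equiv.piCongrLeft (fun a : {a : M // a ∈ x} => Exponents (r a.1) n) η μ, ?_⟩
    simp only [chMonomial]
    congr 1
    funext b
    congr 2
    exact (extendExponents_apply _ (η b)).trans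
      (Equiv.piCongrLeft_apply_apply (fun a : {a : M // a ∈ x} => Exponents (r a.1) n) η μ b)

end Tensor

/-! ### Local frames of the Cauchy-Hadamard bundle -/

section VectorBundle

variable {𝕜 : Type} [RCLike 𝕜]
  {E : Type*} [NormedAddCommGroup E] [NormedSpace ℝ E] {H : Type*} [TopologicalSpace H]
  (I : ModelWithCorners ℝ E H) {M : Type u} [TopologicalSpace M] [ChartedSpace H M]
  [T2Space M] {V : PreBundle.{u, v} 𝕜 M} {F : ℕ → ∀ x, Submodule 𝕜 (V.fib x)}
  (hmono : ∀ x, Monotone fun n => F n x)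
  (hloc : ∀ (s : ∀ x, V.fib x) (x : M), V.SmoothAt s x → ∃ n, ∀ᶠ y in 𝓝 x, s y ∈ F n y)

include hmono hloc in
-- On a pure tensor section the functional is a product over the points of coefficients of the
-- factors, and `ρ` is constant near each point, so a single family `l a` is used there. The bound
-- is the maximum of those at the points of `y`.
lemma SmoothCh.exists_smooth_tensorFunctional {s : ∀ y, ChFib V y} {y : Finset M}
    (hs : SmoothCh I V s y) {ρ : M → M} (hρ : IsLocalRetraction ρ y) :
    ∃ N₀, ∀ N ≥ N₀, ∀ (r : M → ℕ) (l : ∀ a c, V.fib c →ₗ[𝕜] (Fin (r a) → 𝕜)),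
      (∀ a ∈ y, IsSmoothOn (SmoothM 𝕜 I) V (F N) (l a) a) → ∀ m : ∀ a, Fin (r a) → ℕ,
        SmoothU 𝕜 I (fun z => tensorFunctional
          (fun c : {c : M // c ∈ z} => symCoeff (l (ρ c.1) c.1) (m (ρ c.1))) (s z)) y := by
  have Hu := isSmoothAlgebra_smoothU (𝕜 := 𝕜) (M := M) I
  have Hm := isSmoothAlgebra_smoothM (𝕜 := 𝕜) (M := M) I
  refine GenSmoothAt.induction (motive := fun s => ∃ N₀, ∀ N ≥ N₀, ∀ (r : M → ℕ)
      (l : ∀ a c, V.fib c →ₗ[𝕜] (Fin (r a) → 𝕜)),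
      (∀ a ∈ y, IsSmoothOn (SmoothM 𝕜 I) V (F N) (l a) a) → ∀ m : ∀ a, Fin (r a) → ℕ,
        SmoothU 𝕜 I (fun z => tensorFunctional
          (fun c : {c : M // c ∈ z} => symCoeff (l (ρ c.1) c.1) (m (ρ c.1))) (s z)) y)
    ?_ ?_ ?_ ?_ ?_ hs
  · rintro s t h ⟨N, hN⟩
    refine ⟨N, fun N' hN' r l hl m => Hu.congr (hN N' hN' r l hl m) ?_⟩
    filter_upwards [h] with y hy using by rw [hy]
  · exact ⟨0, fun N _ r l _ m => by simpa using Hu.const 0 y⟩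
  · rintro s t ⟨N, hN⟩ ⟨N', hN'⟩
    refine ⟨max N N', fun n hn r l hl m => ?_⟩
    simp only [map_add]
    exact Hu.add (hN n ((le_max_left N N').trans hn) r l hl m)
      (hN' n ((le_max_right N N').trans hn) r l hl m)
  · rintro f s hf ⟨N, hN⟩
    refine ⟨N, fun n hn r l hl m => ?_⟩
    simp only [map_smul, smul_eq_mul]
    exact Hu.mul hf (hN n hn r l hl m)
  · rintro _ ⟨w, hw, rfl⟩
    choose N hN using fun a : {a : M // a ∈ y} =>
      SmoothSym.exists_smooth_symCoeff Hm hmono hloc (hw a.1 a.2)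
    refine ⟨Finset.univ.sup N, fun n hn r l hl m => ?_⟩
    have h : ∀ a ∈ y, SmoothM 𝕜 I (fun c => symCoeff (l (ρ c) c) (m (ρ c)) (w c)) a :=
      fun a ha => by
        refine Hm.congr (hN ⟨a, ha⟩ n ((Finset.le_sup (Finset.mem_univ _)).trans hn) (r a) (l a)
          (hl a ha) (m a)) ?_
        filter_upwards [hρ a ha] with c hc
        rw [hc]
    refine Hu.congr (SmoothU.finset_prod I h) (Filter.Eventually.of_forall fun z => ?_)
    rw [tensorFunctional_tprod]
    exact (Finset.prod_coe_sort z fun c => symCoeff (l (ρ c) c) (m (ρ c)) (w c)).symm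

include hmono hloc in
lemma SmoothCh.exists_mem_chFiltration {s : ∀ y, ChFib V y} {x : Finset M}
    (hs : SmoothCh I V s x) : ∃ N, ∀ᶠ y in 𝓝 x, s y ∈ chFiltration (F N) N y := by
  refine GenSmoothAt.induction
    (motive := fun s => ∃ N, ∀ᶠ y in 𝓝 x, s y ∈ chFiltration (F N) N y)
    ?_ ?_ ?_ ?_ ?_ hs
  · rintro s t h ⟨N, hN⟩
    exact ⟨N, by filter_upwards [h, hN] with y h1 h2 using h1 ▸ h2⟩
  · exact ⟨0, Filter.Eventually.of_forall fun y => zero_mem _⟩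
  · rintro s t ⟨N, hN⟩ ⟨N', hN'⟩
    refine ⟨max N N', ?_⟩
    filter_upwards [hN, hN'] with y h1 h2
    exact add_mem
      (chFiltration_mono (fun a => hmono a (le_max_left N N')) (le_max_left N N') y h1)
      (chFiltration_mono (fun a => hmono a (le_max_right N N')) (le_max_right N N') y h2)
  · rintro f s _ ⟨N, hN⟩
    exact ⟨N, hN.mono fun y h => Submodule.smul_mem _ _ h⟩
  · rintro _ ⟨w, hw, rfl⟩
    choose N hN using fun a : {a : M // a ∈ x} =>
      SmoothSym.exists_mem_symFiltration hmono hloc (hw a.1 a.2)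
    refine ⟨Finset.univ.sup N, ?_⟩
    filter_upwards [eventually_forall_mem (x := x)
      (Q := fun c => w c ∈ symFiltration 𝕜 (F (Finset.univ.sup N) c) (Finset.univ.sup N))
      fun a ha => by
        have hle := Finset.le_sup (f := N) (Finset.mem_univ ⟨a, ha⟩)
        exact (hN ⟨a, ha⟩).mono fun c hc => symFiltration_mono (hmono c hle) hle hc] with y hy
    exact tprod_mem_chFiltration fun b => hy b.1 b.2

lemma smoothCh_chMonomial {r : M → ℕ} {e : ∀ a, Fin (r a) → ∀ y, V.fib y} {ρ : M → M}
    {y : Finset M} (hρ : ∀ c ∈ y, ∀ᶠ b in 𝓝 c, ρ b = ρ c)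
    (he : ∀ c ∈ y, ∀ i, V.SmoothAt (e (ρ c) i) c) (m : ∀ a, Fin (r a) → ℕ) :
    SmoothCh I V (chMonomial e ρ m) y := by
  refine smoothCh_tprod I (w := fun c => symMonomial 𝕜 (fun i => e (ρ c) i c) (m (ρ c)))
    fun c hc => ?_
  refine GenSmoothAt.congr
    (smoothSym_symMonomial (isSmoothAlgebra_smoothM I) (he c hc) (m (ρ c))) ?_
  filter_upwards [hρ c hc] with b hb
  rw [hb]

open Classical in
/-- Near every configuration, the monomials in local frames of `F n` are a local frame of
`chFiltration (F n) n`. -/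
lemma chMonomial_isFrame
    (hcongr : ∀ (s t : ∀ x, V.fib x) (x : M), (∀ᶠ y in 𝓝 x, s y = t y) → V.SmoothAt s x →
      V.SmoothAt t x)
    (hmono : ∀ x, Monotone fun n => F n x)
    (hloc : ∀ (s : ∀ x, V.fib x) (x : M), V.SmoothAt s x → ∃ n, ∀ᶠ y in 𝓝 x, s y ∈ F n y)
    (hframe : ∀ (n : ℕ) (x : M), ∃ (r : ℕ) (e : Fin r → ∀ y, V.fib y), ∀ᶠ y in 𝓝 x,
      IsSmoothFrame (SmoothM 𝕜 I) V (F n) e y) (n : ℕ)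
    {r : M → ℕ} {e : ∀ a, Fin (r a) → ∀ y, V.fib y} {ρ : M → M} {x y : Finset M}
    (hb : Set.BijOn ρ y x) (hρ : ∀ c ∈ y, ∀ᶠ b in 𝓝 c, ρ b = ρ c)
    (he : ∀ c ∈ y, ∀ᶠ b in 𝓝 c, IsSmoothFrame (SmoothM 𝕜 I) V (F n) (e (ρ c)) b) :
    LinearIndependent 𝕜 (fun m : ∀ a : {a : M // a ∈ x}, Exponents (r a.1) n =>
        chMonomial e ρ (fun a => (extendExponents m a).1) y) ∧
      Submodule.span 𝕜 (Set.range fun m : ∀ a : {a : M // a ∈ x}, Exponents (r a.1) n =>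
        chMonomial e ρ (fun a => (extendExponents m a).1) y) = chFiltration (F n) n y ∧
      ∀ f : (∀ a : {a : M // a ∈ x}, Exponents (r a.1) n) → Finset M → 𝕜,
        SmoothCh I V (fun z => ∑ m, f m z • chMonomial e ρ (fun a => (extendExponents m a).1) z) y ↔
          ∀ m, SmoothU 𝕜 I (f m) y := by
  classical
  have Hu := isSmoothAlgebra_smoothU (𝕜 := 𝕜) (M := M) I
  have Hm := isSmoothAlgebra_smoothM (𝕜 := 𝕜) (M := M) I
  refine ⟨?_, span_chMonomial hb n fun b hby => (he b hby).self_of_nhds.2.1, fun f =>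
    ⟨fun hf m => ?_, fun hf => ?_⟩⟩
  -- For independence in one fibre, functionals dual to the frames at the points of `y` suffice; no
  -- smoothness is involved.
  · choose κ hκ using fun c : {c : M // c ∈ y} =>
      exists_dual_of_linearIndependent (𝕜 := 𝕜) fun i => e (ρ c.1) i c.1
    refine Fintype.linearIndependent_iff.2 fun g hg m => ?_
    have h := congrArg
      (tensorFunctional fun c => symCoeff (κ c) (extendExponents m (ρ c.1)).1) hg
    simp only [map_sum, map_smul, map_zero, tensorFunctional_chMonomial hb.surjOn
      (l := κ) (fun c => hκ c (he c.1 c.2).self_of_nhds.1)] at h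
    simpa using h
  -- Coordinates are now tested at `y` instead of `x`, and `ρ` moves the points of `y`; the smooth
  -- functionals are centred at `y` and need a retraction onto it.
  · obtain ⟨ρ', hρ'⟩ := exists_isLocalRetraction y
    obtain ⟨N₀, hN₀⟩ := SmoothCh.exists_smooth_tensorFunctional I hmono hloc hf hρ'
    have hl : ∀ a, ∃ l : ∀ c, V.fib c →ₗ[𝕜] (Fin (r (ρ a)) → 𝕜), a ∈ y →
        (∀ᶠ c in 𝓝 a, ∀ i, l c (e (ρ a) i c) = Pi.single i 1) ∧
          IsSmoothOn (SmoothM 𝕜 I) V (F (max N₀ n)) l a := fun a => by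
      by_cases ha : a ∈ y
      -- The section lies in the span of the `n`-th frame, but its presentation may use sections of
      -- `F N₀`. The dual functionals are therefore made smooth on a subbundle containing both.
      · obtain ⟨r', e', he'⟩ := hframe (max N₀ n) a
        obtain ⟨l, hl, hl'⟩ := exists_smooth_dual Hm (fun hf h => SmoothM.inv I hf h)
          (fun hf => SmoothM.continuousAt I hf) hcongr
          (fun c => hmono c (le_max_right N₀ n)) (he a ha) he'
        exact ⟨l, fun _ => ⟨hl, hl'⟩⟩
      · exact ⟨0, fun h => absurd h ha⟩
    choose l hl using hl
    refine Hu.congr (hN₀ _ (le_max_left N₀ n) (fun a => r (ρ a)) l (fun a ha => (hl a ha).2)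
      fun a => (extendExponents m (ρ a)).1) ?_
    have h1 : ∀ᶠ z : Finset M in 𝓝 y, ∀ c ∈ z, ρ (ρ' c) = ρ c ∧
        ∀ i, l (ρ' c) c (e (ρ (ρ' c)) i c) = Pi.single i 1 :=
      eventually_forall_mem fun a ha => by
        filter_upwards [hρ' a ha, hρ a ha, (hl a ha).1] with c h1 h2 h3
        rw [h1]
        exact ⟨h2.symm, h3⟩
    filter_upwards [h1, hρ'.eventually_bijOn] with z hz hbz
    -- Near `y` the frame chosen through `ρ` agrees with the one chosen through `ρ ∘ ρ'`, to which
    -- the functionals centred at `y` are dual.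
    have h2 : ∀ m' : ∀ a : {a : M // a ∈ x}, Exponents (r a.1) n,
        chMonomial e ρ (fun a => (extendExponents m' a).1) z
          = chMonomial e (ρ ∘ ρ') (fun a => (extendExponents m' a).1) z := fun m' =>
      chMonomial_congr _ fun c hc => (hz c hc).1.symm
    simp only [h2, map_sum, map_smul]
    have h3 := fun m' => tensorFunctional_chMonomial (e := e) (q := ρ ∘ ρ') (n := n)
      (hb.surjOn.comp hbz.surjOn) (l := fun c : {c : M // c ∈ z} => l (ρ' c.1) c.1)
      (fun c i => (hz c.1 c.2).2 i) m m'
    refine (Finset.sum_congr rfl fun m' _ => congrArg (f m' z • ·) (h3 m')).trans ?_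
    simp
  · exact GenSmoothAt.sum _ fun m _ => GenSmoothAt.smul Hu (hf m) (smoothCh_chMonomial I hρ
      (fun c hc i => (he c hc).self_of_nhds.smoothAt Hm i) _)

/-- A single index bounds both the degree at each point and the subbundle of `V`, which yields an
increasing sequence of finite rank. The frame built at `x` serves all nearby `y`, because `ρ`
identifies their points with those of `x` and is locally constant at them. -/
theorem isVectorBundle_chBundle (hV : IsVectorBundle (SmoothM 𝕜 I) V) :
    IsVectorBundle (SmoothU 𝕜 I) (chBundle I V) := by
  classical
  obtain ⟨hcongr, F, hmono, hexh, hloc, hframe⟩ := hV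
  refine ⟨fun s t x h (hs : SmoothCh I V s x) => (GenSmoothAt.congr hs h : SmoothCh I V t x),
    fun n => chFiltration (F n) n,
    fun x n n' h => chFiltration_mono (fun a => hmono a h) h x,
    fun x v => exists_mem_chFiltration hmono hexh v,
    fun s x hs => SmoothCh.exists_mem_chFiltration I hmono hloc hs, fun n x => ?_⟩
  choose r e he using fun a => hframe n a
  obtain ⟨ρ, hρ⟩ := exists_isLocalRetraction x
  refine exists_isSmoothFrame_of_fintype (V := chBundle I V)
    (fun (m : ∀ a : {a : M // a ∈ x}, Exponents (r a.1) n) =>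
      chMonomial e ρ fun a => (extendExponents m a).1) ?_
  have h1 : ∀ᶠ y : Finset M in 𝓝 x, ∀ c ∈ y,
      ∀ᶠ b in 𝓝 c, IsSmoothFrame (SmoothM 𝕜 I) V (F n) (e (ρ c)) b :=
    eventually_forall_mem fun a ha => by
      filter_upwards [hρ a ha, (he a).eventually_nhds] with c hc h
      rw [hc]
      exact h
  filter_upwards [h1, hρ.eventually, hρ.eventually_bijOn] with y h1 h2 h3
  exact chMonomial_isFrame I hcongr hmono hloc hframe n h3 h2 h1

end VectorBundle

end

/-! ### The Poisson 2-algebra structure -/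

theorem mainTheorem1 {𝕜 : Type} [RCLike 𝕜]
    {E : Type*} [NormedAddCommGroup E] [NormedSpace ℝ E] [FiniteDimensional ℝ E]
    {H : Type*} [TopologicalSpace H] (I : ModelWithCorners ℝ E H) [I.Boundaryless]
    {M : Type*} [TopologicalSpace M] [T2Space M] [ChartedSpace H M] [IsManifold I ∞ M]
    (V : PreBundle 𝕜 M) (hV : IsVectorBundle (SmoothM 𝕜 I) V)
    (k : ∀ w : Finset M, (cauchy (SmoothU 𝕜 I) (pushforward V) (pushforward V)).fib w →ₗ[𝕜]
      (trivialLine (SmoothU 𝕜 I)).fib w)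
    (hk : IsBundleMap (V := cauchy (SmoothU 𝕜 I) (pushforward V) (pushforward V))
      (W := trivialLine (SmoothU 𝕜 I)) k)
    (hk' : IsAntisymmetricKernel (SmoothU 𝕜 I) V k) :
    ∃ br : ∀ w : Finset M,
        (cauchy (SmoothU 𝕜 I) (cauchyHadamard (SmoothM 𝕜 I) (SmoothU 𝕜 I) V)
          (cauchyHadamard (SmoothM 𝕜 I) (SmoothU 𝕜 I) V)).fib w →ₗ[𝕜]
        (cauchyHadamard (SmoothM 𝕜 I) (SmoothU 𝕜 I) V).fib w,
      IsPoissonTwoAlgebraBundle (SmoothU 𝕜 I) (cauchyHadamard (SmoothM 𝕜 I) (SmoothU 𝕜 I) V)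
        (chMulH (SmoothM 𝕜 I) (SmoothU 𝕜 I) V) (chUnitH (SmoothM 𝕜 I) (SmoothU 𝕜 I) V)
        (chMulC (SmoothM 𝕜 I) (SmoothU 𝕜 I) V) (chUnitC (SmoothM 𝕜 I) (SmoothU 𝕜 I) V) br ∧
      IsKernelBracket (SmoothM 𝕜 I) (SmoothU 𝕜 I) V k br ∧
      ∀ br', IsKernelBracket (SmoothM 𝕜 I) (SmoothU 𝕜 I) V k br' → br' = br := by
  have hP := isVectorBundle_chBundle I hV
  have hbr := isBundleMap_kernelBracket I k hV hk
  exact ⟨kernelBracket V (SmoothM 𝕜 I) (SmoothU 𝕜 I) k,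
    { isVectorBundle := hP
      smooth_mH := isBundleMap_chMulH I
      smooth_uH := isBundleMap_chUnitH I
      smooth_mC := isBundleMap_chMulC I
      smooth_uC := isBundleMap_chUnitC I
      assoc_mH := fun x a b c => mul_assoc (G := ChFib V x) a b c
      comm_mH := fun x a b => mul_comm (G := ChFib V x) a b
      unit_mH := fun x a => by
        rw [chUnitH_one]
        exact ⟨one_mul (M := ChFib V x) a, mul_one (M := ChFib V x) a⟩
      assoc_mC := fun hxy hyz h h' a b c => chMulC_assoc _ _ _ hxy hyz h h' a b c
      comm_mC := fun h a b => chMulC_comm _ _ _ h a b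
      unit_mC := fun h a => by
        rw [chMulC_comm _ _ _ h.symm]
        exact ⟨chMulC_unit_left _ _ _ h a, chMulC_unit_left _ _ _ h a⟩
      interchange := fun h a b c d => chMulC_interchange _ _ _ h a b c d
      mC_uH := fun h => chMulC_chUnitH _ _ _ h
      mH_uC := by
        rw [chUnitC_empty, chUnitH_one]
        exact mul_one (M := ChFib V ∅) 1
      uC_eq_uH := chUnitC_empty _ _ _
      smooth_br := hbr
      antisymm := fun h a b => kernelBracket_antisymm _ _ _ k hk' h a b
      jacobi := fun hxy hyz hzx h₁ h₂ h₃ a b c =>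
        kernelBracket_jacobi _ _ _ k hk' hxy hyz hzx h₁ h₂ h₃ a b c
      leibniz_mC := (isKernelBracket_kernelBracket V _ _ k).leibnizC_right
      leibniz_mH := (isKernelBracket_kernelBracket V _ _ k).leibnizH_right },
    isKernelBracket_kernelBracket V _ _ k,
    fun br' h => IsKernelBracket.unique V _ _ k h (isKernelBracket_kernelBracket V _ _ k)⟩
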